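/- Let $T$ be a finite tree with start vertex (root) $v_s$ and non-negative real weights $w_v$ on the vertices and $w_e$ on the edges. A single group of $K$ agents starts at $v_s$ and walks along the edges of $T$; at the first visit of a vertex $v$ (including $v_s$ at the start) $w_v$ agents must be available and are left at $v$ for good, and an edge $e$ may only be crossed by at least $w_e$ non-settled agents. In the return variant a strategy is a walk from $v_s$ back to $v_s$ that visits all vertices and can be executed in this way; it is optimal if $K$ is as small as possible for all such walks, and this $K$ is the optimal number of agents. An optimal visiting order of the leaves is the order of first visits of the leaves in some optimal strategy. For a leaf $b\ne v_s$ let $e(b)$ be the edge of maximal weight on the path from $v_s$ to $b$, the one closest to $v_s$ if there are several, and let $v(b)$ be its end vertex farther from $v_s$. For each edge $e$ that occurs as some $e(b)$, the collected subtree dominated by $e$ is the union of the paths from $v(b)$ to $b$ over all leaves $b$ with $e(b)=e$; its root is $v(b)$. **Theorem.** (1) The collected subtrees are pairwise disjoint. They can be listed by decreasing weight of their dominating edges, and each of them can be explored by a closed walk from its root, inside it, that visits all its vertices (for example a depth-first walk, which takes $2(m-1)$ steps in a subtree with $m$ vertices). For every such list (equal weights in any order) and every choice of such closed walks, the following strategy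 is optimal: treat the subtrees in the order of the list, for each one going from $v_s$ to its root, exploring it completely by the chosen closed walk, and going back to $v_s$. (2) Let $n$ be the number of vertices, and let a rooted tree be given by the predecessor of each vertex, the vertex weights, and the weight of each vertex's incoming edge. (a) For real weights, an optimal visiting order of the leaves together with the optimal number of agents can be computed in $O(n\log n)$ time on a real random access machine (unit cost arithmetic and comparisons of reals, no rounding, indices of $O(\log n)$ bits). Conversely, any program of such a machine (with indices of any length) that computes an optimal visiting order of the leaves, even only for trees with positive weights, takes $\Omega(n\log n)$ time in the worst case. In the algebraic decision tree model, for every $n\ge 3$ there is a rooted tree with $n$ vertices such that any algebraic decision tree (with polynomial tests of any degree) that computes an optimal visiting order of its leaves for all positive real weights has depth $\Omega(n\log n)$. (b) For non-negative integer weights of at most $(n+1)^k$, an optimal visiting order of the leaves together with the optimal number of agents can be computed in $O((k+1)\,n)$ time, by one program for all $k$ and with a constant independent of $k$, on a unit-cost random access machine with words of $O((k+1)\log (n+1))$ bits. Conversely, for every $k$, any program that computes an optimal visiting order of the leaves for these weights takes $\Omega(n)$ time in the worst case. Hence the time is $\Theta(n)$ for integer weights that are polynomially bounded in $n$. -/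

import Mathlib

/-! ## Weighted rooted trees and deployment by a single group -/

/-- A tree with a start vertex `root`, non-negative vertex weights `vw` and non-negative edge
weights `ew` (only the values of `ew` on edges of the tree are ever used). -/
structure WTree (V : Type*) (R : Type*) [Zero R] [LE R] where
  graph : SimpleGraph V
  isTree : graph.IsTree
  root : V
  vw : V → R
  ew : Sym2 V → R
  vw_nonneg : ∀ v, 0 ≤ vw v
  ew_nonneg : ∀ e ∈ graph.edgeSet, 0 ≤ ew e

namespace WTree

/-- An integer-weighted tree regarded as a real-weighted tree. -/
def toReal {V : Type*} (T : WTree V ℕ) : WTree V ℝ where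
  graph := T.graph
  isTree := T.isTree
  root := T.root
  vw v := (T.vw v : ℝ)
  ew e := (T.ew e : ℝ)
  vw_nonneg _ := Nat.cast_nonneg _
  ew_nonneg _ _ := Nat.cast_nonneg _

section Paths

variable {V : Type*} {R : Type*} [Zero R] [LE R]

/-- The unique path from the root to `v`. -/
noncomputable def path (T : WTree V R) (v : V) : T.graph.Walk T.root v :=
  (T.isTree.existsUnique_path T.root v).choose

/-- The predecessor of `v` on the path from the root (the root itself if `v` is the root). -/
noncomputable def parent (T : WTree V R) (v : V) : V := (T.path v).penultimate

open Classical in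
/-- The weight of the edge that enters `v` from its predecessor (`0` for the root). -/
noncomputable def inWeight (T : WTree V R) (v : V) : R :=
  if v = T.root then 0 else T.ew s(T.parent v, v)

/-- The weight of the edge that is crossed in step `i` of a walk. -/
def stepWeight (T : WTree V R) {u v : V} (S : T.graph.Walk u v) (i : ℕ) : R :=
  T.ew s(S.getVert i, S.getVert (i + 1))

/-- All weights are positive. -/
def Positive [LT R] (T : WTree V R) : Prop :=
  (∀ v, 0 < T.vw v) ∧ ∀ e ∈ T.graph.edgeSet, 0 < T.ew e

/-- All weights are at most `M`. -/
def BoundedBy (T : WTree V R) (M : R) : Prop :=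
  (∀ v, T.vw v ≤ M) ∧ ∀ e ∈ T.graph.edgeSet, T.ew e ≤ M

end Paths

section Deployment

variable {V : Type*} [DecidableEq V]

/-- The number of agents that are settled when the group has arrived at the `i`-th position of
the walk `S` and has covered it: every vertex visited so far holds its weight, once. -/
def settled (T : WTree V ℝ) {u v : V} (S : T.graph.Walk u v) (i : ℕ) : ℝ :=
  ∑ x ∈ (Finset.range (i + 1)).image S.getVert, T.vw x

/-- A single group that starts with `K` agents can execute the walk `S`: there are always enough
agents to cover a vertex at its first visit, and each edge is crossed by at least as many
non-settled agents as its weight. -/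
def Executes (T : WTree V ℝ) (K : ℝ) {u v : V} (S : T.graph.Walk u v) : Prop :=
  (∀ i ≤ S.length, T.settled S i ≤ K) ∧
    ∀ i < S.length, T.stepWeight S i ≤ K - T.settled S i

/-- The walk `S` from the root back to the root visits all vertices and can be executed with `K`
agents: a strategy for the return variant. -/
def IsStrategy (T : WTree V ℝ) (K : ℝ) (S : T.graph.Walk T.root T.root) : Prop :=
  (∀ v, v ∈ S.support) ∧ T.Executes K S

/-- `S`, executed with `K` agents, is an optimal strategy for the return variant. -/
def IsOptimalStrategy (T : WTree V ℝ) (K : ℝ) (S : T.graph.Walk T.root T.root) : Prop :=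
  T.IsStrategy K S ∧ ∀ K' S', T.IsStrategy K' S' → K ≤ K'

/-- `K` is the optimal number of agents for the return variant. -/
def IsOptimalNumber (T : WTree V ℝ) (K : ℝ) : Prop := ∃ S, T.IsOptimalStrategy K S

/-- A leaf of the rooted tree. The root is never one, even if it has only one neighbour. -/
def IsLeaf (T : WTree V ℝ) (b : V) : Prop := b ≠ T.root ∧ ∃! u, T.graph.Adj b u

/-- `l` lists the leaves in the order in which the walk `S` visits them first. -/
def IsLeafOrder (T : WTree V ℝ) (S : T.graph.Walk T.root T.root) (l : List V) : Prop :=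
  (∀ b, b ∈ l ↔ T.IsLeaf b) ∧ l.Pairwise fun b b' => S.support.idxOf b < S.support.idxOf b'

/-- `l` is the leaf order of some optimal strategy. -/
def IsOptimalLeafOrder (T : WTree V ℝ) (l : List V) : Prop :=
  ∃ K S, T.IsOptimalStrategy K S ∧ T.IsLeafOrder S l

/-! ### Collected subtrees -/

/-- `v` is the lower end vertex of the edge that dominates the leaf `b`: the edge of maximal weight
on the path from the root to `b`, and the one closest to the root if there are several. -/
def Dominates (T : WTree V ℝ) (v b : V) : Prop :=
  T.IsLeaf b ∧ ∃ j < (T.path b).length, v = (T.path b).getVert (j + 1) ∧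
    (∀ i < (T.path b).length, T.stepWeight (T.path b) i ≤ T.stepWeight (T.path b) j) ∧
    ∀ i < j, T.stepWeight (T.path b) i < T.stepWeight (T.path b) j

/-- `v` is the root of a collected subtree (whose dominating edge has weight `T.inWeight v`). -/
def IsCollectedRoot (T : WTree V ℝ) (v : V) : Prop := ∃ b, T.Dominates v b

/-- The vertex set of the collected subtree with root `v`: the union of the paths from `v` to the
leaves `b` that are dominated by the edge entering `v`. -/
def collected (T : WTree V ℝ) (v : V) : Set V :=
  {x | ∃ b, T.Dominates v b ∧ x ∈ (T.path b).support ∧ v ∈ (T.path x).support}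

/-- `L` lists the roots of all collected subtrees, by decreasing weight of dominating edges
(in an arbitrary order among equal weights). -/
def IsDecreasingList (T : WTree V ℝ) (L : List V) : Prop :=
  L.Nodup ∧ (∀ v, v ∈ L ↔ T.IsCollectedRoot v) ∧
    L.Pairwise fun u v => T.inWeight v ≤ T.inWeight u

/-- `c` starts and ends in the root `v` of a collected subtree, stays inside this subtree and
visits all of it. -/
def Explores (T : WTree V ℝ) {v : V} (c : T.graph.Walk v v) : Prop :=
  ∀ x, x ∈ c.support ↔ x ∈ T.collected v

/-- Treat the vertices `v` of the list one after the other: go from the start vertex to `v`, execute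
the closed walk `c v`, and go back to the start vertex. -/
noncomputable def tour (T : WTree V ℝ) (c : ∀ v, T.graph.Walk v v) :
    List V → T.graph.Walk T.root T.root
  | [] => .nil
  | v :: L => (T.path v).append ((c v).append ((T.path v).reverse.append (T.tour c L)))

end Deployment

end WTree

/-! ## A random access machine with natural and real numbers

A program works on variables and arrays of two kinds, natural and real. Natural numbers may be used
as array indices and may be converted to reals. Real numbers influence the natural ones only
through comparisons (there is no rounding). Each operation, comparison or memory access costs one
time unit. Natural numbers that are stored must not exceed the word bound of the machine. -/

namespace RAM

/-- The memory: natural variables and arrays, real variables and arrays. -/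
structure Mem where
  nv : ℕ → ℕ
  na : ℕ → ℕ → ℕ
  rv : ℕ → ℝ
  ra : ℕ → ℕ → ℝ

/-- Expressions with natural values; `get a e` reads entry `e` of the array `a`. -/
inductive NExp where
  | const (k : ℕ)
  | var (x : ℕ)
  | get (a : ℕ) (e : NExp)
  | add (e f : NExp)
  | sub (e f : NExp)
  | mul (e f : NExp)
  | div (e f : NExp)
  | mod (e f : NExp)

/-- Expressions with real values. -/
inductive RExp where
  | ofNat (e : NExp)
  | var (x : ℕ)
  | get (a : ℕ) (e : NExp)
  | add (e f : RExp)
  | sub (e f : RExp)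
  | mul (e f : RExp)
  | div (e f : RExp)

/-- Tests. -/
inductive Test where
  | ltN (e f : NExp)
  | eqN (e f : NExp)
  | ltR (e f : RExp)
  | eqR (e f : RExp)

/-- Programs. -/
inductive Prog where
  | skip
  | setN (x : ℕ) (e : NExp)
  | setR (x : ℕ) (e : RExp)
  | putN (a : ℕ) (i e : NExp)
  | putR (a : ℕ) (i : NExp) (e : RExp)
  | seq (p q : Prog)
  | ite (b : Test) (p q : Prog)
  | while (b : Test) (p : Prog)

def NExp.eval (m : Mem) : NExp → ℕ
  | .const k => k
  | .var x => m.nv x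
  | .get a e => m.na a (e.eval m)
  | .add e f => e.eval m + f.eval m
  | .sub e f => e.eval m - f.eval m
  | .mul e f => e.eval m * f.eval m
  | .div e f => e.eval m / f.eval m
  | .mod e f => e.eval m % f.eval m

noncomputable def RExp.eval (m : Mem) : RExp → ℝ
  | .ofNat e => (e.eval m : ℝ)
  | .var x => m.rv x
  | .get a e => m.ra a (e.eval m)
  | .add e f => e.eval m + f.eval m
  | .sub e f => e.eval m - f.eval m
  | .mul e f => e.eval m * f.eval m
  | .div e f => e.eval m / f.eval m

def Test.Holds (m : Mem) : Test → Prop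
  | .ltN e f => e.eval m < f.eval m
  | .eqN e f => e.eval m = f.eval m
  | .ltR e f => e.eval m < f.eval m
  | .eqR e f => e.eval m = f.eval m

def NExp.cost : NExp → ℕ
  | .const _ => 1
  | .var _ => 1
  | .get _ e => e.cost + 1
  | .add e f => e.cost + f.cost + 1
  | .sub e f => e.cost + f.cost + 1
  | .mul e f => e.cost + f.cost + 1
  | .div e f => e.cost + f.cost + 1
  | .mod e f => e.cost + f.cost + 1

def RExp.cost : RExp → ℕ
  | .ofNat e => e.cost + 1
  | .var _ => 1
  | .get _ e => e.cost + 1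
  | .add e f => e.cost + f.cost + 1
  | .sub e f => e.cost + f.cost + 1
  | .mul e f => e.cost + f.cost + 1
  | .div e f => e.cost + f.cost + 1

def Test.cost : Test → ℕ
  | .ltN e f => e.cost + f.cost + 1
  | .eqN e f => e.cost + f.cost + 1
  | .ltR e f => e.cost + f.cost + 1
  | .eqR e f => e.cost + f.cost + 1

def Mem.setN (m : Mem) (x k : ℕ) : Mem := { m with nv := Function.update m.nv x k }

noncomputable def Mem.setR (m : Mem) (x : ℕ) (r : ℝ) : Mem :=
  { m with rv := Function.update m.rv x r }

def Mem.putN (m : Mem) (a i k : ℕ) : Mem :=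
  { m with na := Function.update m.na a (Function.update (m.na a) i k) }

noncomputable def Mem.putR (m : Mem) (a i : ℕ) (r : ℝ) : Mem :=
  { m with ra := Function.update m.ra a (Function.update (m.ra a) i r) }

/-- `Runs B p m t m'`: with word bound `B`, the program `p` started in the memory `m` halts after
`t` time units in the memory `m'`. A program that would store a natural number above the word bound
does not halt in this sense. -/
inductive Runs (B : ℕ) : Prog → Mem → ℕ → Mem → Prop where
  | skip (m : Mem) : Runs B .skip m 1 m
  | setN (m : Mem) (x : ℕ) (e : NExp) (h : e.eval m ≤ B) :
      Runs B (.setN x e) m (e.cost + 1) (m.setN x (e.eval m))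
  | setR (m : Mem) (x : ℕ) (e : RExp) :
      Runs B (.setR x e) m (e.cost + 1) (m.setR x (e.eval m))
  | putN (m : Mem) (a : ℕ) (i e : NExp) (h : e.eval m ≤ B) :
      Runs B (.putN a i e) m (i.cost + e.cost + 1) (m.putN a (i.eval m) (e.eval m))
  | putR (m : Mem) (a : ℕ) (i : NExp) (e : RExp) :
      Runs B (.putR a i e) m (i.cost + e.cost + 1) (m.putR a (i.eval m) (e.eval m))
  | seq (p q : Prog) (m m₁ m₂ : Mem) (t₁ t₂ : ℕ) (h₁ : Runs B p m t₁ m₁)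
      (h₂ : Runs B q m₁ t₂ m₂) : Runs B (.seq p q) m (t₁ + t₂) m₂
  | iteTrue (b : Test) (p q : Prog) (m m₁ : Mem) (t : ℕ) (hb : b.Holds m)
      (h : Runs B p m t m₁) : Runs B (.ite b p q) m (b.cost + t) m₁
  | iteFalse (b : Test) (p q : Prog) (m m₁ : Mem) (t : ℕ) (hb : ¬ b.Holds m)
      (h : Runs B q m t m₁) : Runs B (.ite b p q) m (b.cost + t) m₁
  | whileTrue (b : Test) (p : Prog) (m m₁ m₂ : Mem) (t₁ t₂ : ℕ) (hb : b.Holds m)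
      (h₁ : Runs B p m t₁ m₁) (h₂ : Runs B (.while b p) m₁ t₂ m₂) :
      Runs B (.while b p) m (b.cost + t₁ + t₂) m₂
  | whileFalse (b : Test) (p : Prog) (m : Mem) (hb : ¬ b.Holds m) :
      Runs B (.while b p) m b.cost m

/-- An array of length `n`, continued by `0`. -/
def arr {R : Type*} [Zero R] {n : ℕ} (f : Fin n → R) (i : ℕ) : R :=
  if h : i < n then f ⟨i, h⟩ else 0

/-- The input for a tree with vertices `0, …, n - 1` and real weights: `n` in natural variable `0`,
the root in natural variable `1`, the predecessors in natural array `0`, the vertex weights in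
real array `0`, the weights of the incoming edges in real array `1`. The rest is `0`. -/
noncomputable def realInput {n : ℕ} (T : WTree (Fin n) ℝ) : Mem where
  nv x := if x = 0 then n else if x = 1 then (T.root : ℕ) else 0
  na a := if a = 0 then arr (fun v => (T.parent v : ℕ)) else 0
  rv := 0
  ra a := if a = 0 then arr T.vw else if a = 1 then arr T.inWeight else 0

/-- The input for a tree with integer weights. The vertex weights are in natural array `1`,
the weights of the incoming edges in natural array `2`. -/
noncomputable def natInput {n : ℕ} (T : WTree (Fin n) ℕ) : Mem where
  nv x := if x = 0 then n else if x = 1 then (T.root : ℕ) else 0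
  na a := if a = 0 then arr (fun v => (T.parent v : ℕ)) else if a = 1 then arr T.vw
    else if a = 2 then arr T.inWeight else 0
  rv := 0
  ra := 0

/-- Natural array `3` starts with an optimal visiting order of the leaves. -/
def HasOrder {n : ℕ} (T : WTree (Fin n) ℝ) (m : Mem) : Prop :=
  ∃ l : List (Fin n), T.IsOptimalLeafOrder l ∧
    ∀ (i : ℕ) (h : i < l.length), m.na 3 i = (l[i] : ℕ)

end RAM

/-! ## Algebraic decision trees -/

/-- A decision tree on the input variables `ι`: an inner node branches according to the sign of a
polynomial in the inputs (of any degree), a leaf holds an output. -/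
inductive DecTree (ι : Type*) (Out : Type*) where
  | out (o : Out)
  | test (p : MvPolynomial ι ℝ) (neg zero pos : DecTree ι Out)

namespace DecTree

variable {ι Out : Type*}

open Classical in
/-- The output for the input `x`. -/
noncomputable def eval (x : ι → ℝ) : DecTree ι Out → Out
  | .out o => o
  | .test p neg zero pos =>
    if MvPolynomial.eval x p < 0 then neg.eval x
    else if MvPolynomial.eval x p = 0 then zero.eval x
    else pos.eval x

/-- The maximal number of tests. -/
def depth : DecTree ι Out → ℕ
  | .out _ => 0
  | .test _ neg zero pos => max neg.depth (max zero.depth pos.depth) + 1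

end DecTree

/-! Let `key v` be the largest edge weight on the path from the root to `v`, and let `heavy w`
consist of the ancestors of all non-root vertices of key at least `w`. Consider the last moment at
which a strategy stands on a non-root vertex of key at least `w`. Its next step goes up across an
edge of weight at least `w`. By then all of `heavy w` is settled, because a walk from the root meets
every ancestor of a vertex before or when it reaches the vertex. So `w` plus the vertex weight of
`heavy w` bounds the number of agents from below, provided that some non-root vertex has key at
least `w` (`add_sum_le_of_isStrategy`).

This bound is met by every concatenation of closed walks from the root in order of decreasing
parameters `w`, if the walk with parameter `w` stays inside `heavy w` and crosses only edges of
weight at most `w` (`executes_concatWalks`). Collected subtrees, with the weight of the dominating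
edge as parameter, give walks of this kind; this is part (1) (`exists_isOptimalStrategy_tour`). The
same principle for round trips from the root to single leaves, by decreasing keys, gives an explicit
formula for the optimal number: a maximum over the leaves of the key plus the weight of all root
paths used so far (`isOptimalStrategy_leafWalk`).

Hence the algorithmic problem is to sort the leaves by key, apart from linear work. Heaviest edges
on root paths are found by climbing from each vertex to the nearest treated one and coming back
(`wp_dominators`); the formula is evaluated by settling each vertex once (`wp_agents`). Real keys
are sorted by a tournament in `O(n log n)` (`wp_tournamentSort`), natural keys of at most `(n + 1) ^
k` by a radix sort in base `n + 1` with at most `k + 1` passes (`wp_radixSort`).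

For the lower bounds with real weights, take a star with unit vertex weights whose edge weights are
consecutive numbers arranged by a permutation. Exactly one leaf order is optimal
(`eq_of_isOptimalLeafOrder_starTree`), so `m!` outputs are needed for `m` leaves. A decision tree of
depth `d` has at most `3 ^ d` outputs, whatever its polynomials. A machine program affects its
natural memory by reals only through tests, so the test outcomes determine the output and there are
at most `2 ^ t` results in time `t`. For integer weights the output alone forces linearly many
memory writes. -/

namespace WTree

/-! ### Ancestors, depth and keys in the rooted tree -/

section Rooted

variable {V : Type*} (T : WTree V ℝ)

lemma path_isPath (v : V) : (T.path v).IsPath :=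
  (T.isTree.existsUnique_path T.root v).choose_spec.1

lemma eq_path {v : V} {p : T.graph.Walk T.root v} (hp : p.IsPath) : p = T.path v :=
  (T.isTree.existsUnique_path T.root v).choose_spec.2 p hp

lemma path_root : T.path T.root = .nil := (T.eq_path .nil).symm

lemma parent_root : T.parent T.root = T.root := by
  rw [parent, path_root, SimpleGraph.Walk.penultimate_nil]

lemma path_not_nil {v : V} (hv : v ≠ T.root) : ¬ (T.path v).Nil :=
  fun h => hv h.eq.symm

lemma adj_parent {v : V} (hv : v ≠ T.root) : T.graph.Adj (T.parent v) v :=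
  SimpleGraph.Walk.adj_penultimate (T.path_not_nil hv)

lemma path_eq_concat {v : V} (hv : v ≠ T.root) :
    T.path v = (T.path (T.parent v)).concat (T.adj_parent hv) := by
  have hadj : T.graph.Adj (T.path v).penultimate v := T.adj_parent hv
  have hc : (T.path v).dropLast.concat hadj = T.path v := SimpleGraph.Walk.concat_dropLast hadj
  have h : (T.path v).dropLast.IsPath := by
    have := T.path_isPath v
    rw [← hc, SimpleGraph.Walk.concat_isPath_iff] at this
    exact this.1
  have h' : (T.path v).dropLast = T.path (T.parent v) := T.eq_path h
  rw [← h']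
  exact hc.symm

/-- `x` lies on the path from the root to `y`. -/
def Anc (x y : V) : Prop := x ∈ (T.path y).support

lemma anc_refl (x : V) : T.Anc x x := (T.path x).end_mem_support

lemma root_anc (x : V) : T.Anc T.root x := (T.path x).start_mem_support

lemma anc_root {x : V} : T.Anc x T.root ↔ x = T.root := by
  simp [Anc, path_root]

lemma anc_iff {x y : V} (hy : y ≠ T.root) : T.Anc x y ↔ x = y ∨ T.Anc x (T.parent y) := by
  unfold Anc
  rw [T.path_eq_concat hy, SimpleGraph.Walk.support_concat]
  simp [or_comm]

lemma Anc.parent {x y : V} (h : T.Anc x (T.parent y)) : T.Anc x y := by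
  by_cases hy : y = T.root
  · rwa [hy, T.parent_root, ← hy] at h
  · exact (T.anc_iff hy).2 (.inr h)

/-- Distance from the root. -/
noncomputable def depth (v : V) : ℕ := (T.path v).length

lemma depth_parent {v : V} (hv : v ≠ T.root) : T.depth v = T.depth (T.parent v) + 1 := by
  unfold depth
  conv_lhs => rw [T.path_eq_concat hv]
  simp

lemma rooted_induction {P : V → Prop} (h0 : P T.root)
    (h1 : ∀ v, v ≠ T.root → P (T.parent v) → P v) (v : V) : P v := by
  induction hd : T.depth v using Nat.strong_induction_on generalizing v with
  | _ d ih =>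
    by_cases hv : v = T.root
    · rwa [hv]
    · exact h1 v hv (ih _ (by rw [← hd, T.depth_parent hv]; omega) _ rfl)

variable {T} in
lemma Anc.trans {x y z : V} (h : T.Anc x y) (h' : T.Anc y z) : T.Anc x z := by
  induction z using T.rooted_induction with
  | h0 => rwa [T.anc_root.1 h'] at h
  | h1 z hz ih =>
    rcases (T.anc_iff hz).1 h' with rfl | h'
    · exact h
    · exact (ih h').parent

variable {T} in
lemma Anc.depth_le {x y : V} (h : T.Anc x y) : T.depth x ≤ T.depth y := by
  induction y using T.rooted_induction with
  | h0 => rw [T.anc_root.1 h]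
  | h1 y hy ih =>
    rcases (T.anc_iff hy).1 h with rfl | h
    · rfl
    · exact (ih h).trans (by rw [T.depth_parent hy]; omega)

variable {T} in
lemma Anc.eq_of_depth_le {x y : V} (h : T.Anc x y) (hd : T.depth y ≤ T.depth x) : x = y := by
  by_cases hy : y = T.root
  · subst hy; exact T.anc_root.1 h
  rcases (T.anc_iff hy).1 h with rfl | h
  · rfl
  · have := h.depth_le
    rw [T.depth_parent hy] at hd
    omega

/-- If `y` lies on the path to `x`, acyclicity makes it the penultimate vertex there. Otherwise the
path to `x`, prolonged by the edge, is the unique path to `y`. -/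
lemma parent_eq_or {x y : V} (h : T.graph.Adj x y) :
    (y ≠ T.root ∧ T.parent y = x) ∨ (x ≠ T.root ∧ T.parent x = y) := by
  by_cases hy : T.Anc y x
  · right
    have hx : x ≠ T.root := by
      rintro rfl
      exact h.ne (T.anc_root.1 hy).symm
    exact ⟨hx, (T.isTree.isAcyclic.eq_penultimate_of_adj_end (T.path_isPath x) h hy).symm⟩
  · left
    have hp : T.path y = (T.path x).concat h := (T.eq_path ((T.path_isPath x).concat hy h)).symm
    refine ⟨?_, by rw [parent, hp, SimpleGraph.Walk.penultimate_concat]⟩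
    rintro rfl
    exact hy (T.root_anc x)

lemma inWeight_of_ne {v : V} (hv : v ≠ T.root) : T.inWeight v = T.ew s(T.parent v, v) := by
  rw [inWeight, if_neg hv]

lemma inWeight_root : T.inWeight T.root = 0 := by rw [inWeight, if_pos rfl]

lemma inWeight_nonneg (v : V) : 0 ≤ T.inWeight v := by
  by_cases hv : v = T.root
  · rw [hv, inWeight_root]
  · rw [T.inWeight_of_ne hv]; exact T.ew_nonneg _ (T.adj_parent hv)

/-- The maximal weight of an edge on the path from the root to `v`. -/
noncomputable def key (v : V) : ℝ := ((T.path v).support.map T.inWeight).foldr max 0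

lemma key_root : T.key T.root = 0 := by simp [key, path_root, inWeight_root]

lemma foldr_max_append (l : List ℝ) {a b : ℝ} (ha : b ≤ a) :
    (l ++ [a]).foldr max b = max (l.foldr max b) a := by
  induction l with
  | nil => simp [ha]
  | cons c l ih => simp [ih, max_assoc]

lemma key_eq {v : V} (hv : v ≠ T.root) : T.key v = max (T.key (T.parent v)) (T.inWeight v) := by
  conv_lhs => rw [key, T.path_eq_concat hv]
  rw [SimpleGraph.Walk.support_concat, List.map_append]
  exact foldr_max_append _ (T.inWeight_nonneg v)

lemma inWeight_le_key (v : V) : T.inWeight v ≤ T.key v := by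
  by_cases hv : v = T.root
  · rw [hv, inWeight_root, key_root]
  · rw [T.key_eq hv]; exact le_max_right _ _

lemma key_nonneg (v : V) : 0 ≤ T.key v := (T.inWeight_nonneg v).trans (T.inWeight_le_key v)

variable {T} in
lemma Anc.key_le {x y : V} (h : T.Anc x y) : T.key x ≤ T.key y := by
  induction y using T.rooted_induction with
  | h0 => rw [T.anc_root.1 h]
  | h1 y hy ih =>
    rcases (T.anc_iff hy).1 h with rfl | h
    · rfl
    · exact (ih h).trans (by rw [T.key_eq hy]; exact le_max_left _ _)

/-- Moves edge weights to the lower end vertices, so that a step can be judged by `inWeight` and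
`key` according to its direction, down or up. -/
lemma stepWeight_eq {u v : V} (S : T.graph.Walk u v) {i : ℕ} (hi : i < S.length) :
    (S.getVert (i + 1) ≠ T.root ∧ T.parent (S.getVert (i + 1)) = S.getVert i ∧
      T.stepWeight S i = T.inWeight (S.getVert (i + 1))) ∨
    (S.getVert i ≠ T.root ∧ T.parent (S.getVert i) = S.getVert (i + 1) ∧
      T.stepWeight S i = T.inWeight (S.getVert i)) := by
  rcases T.parent_eq_or (S.adj_getVert_succ hi) with ⟨h, h'⟩ | ⟨h, h'⟩
  · left
    refine ⟨h, h', ?_⟩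
    rw [stepWeight, T.inWeight_of_ne h, h']
  · right
    refine ⟨h, h', ?_⟩
    rw [stepWeight, T.inWeight_of_ne h, h', Sym2.eq_swap]

/-- A step down adds only the new vertex to the set of ancestors of the current position, and a step
up adds nothing. Past its end the walk stands still. -/
lemma anc_mem_of_walk {v x : V} (S : T.graph.Walk T.root v) (i : ℕ) (h : T.Anc x (S.getVert i)) :
    ∃ j ≤ i, S.getVert j = x := by
  induction i with
  | zero =>
    rw [SimpleGraph.Walk.getVert_zero, anc_root] at h
    exact ⟨0, le_rfl, by simp [h]⟩
  | succ i ih =>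
    by_cases hi : i < S.length
    · rcases T.parent_eq_or (S.adj_getVert_succ hi) with ⟨h1, h2⟩ | ⟨h1, h2⟩
      · rcases (T.anc_iff h1).1 h with rfl | h
        · exact ⟨i + 1, le_rfl, rfl⟩
        · rw [h2] at h
          obtain ⟨j, hj, hj'⟩ := ih h
          exact ⟨j, hj.trans (Nat.le_succ i), hj'⟩
      · rw [← h2] at h
        obtain ⟨j, hj, hj'⟩ := ih h.parent
        exact ⟨j, hj.trans (Nat.le_succ i), hj'⟩
    · rw [S.getVert_of_length_le (by omega), ← S.getVert_of_length_le (i := i) (by omega)] at h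
      obtain ⟨j, hj, hj'⟩ := ih h
      exact ⟨j, hj.trans (Nat.le_succ i), hj'⟩

/-- The ancestors of the vertices that are only reached over an edge of weight at least `w`. -/
def heavy (w : ℝ) : Set V := {x | ∃ y, y ≠ T.root ∧ w ≤ T.key y ∧ T.Anc x y}

lemma heavy_anti {w w' : ℝ} (h : w' ≤ w) : T.heavy w ⊆ T.heavy w' := by
  rintro x ⟨y, h1, h2, h3⟩
  exact ⟨y, h1, h.trans h2, h3⟩

end Rooted

/-! ### The lower bound on the number of agents and the walks that attain it -/

section Bounds

variable {V : Type*} (T : WTree V ℝ)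

/-- Concatenation of closed walks. -/
def concatWalks {ι : Type*} (Q : ι → T.graph.Walk T.root T.root) :
    List ι → T.graph.Walk T.root T.root
  | [] => .nil
  | a :: l => (Q a).append (concatWalks Q l)

lemma mem_support_concatWalks {ι : Type*} (Q : ι → T.graph.Walk T.root T.root) (l : List ι)
    {x : V} : x ∈ (T.concatWalks Q l).support ↔ x = T.root ∨ ∃ a ∈ l, x ∈ (Q a).support := by
  induction l with
  | nil => simp [concatWalks]
  | cons a l ih =>
    rw [concatWalks, SimpleGraph.Walk.mem_support_append_iff, ih]
    constructor
    · rintro (h | h | ⟨b, hb, h⟩)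
      · exact .inr ⟨a, by simp, h⟩
      · exact .inl h
      · exact .inr ⟨b, by simp [hb], h⟩
    · rintro (h | ⟨b, hb, h⟩)
      · exact .inr (.inl h)
      · rcases List.mem_cons.1 hb with rfl | hb
        · exact .inl h
        · exact .inr (.inr ⟨b, hb, h⟩)

lemma stepWeight_append {u v w : V} (p : T.graph.Walk u v) (q : T.graph.Walk v w) (i : ℕ) :
    T.stepWeight (p.append q) i =
      if i < p.length then T.stepWeight p i else T.stepWeight q (i - p.length) := by
  unfold stepWeight
  rw [SimpleGraph.Walk.getVert_append, SimpleGraph.Walk.getVert_append]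
  split_ifs with h1 h2 h2
  · rfl
  · rw [show i + 1 = p.length by omega]; simp
  · omega
  · rw [show i + 1 - p.length = i - p.length + 1 by omega]

/-- Each step of a concatenation of closed walks belongs to one of them, and what has been visited
so far lies in this one or in earlier ones. -/
lemma concatWalks_step {ι : Type*} (Q : ι → T.graph.Walk T.root T.root) (l : List ι) {i : ℕ}
    (hi : i < (T.concatWalks Q l).length) : ∃ k, ∃ hk : k < l.length,
      (∃ j < (Q l[k]).length, T.stepWeight (T.concatWalks Q l) i = T.stepWeight (Q l[k]) j) ∧
      ∀ j ≤ i, ∃ k', ∃ hk' : k' < l.length, k' ≤ k ∧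
        (T.concatWalks Q l).getVert j ∈ (Q l[k']).support := by
  induction l generalizing i with
  | nil => simp [concatWalks] at hi
  | cons a l ih =>
    simp only [concatWalks] at hi ⊢
    have hfst : ∀ j, j ≤ (Q a).length →
        ((Q a).append (T.concatWalks Q l)).getVert j ∈ (Q a).support := by
      intro j hj
      rw [SimpleGraph.Walk.getVert_append']
      rw [if_pos hj]
      exact SimpleGraph.Walk.getVert_mem_support _ _
    by_cases h : i < (Q a).length
    · refine ⟨0, by simp, ⟨i, h, ?_⟩, fun j hj => ⟨0, by simp, le_rfl, hfst j (by omega)⟩⟩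
      rw [stepWeight_append, if_pos h]; rfl
    · rw [SimpleGraph.Walk.length_append] at hi
      obtain ⟨k, hk, ⟨j, hj, hj'⟩, h3⟩ := ih (i := i - (Q a).length) (by omega)
      refine ⟨k + 1, by simpa using hk, ⟨j, by simpa using hj, ?_⟩, fun j hj => ?_⟩
      · rw [stepWeight_append, if_neg h, hj']; rfl
      · by_cases hj2 : j ≤ (Q a).length
        · exact ⟨0, by simp, by omega, hfst j hj2⟩
        · obtain ⟨k', hk', h4, h5⟩ := h3 (j - (Q a).length) (by omega)
          refine ⟨k' + 1, by simpa using hk', by omega, ?_⟩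
          rw [SimpleGraph.Walk.getVert_append, if_neg (by omega)]
          simpa using h5

variable [DecidableEq V]


lemma settled_le {u v : V} (S : T.graph.Walk u v) (i : ℕ) (D : Finset V)
    (h : ∀ j ≤ i, S.getVert j ∈ D) : T.settled S i ≤ ∑ x ∈ D, T.vw x := by
  refine Finset.sum_le_sum_of_subset_of_nonneg ?_ fun _ _ _ => T.vw_nonneg _
  intro x hx
  simp only [Finset.mem_image, Finset.mem_range] at hx
  obtain ⟨j, hj, rfl⟩ := hx
  exact h j (by omega)

lemma le_settled {u v : V} (S : T.graph.Walk u v) (i : ℕ) (D : Finset V)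
    (h : ∀ x ∈ D, ∃ j ≤ i, S.getVert j = x) : ∑ x ∈ D, T.vw x ≤ T.settled S i := by
  refine Finset.sum_le_sum_of_subset_of_nonneg ?_ fun _ _ _ => T.vw_nonneg _
  intro x hx
  simp only [Finset.mem_image, Finset.mem_range]
  obtain ⟨j, hj, hj'⟩ := h x hx
  exact ⟨j, by omega, hj'⟩

/-- Every strategy leaves the part of the tree behind heavy edges for the last time over a
heavy edge, when this part has been settled completely. -/
lemma add_sum_le_of_isStrategy {K : ℝ} {S : T.graph.Walk T.root T.root} (hS : T.IsStrategy K S)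
    {w : ℝ} {z : V} (hz : z ≠ T.root) (hw : w ≤ T.key z) (D : Finset V)
    (hD : ∀ x ∈ D, x ∈ T.heavy w) : w + ∑ x ∈ D, T.vw x ≤ K := by
  classical
  -- Positions beyond a heavy edge; `t` below is the last of them. It is not the end of the walk,
  -- since the walk ends at the root.
  let P : ℕ → Prop := fun i => S.getVert i ≠ T.root ∧ w ≤ T.key (S.getVert i)
  obtain ⟨i₀, hi₀, hi₀'⟩ := SimpleGraph.Walk.mem_support_iff_exists_getVert.1 (hS.1 z)
  have hP₀ : P i₀ := by simp only [P, hi₀]; exact ⟨hz, hw⟩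
  set t := Nat.findGreatest P S.length with ht
  have hPt : P t := Nat.findGreatest_spec hi₀' hP₀
  have htl : t < S.length := by
    refine lt_of_le_of_ne (Nat.findGreatest_le _) fun h => hPt.1 ?_
    rw [h, S.getVert_length]
  have hmax : ∀ i ≤ S.length, P i → i ≤ t := fun i hi h => Nat.le_findGreatest hi h
  have hsucc : ¬ P (t + 1) := fun h => by have := hmax (t + 1) htl h; omega
  -- A step down cannot lower the key, so the step at time `t` goes up. If its edge were lighter
  -- than `w`, the key of the predecessor would still be at least `w`.
  have hstep : w ≤ T.stepWeight S t := by
    rcases T.stepWeight_eq S htl with ⟨h1, h2, h3⟩ | ⟨h1, h2, h3⟩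
    · refine absurd ⟨h1, ?_⟩ hsucc
      rw [T.key_eq h1, h2]
      exact hPt.2.trans (le_max_left _ _)
    · rw [h3]
      by_contra hlt
      have hk := hPt.2
      rw [T.key_eq h1, h2, le_max_iff, or_iff_left hlt] at hk
      refine hsucc ⟨fun h => ?_, hk⟩
      -- The predecessor could be the root, but its key is `0`; then `w ≤ 0` and no edge is lighter
      -- than `w`.
      rw [h, key_root] at hk
      exact hlt (hk.trans (T.inWeight_nonneg _))
  -- Each `y` that puts an element into `heavy w` is visited at some time, which is at most `t` by
  -- maximality; its ancestors are visited no later.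
  have hset : ∑ x ∈ D, T.vw x ≤ T.settled S t := by
    refine T.le_settled S t D fun x hx => ?_
    obtain ⟨y, hy1, hy2, hy3⟩ := hD x hx
    obtain ⟨i, hi, hi'⟩ := SimpleGraph.Walk.mem_support_iff_exists_getVert.1 (hS.1 y)
    have hit : i ≤ t := hmax i hi' (by simp only [P, hi]; exact ⟨hy1, hy2⟩)
    rw [← hi] at hy3
    obtain ⟨j, hj, hj'⟩ := T.anc_mem_of_walk S i hy3
    exact ⟨j, hj.trans hit, hj'⟩
  have := hS.2.2 t htl
  linarith

lemma sum_le_of_isStrategy {K : ℝ} {S : T.graph.Walk T.root T.root} (hS : T.IsStrategy K S)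
    (D : Finset V) : ∑ x ∈ D, T.vw x ≤ K := by
  refine le_trans (T.le_settled S S.length D fun x _ => ?_) (hS.2.1 S.length le_rfl)
  obtain ⟨i, hi, hi'⟩ := SimpleGraph.Walk.mem_support_iff_exists_getVert.1 (hS.1 x)
  exact ⟨i, hi', hi⟩

/-- A concatenation of closed walks in heavy parts of the tree, by decreasing weights, needs no
more agents than any strategy. -/
lemma executes_concatWalks [Fintype V] {ι : Type*} (Q : ι → T.graph.Walk T.root T.root)
    (w : ι → ℝ) (l : List ι) (hl : l.Pairwise fun a b => w b ≤ w a)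
    (hw : ∀ a ∈ l, ∃ z, z ≠ T.root ∧ w a ≤ T.key z)
    (hQ : ∀ a ∈ l, ∀ i < (Q a).length, T.stepWeight (Q a) i ≤ w a)
    (hQ' : ∀ a ∈ l, ∀ x ∈ (Q a).support, x ∈ T.heavy (w a)) {K : ℝ}
    {S : T.graph.Walk T.root T.root} (hS : T.IsStrategy K S) :
    T.Executes K (T.concatWalks Q l) := by
  classical
  refine ⟨fun i _ => ?_, fun i hi => ?_⟩
  · exact (T.settled_le _ i Finset.univ (by simp)).trans (T.sum_le_of_isStrategy hS _)
  · obtain ⟨k, hk, ⟨j, hj, hj'⟩, h3⟩ := T.concatWalks_step Q l hi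
    have hmem : l[k] ∈ l := List.getElem_mem hk
    obtain ⟨z, hz, hz'⟩ := hw _ hmem
    -- The bound is used for the whole of `heavy (w l[k])`. Earlier walks have larger parameters,
    -- hence smaller heavy sets, so everything visited so far lies in this set.
    have h1 := T.add_sum_le_of_isStrategy hS hz hz'
      (Finset.univ.filter fun x => x ∈ T.heavy (w l[k])) (by simp)
    have h2 : T.settled (T.concatWalks Q l) i ≤
        ∑ x ∈ Finset.univ.filter fun x => x ∈ T.heavy (w l[k]), T.vw x := by
      refine T.settled_le _ i _ fun j hj => ?_
      obtain ⟨k', hk', h4, h5⟩ := h3 j hj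
      simp only [Finset.mem_filter, Finset.mem_univ, true_and]
      refine T.heavy_anti ?_ (hQ' _ (List.getElem_mem hk') _ h5)
      rcases h4.lt_or_eq with h4 | rfl
      · exact List.pairwise_iff_getElem.1 hl _ _ hk' hk h4
      · exact le_rfl
    have h4 := hQ _ hmem j hj
    rw [hj']
    linarith

/-- A walk that is executable with the number of agents of any strategy is optimal for some
number of agents. -/
lemma exists_isOptimalStrategy {S : T.graph.Walk T.root T.root} (hS : ∀ v, v ∈ S.support)
    (h : ∀ K' S', T.IsStrategy K' S' → T.Executes K' S) : ∃ K, T.IsOptimalStrategy K S := by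
  classical
  -- All demands of the walk `S`. Their maximum is the least number of agents that can execute it.
  let A : Finset ℝ := (Finset.range (S.length + 1)).image (T.settled S) ∪
    (Finset.range S.length).image fun i => T.stepWeight S i + T.settled S i
  have hA : A.Nonempty := ⟨T.settled S 0, Finset.mem_union_left _ (Finset.mem_image_of_mem _ (by simp))⟩
  refine ⟨A.max' hA, ⟨hS, ⟨fun i hi => ?_, fun i hi => ?_⟩⟩, fun K' S' hS' => ?_⟩
  · exact A.le_max' _ (Finset.mem_union_left _ (Finset.mem_image_of_mem _ (by simpa using Nat.lt_succ_of_le hi)))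
  · have := A.le_max' (T.stepWeight S i + T.settled S i)
      (Finset.mem_union_right _ (Finset.mem_image.2 ⟨i, by simpa using hi, rfl⟩))
    linarith
  · obtain ⟨h1, h2⟩ := h K' S' hS'
    refine Finset.max'_le _ _ _ fun y hy => ?_
    simp only [A, Finset.mem_union, Finset.mem_image, Finset.mem_range] at hy
    rcases hy with ⟨i, hi, rfl⟩ | ⟨i, hi, rfl⟩
    · exact h1 i (by omega)
    · have := h2 i hi; linarith

end Bounds

end WTree

namespace WTree

/-! ### Leaves, round trips, and the formula for the optimal number -/

section Leaves

variable {V : Type*} (T : WTree V ℝ)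

lemma path_getVert {b : V} (i : ℕ) :
    T.path ((T.path b).getVert i) = (T.path b).take i :=
  (T.eq_path ((T.path_isPath b).take i)).symm

lemma depth_getVert {b : V} {i : ℕ} (hi : i ≤ (T.path b).length) :
    T.depth ((T.path b).getVert i) = i := by
  rw [depth, path_getVert, SimpleGraph.Walk.take_length, min_eq_left hi]


lemma getVert_succ_ne_root {b : V} {i : ℕ} (hi : i < (T.path b).length) :
    (T.path b).getVert (i + 1) ≠ T.root := by
  intro h
  have := T.depth_getVert (b := b) (i := i + 1) hi
  rw [h, depth, path_root] at this
  simp at this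

lemma stepWeight_path {b : V} {i : ℕ} (hi : i < (T.path b).length) :
    T.stepWeight (T.path b) i = T.inWeight ((T.path b).getVert (i + 1)) := by
  rcases T.stepWeight_eq (T.path b) hi with h | ⟨h1, h2, -⟩
  · exact h.2.2
  · have := T.depth_parent h1
    rw [h2, T.depth_getVert hi.le, T.depth_getVert hi] at this
    omega

lemma Anc.exists_getVert {x b : V} (h : T.Anc x b) (hx : x ≠ T.root) :
    ∃ j < (T.path b).length, x = (T.path b).getVert (j + 1) := by
  obtain ⟨j, hj, hj'⟩ := SimpleGraph.Walk.mem_support_iff_exists_getVert.1 h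
  cases j with
  | zero => exact absurd (by simpa using hj.symm) hx
  | succ j => exact ⟨j, hj', hj.symm⟩

lemma anc_total {x y b : V} (hx : T.Anc x b) (hy : T.Anc y b) : T.Anc x y ∨ T.Anc y x := by
  induction b using T.rooted_induction with
  | h0 =>
    rw [T.anc_root.1 hx]
    exact .inl (T.root_anc y)
  | h1 b hb ih =>
    rcases (T.anc_iff hb).1 hx with rfl | hx'
    · exact .inr hy
    · rcases (T.anc_iff hb).1 hy with rfl | hy'
      · exact .inl hx
      · exact ih hx' hy'

/-- Along a walk among ancestors of vertices `b`, the steps have weights at most `key b`. -/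
lemma stepWeight_le {u v : V} (S : T.graph.Walk u v) {w : ℝ}
    (h : ∀ x ∈ S.support, T.inWeight x ≤ w) {i : ℕ} (hi : i < S.length) :
    T.stepWeight S i ≤ w := by
  rcases T.stepWeight_eq S hi with ⟨-, -, h'⟩ | ⟨-, -, h'⟩ <;> rw [h'] <;>
    exact h _ (S.getVert_mem_support _)

/-- A neighbour is the predecessor or a successor, and depth tells the two apart. This is the
criterion that the programs test. -/
lemma isLeaf_iff {b : V} :
    T.IsLeaf b ↔ b ≠ T.root ∧ ∀ v, v ≠ T.root → T.parent v ≠ b := by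
  constructor
  · rintro ⟨hb, u, -, hu⟩
    refine ⟨hb, fun v hv hvb => ?_⟩
    have h1 := hu _ (T.adj_parent hb).symm
    have h2 := hu v (hvb ▸ T.adj_parent hv)
    have h3 := T.depth_parent hb
    have h4 := T.depth_parent hv
    rw [h1, ← h2] at h3
    rw [hvb] at h4
    omega
  · rintro ⟨hb, h⟩
    refine ⟨hb, T.parent b, (T.adj_parent hb).symm, fun u hu => ?_⟩
    rcases T.parent_eq_or hu with ⟨h1, h2⟩ | ⟨-, h2⟩
    · exact absurd h2 (h u h1)
    · exact h2.symm

variable {T} in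
lemma IsLeaf.eq_of_anc {b y : V} (hb : T.IsLeaf b) (h : T.Anc b y) : y = b := by
  induction y using T.rooted_induction with
  | h0 => exact absurd (T.anc_root.1 h) hb.1
  | h1 y hy ih =>
    rcases (T.anc_iff hy).1 h with rfl | h
    · rfl
    · exact absurd (ih h) ((T.isLeaf_iff.1 hb).2 y hy)

/-- A descendant of `v` of maximal depth has no successor. -/
lemma exists_leaf [Finite V] {v : V} (hv : v ≠ T.root) : ∃ b, T.IsLeaf b ∧ T.Anc v b := by
  obtain ⟨b, hb, hmax⟩ := Set.exists_max_image {z | T.Anc v z} T.depth (Set.toFinite _)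
    ⟨v, T.anc_refl v⟩
  refine ⟨b, T.isLeaf_iff.2 ⟨?_, fun u hu hub => ?_⟩, hb⟩
  · rintro rfl
    exact hv (T.anc_root.1 hb)
  · have h1 := hmax u (Anc.parent (y := u) T (by rw [hub]; exact hb))
    rw [T.depth_parent hu, hub] at h1
    omega

/-- The closed walk from the root to `b` and back. -/
noncomputable def roundTrip (b : V) : T.graph.Walk T.root T.root :=
  (T.path b).append (T.path b).reverse

lemma mem_support_roundTrip {x b : V} : x ∈ (T.roundTrip b).support ↔ T.Anc x b := by
  simp [roundTrip, SimpleGraph.Walk.mem_support_append_iff, Anc]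

lemma stepWeight_roundTrip {b : V} {i : ℕ} (hi : i < (T.roundTrip b).length) :
    T.stepWeight (T.roundTrip b) i ≤ T.key b :=
  T.stepWeight_le _ (fun x hx => (T.inWeight_le_key x).trans
    (T.mem_support_roundTrip.1 hx).key_le) hi

/-- Visit the vertices of the list one after the other, returning to the root each time. -/
noncomputable def leafWalk (l : List V) : T.graph.Walk T.root T.root :=
  T.concatWalks T.roundTrip l

open Classical in
/-- The vertices on the paths from the root to vertices of a list. -/
noncomputable def upTo [Fintype V] (l : List V) : Finset V :=
  Finset.univ.filter fun x => x = T.root ∨ ∃ b ∈ l, T.Anc x b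

lemma mem_upTo [Fintype V] {l : List V} {x : V} :
    x ∈ T.upTo l ↔ x = T.root ∨ ∃ b ∈ l, T.Anc x b := by
  simp [upTo]

lemma mem_support_leafWalk [Finite V] {l : List V} (hl : ∀ b, b ∈ l ↔ T.IsLeaf b) (v : V) :
    v ∈ (T.leafWalk l).support := by
  rw [leafWalk, mem_support_concatWalks]
  by_cases hv : v = T.root
  · exact .inl hv
  · obtain ⟨b, hb, hvb⟩ := T.exists_leaf hv
    exact .inr ⟨b, (hl b).2 hb, T.mem_support_roundTrip.2 hvb⟩

/-- No leaf is a proper ancestor of another vertex, so a round trip to one leaf meets no other leaf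
and first visits follow the list. -/
lemma isLeafOrder_leafWalk [DecidableEq V] {l : List V} (hl : ∀ b, b ∈ l ↔ T.IsLeaf b) (hnd : l.Nodup) :
    T.IsLeafOrder (T.leafWalk l) l := by
  refine ⟨hl, ?_⟩
  -- Only this half of `hl` passes to the tail of the list, so the induction uses it alone.
  have hl' : ∀ b ∈ l, T.IsLeaf b := fun b hb => (hl b).1 hb
  clear hl
  induction l with
  | nil => exact .nil
  | cons a l ih =>
    rw [List.nodup_cons] at hnd
    have hsup : (T.leafWalk (a :: l)).support =
        (T.roundTrip a).support ++ (T.leafWalk l).support.tail :=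
      SimpleGraph.Walk.support_append _ _
    have hnot : ∀ b ∈ l, b ∉ (T.roundTrip a).support := fun b hb hba => by
      have := (hl' b (by simp [hb])).eq_of_anc (T.mem_support_roundTrip.1 hba)
      exact hnd.1 (this ▸ hb)
    rw [List.pairwise_cons, hsup]
    refine ⟨fun b hb => ?_, ?_⟩
    · rw [List.idxOf_append_of_mem (T.mem_support_roundTrip.2 (T.anc_refl a)),
        List.idxOf_append_of_notMem (hnot b hb)]
      have := List.idxOf_lt_length_of_mem (T.mem_support_roundTrip.2 (T.anc_refl a))
      omega
    · refine (ih hnd.2 fun b hb => hl' b (by simp [hb])).imp_of_mem fun {b b'} hb hb' h => ?_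
      rw [List.idxOf_append_of_notMem (hnot b hb), List.idxOf_append_of_notMem (hnot b' hb')]
      rw [← SimpleGraph.Walk.cons_tail_support (T.leafWalk l), List.idxOf_cons_ne _ (hl' b (by simp [hb])).1.symm,
        List.idxOf_cons_ne _ (hl' b' (by simp [hb'])).1.symm] at h
      omega

/-- The leaves in the order of decreasing keys: the optimal number of agents. -/
theorem isOptimalStrategy_leafWalk [DecidableEq V] [Fintype V] {l : List V} (hl : ∀ b, b ∈ l ↔ T.IsLeaf b)
    (hs : l.Pairwise fun a b => T.key b ≤ T.key a) {K : ℝ} (hK0 : T.vw T.root ≤ K)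
    (hK : ∀ (i : ℕ) (h : i < l.length),
      T.key l[i] + ∑ x ∈ T.upTo (l.take (i + 1)), T.vw x ≤ K)
    (hK' : K = T.vw T.root ∨ ∃ (i : ℕ) (h : i < l.length),
      K = T.key l[i] + ∑ x ∈ T.upTo (l.take (i + 1)), T.vw x) :
    T.IsOptimalStrategy K (T.leafWalk l) := by
  refine ⟨⟨T.mem_support_leafWalk hl, fun i _ => ?_, fun i hi => ?_⟩, fun K' S' hS' => ?_⟩
  -- Without leaves the walk stays at the root. Otherwise the root paths of all leaves cover the
  -- tree, so the term of the last leaf bounds every number of settled agents.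
  · rcases List.eq_nil_or_concat' l with rfl | ⟨l', b, rfl⟩
    · refine (T.settled_le _ i {T.root} fun j _ => ?_).trans (by simpa using hK0)
      simp [leafWalk, concatWalks]
    · have h1 := hK l'.length (by simp)
      refine le_trans ?_ h1
      refine (T.settled_le _ i (T.upTo ((l' ++ [b]).take (l'.length + 1))) fun j _ => ?_).trans
        (le_add_of_nonneg_left (T.key_nonneg _))
      rw [List.take_of_length_le (by simp), mem_upTo]
      by_cases h : (T.leafWalk (l' ++ [b])).getVert j = T.root
      · exact .inl h
      · obtain ⟨b', h1, h2⟩ := T.exists_leaf h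
        exact .inr ⟨b', (hl b').2 h1, h2⟩
  · obtain ⟨k, hk, ⟨j, hj, hj'⟩, h3⟩ := T.concatWalks_step T.roundTrip l hi
    have h1 : T.settled (T.leafWalk l) i ≤ ∑ x ∈ T.upTo (l.take (k + 1)), T.vw x := by
      refine T.settled_le _ i _ fun j hj => ?_
      obtain ⟨k', hk', h4, h5⟩ := h3 j hj
      refine T.mem_upTo.2 (.inr ⟨l[k'], ?_, T.mem_support_roundTrip.1 h5⟩)
      exact List.mem_take_iff_getElem.2 ⟨k', by omega, rfl⟩
    have h2 := hK k hk
    have h4 := T.stepWeight_roundTrip hj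
    rw [leafWalk] at h1 ⊢
    rw [hj']
    linarith
  · rcases hK' with rfl | ⟨i, hi, rfl⟩
    · simpa using T.sum_le_of_isStrategy hS' {T.root}
    · have hb := (hl l[i]).1 (List.getElem_mem hi)
      -- By the sorting, leaves up to index `i` have keys at least that of `l[i]`, so their root
      -- paths lie in `heavy (T.key l[i])`.
      refine T.add_sum_le_of_isStrategy hS' hb.1 le_rfl _ fun x hx => ?_
      rcases T.mem_upTo.1 hx with rfl | ⟨b, hb', hx⟩
      · exact ⟨_, hb.1, le_rfl, T.root_anc _⟩
      · obtain ⟨j, hj, rfl⟩ := List.mem_take_iff_getElem.1 hb'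
        refine ⟨_, ((hl l[j]).1 (List.getElem_mem _)).1, ?_, hx⟩
        rcases (show j ≤ i by omega).lt_or_eq with h | rfl
        · exact List.pairwise_iff_getElem.1 hs _ _ _ _ h
        · exact le_rfl

end Leaves

/-! ### Collected subtrees and their tour -/

section Collected

variable {V : Type*} (T : WTree V ℝ)

variable {T} in
lemma Dominates.ne_root {v b : V} (h : T.Dominates v b) : v ≠ T.root := by
  obtain ⟨-, j, hj, rfl, -⟩ := h
  exact T.getVert_succ_ne_root hj

variable {T} in
lemma Dominates.anc {v b : V} (h : T.Dominates v b) : T.Anc v b := by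
  obtain ⟨-, j, hj, rfl, -⟩ := h
  exact SimpleGraph.Walk.getVert_mem_support _ _

variable {T} in
lemma Dominates.inWeight_le {v b u : V} (h : T.Dominates v b) (hu : T.Anc u b) :
    T.inWeight u ≤ T.inWeight v := by
  by_cases hur : u = T.root
  · rw [hur, inWeight_root]; exact T.inWeight_nonneg v
  obtain ⟨-, j, hj, rfl, h1, -⟩ := h
  obtain ⟨i, hi, rfl⟩ := Anc.exists_getVert T hu hur
  rw [← T.stepWeight_path hi, ← T.stepWeight_path hj]
  exact h1 i hi

-- Here the tie-breaking in favour of the root enters: every earlier edge is strictly lighter.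
variable {T} in
lemma Dominates.inWeight_lt {v b u : V} (h : T.Dominates v b) (hu : T.Anc u v)
    (hur : u ≠ T.root) (huv : u ≠ v) : T.inWeight u < T.inWeight v := by
  obtain ⟨-, j, hj, rfl, -, h1⟩ := h
  have hub := hu.trans ((T.path b).getVert_mem_support (j + 1))
  obtain ⟨i, hi, rfl⟩ := Anc.exists_getVert T hub hur
  rw [← T.stepWeight_path hi, ← T.stepWeight_path hj]
  refine h1 i ?_
  by_contra hlt
  exact huv (hu.eq_of_depth_le (by rw [T.depth_getVert hi, T.depth_getVert hj]; omega))

variable {T} in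
lemma Dominates.le_key {v b : V} (h : T.Dominates v b) : T.inWeight v ≤ T.key b :=
  (T.inWeight_le_key v).trans h.anc.key_le

/-- The least index at which the maximum is attained works: an earlier edge of no smaller weight
would attain it too. -/
lemma exists_dominates {b : V} (hb : T.IsLeaf b) : ∃ v, T.Dominates v b := by
  classical
  have hlen : 0 < (T.path b).length := by
    rw [Nat.pos_iff_ne_zero]
    intro h
    exact hb.1 (SimpleGraph.Walk.eq_of_length_eq_zero h).symm
  obtain ⟨j₀, hj₀, hmax⟩ := Finset.exists_max_image (Finset.range (T.path b).length)
    (T.stepWeight (T.path b)) ⟨0, by simpa using hlen⟩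
  have hex : ∃ j, j < (T.path b).length ∧
      ∀ i < (T.path b).length, T.stepWeight (T.path b) i ≤ T.stepWeight (T.path b) j :=
    ⟨j₀, by simpa using hj₀, fun i hi => hmax i (by simpa using hi)⟩
  obtain ⟨h1, h2⟩ := Nat.find_spec hex
  refine ⟨_, hb, Nat.find hex, h1, rfl, h2, fun i hi => ?_⟩
  by_contra hlt
  exact Nat.find_min hex hi ⟨hi.trans h1, fun k hk => (h2 k hk).trans (not_lt.1 hlt)⟩

/-- The roots of two subtrees with a common vertex `x` are both ancestors of `x`, hence comparable.
If `u` is above `v`, the edge entering `v` is strictly heavier than the one entering `u`; but it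
lies on the path to `x` and so to a leaf dominated from `u`, a contradiction. -/
lemma collected_disjoint {u v : V} (huv : u ≠ v) :
    Disjoint (T.collected u) (T.collected v) := by
  rw [Set.disjoint_left]
  have key : ∀ {u v x : V}, u ≠ v → x ∈ T.collected u → x ∈ T.collected v → ¬ T.Anc u v := by
    rintro u v x huv ⟨b, hb, hxb, hux⟩ ⟨b', hb', hxb', hvx⟩ h
    have h1 := hb'.inWeight_lt h hb.ne_root huv
    have h2 := hb.inWeight_le (Anc.trans hvx hxb)
    exact absurd h1 (not_lt.2 h2)
  intro x hu hv
  have hxu := hu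
  have hxv := hv
  obtain ⟨b, -, -, hux⟩ := hu
  obtain ⟨b', -, -, hvx⟩ := hv
  rcases T.anc_total hux hvx with h | h
  · exact key huv hxu hxv h
  · exact key huv.symm hxv hxu h

lemma exists_isDecreasingList [Finite V] : ∃ L, T.IsDecreasingList L := by
  classical
  have := Fintype.ofFinite V
  let r : V → V → Prop := fun u v => T.inWeight v ≤ T.inWeight u
  have h1 : Std.Total r := ⟨fun a b => le_total _ _⟩
  have h2 : IsTrans V r := ⟨fun a b c hab hbc => le_trans (α := ℝ) hbc hab⟩
  let L := (Finset.univ.filter T.IsCollectedRoot).toList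
  have hp : (L.insertionSort r).Perm L := List.perm_insertionSort r L
  refine ⟨L.insertionSort r, hp.nodup_iff.2 (Finset.nodup_toList _), fun v => ?_,
    List.pairwise_insertionSort r L⟩
  rw [hp.mem_iff]
  simp [L]

/-- A closed walk through a connected set of vertices that uses each edge twice. -/
lemma exists_closed_walk [DecidableEq V] (v : V) (C : Finset V) (hv : v ∈ C)
    (hC : ∀ x ∈ C, x ≠ v → x ≠ T.root ∧ T.parent x ∈ C) :
    ∃ c : T.graph.Walk v v, (∀ x, x ∈ c.support ↔ x ∈ C) ∧ c.length = 2 * (C.card - 1) := by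
  induction hn : C.card generalizing C with
  | zero => exact absurd hv (by simp [Finset.card_eq_zero.1 hn])
  | succ n ih =>
    rcases (C.erase v).eq_empty_or_nonempty with he | hne
    · have hCv : C = {v} := by rw [← Finset.insert_erase hv, he]; rfl
      refine ⟨.nil, by simp [hCv], ?_⟩
      have : C.card = 1 := by simp [hCv]
      simp; omega
    -- A deepest vertex other than `v` is the predecessor of no other vertex of `C`, so the
    -- hypotheses survive its removal.
    · obtain ⟨x, hx, hmax⟩ := Finset.exists_max_image _ T.depth hne
      obtain ⟨hxv, hxC⟩ := Finset.mem_erase.1 hx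
      obtain ⟨hxr, hpC⟩ := hC x hxC hxv
      have hpx : T.parent x ≠ x := (T.adj_parent hxr).ne
      obtain ⟨c, hc, hlen⟩ := ih (C.erase x) (Finset.mem_erase.2 ⟨hxv.symm, hv⟩)
        (fun y hy hyv => by
          obtain ⟨hyx, hyC⟩ := Finset.mem_erase.1 hy
          obtain ⟨hyr, hpy⟩ := hC y hyC hyv
          refine ⟨hyr, Finset.mem_erase.2 ⟨fun h => ?_, hpy⟩⟩
          have h1 := hmax y (Finset.mem_erase.2 ⟨hyv, hyC⟩)
          rw [T.depth_parent hyr, h] at h1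
          omega)
        (by rw [Finset.card_erase_of_mem hxC, hn]; rfl)
      have hp : T.parent x ∈ c.support := (hc _).2 (Finset.mem_erase.2 ⟨hpx, hpC⟩)
      have hspec := c.take_spec hp
      have hmem : ∀ y, y ∈ c.support ↔ y ∈ (c.takeUntil _ hp).support ∨
          y ∈ (c.dropUntil _ hp).support := fun y => by
        conv_lhs => rw [← hspec]
        exact SimpleGraph.Walk.mem_support_append_iff _ _
      have hl : c.length = (c.takeUntil _ hp).length + (c.dropUntil _ hp).length := by
        conv_lhs => rw [← hspec]
        exact SimpleGraph.Walk.length_append _ _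
      -- The walk for the smaller set gets a detour of two steps to `x` where it first meets the
      -- predecessor of `x`.
      refine ⟨(c.takeUntil _ hp).append (.cons (T.adj_parent hxr)
        (.cons (T.adj_parent hxr).symm (c.dropUntil _ hp))), fun y => ?_, ?_⟩
      · rw [SimpleGraph.Walk.mem_support_append_iff, SimpleGraph.Walk.support_cons,
          SimpleGraph.Walk.support_cons, List.mem_cons, List.mem_cons]
        have h1 := hc y
        rw [Finset.mem_erase, hmem] at h1
        have h2 : T.parent x ∈ (c.dropUntil _ hp).support := SimpleGraph.Walk.start_mem_support _
        constructor
        · rintro (h | rfl | rfl | h)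
          · exact (h1.1 (.inl h)).2
          · exact hpC
          · exact hxC
          · exact (h1.1 (.inr h)).2
        · intro hy
          by_cases hyx : y = x
          · exact .inr (.inr (.inl hyx))
          · rcases h1.2 ⟨hyx, hy⟩ with h | h
            · exact .inl h
            · exact .inr (.inr (.inr h))
      · have : 0 < n := by
          have := Finset.card_pos.2 hne
          rw [Finset.card_erase_of_mem hv] at this; omega
        simp only [SimpleGraph.Walk.length_append, SimpleGraph.Walk.length_cons]
        omega

lemma exists_explores [DecidableEq V] [Finite V] {v : V} (hv : T.IsCollectedRoot v) :
    ∃ c : T.graph.Walk v v, T.Explores c ∧ c.length = 2 * ((T.collected v).ncard - 1) := by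
  have hfin : (T.collected v).Finite := Set.toFinite _
  obtain ⟨b, hb⟩ := hv
  obtain ⟨c, h1, h2⟩ := T.exists_closed_walk v hfin.toFinset
    (by rw [Set.Finite.mem_toFinset]; exact ⟨b, hb, hb.anc, T.anc_refl v⟩)
    (fun x hx hxv => by
      rw [Set.Finite.mem_toFinset] at hx ⊢
      obtain ⟨b', hb', hxb', hvx⟩ := hx
      have hxr : x ≠ T.root := by
        rintro rfl
        exact hxv (T.anc_root.1 hvx).symm
      have hpx : T.Anc (T.parent x) x := Anc.parent T (T.anc_refl _)
      refine ⟨hxr, b', hb', hpx.trans hxb', ?_⟩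
      rcases (T.anc_iff hxr).1 hvx with h | h
      · exact absurd h.symm hxv
      · exact h)
  refine ⟨c, fun x => by rw [h1, Set.Finite.mem_toFinset], ?_⟩
  rw [h2, Set.ncard_eq_toFinset_card _ hfin]

lemma tour_eq_concatWalks (c : ∀ v, T.graph.Walk v v) (L : List V) : T.tour c L =
    T.concatWalks (fun v => (T.path v).append ((c v).append (T.path v).reverse)) L := by
  induction L with
  | nil => rfl
  | cons v L ih =>
    rw [tour, concatWalks, ih]
    simp only [SimpleGraph.Walk.append_assoc]

/-- The closed walk for `v` runs through ancestors of leaves dominated from `v`. No edge on the way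
to such a leaf is heavier than the dominating edge, and the leaf has at least this weight as its
key; so `executes_concatWalks` applies with parameter `inWeight v`. -/
theorem exists_isOptimalStrategy_tour [DecidableEq V] [Finite V] {L : List V} {c : ∀ v, T.graph.Walk v v}
    (hL : T.IsDecreasingList L) (hc : ∀ v ∈ L, T.Explores (c v)) :
    ∃ K, T.IsOptimalStrategy K (T.tour c L) := by
  have := Fintype.ofFinite V
  rw [tour_eq_concatWalks]
  have hsup : ∀ v ∈ L, ∀ x ∈ ((T.path v).append ((c v).append (T.path v).reverse)).support,
      ∃ b, T.Dominates v b ∧ T.Anc x b := by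
    intro v hv x hx
    obtain ⟨b, hb⟩ := (hL.2.1 v).1 hv
    simp only [SimpleGraph.Walk.mem_support_append_iff, SimpleGraph.Walk.support_reverse,
      List.mem_reverse] at hx
    rcases hx with hx | hx | hx
    · exact ⟨b, hb, Anc.trans hx hb.anc⟩
    · obtain ⟨b', hb', hx, -⟩ := (hc v hv x).1 hx
      exact ⟨b', hb', hx⟩
    · exact ⟨b, hb, Anc.trans hx hb.anc⟩
  refine T.exists_isOptimalStrategy (fun x => ?_) fun K' S' hS' =>
    T.executes_concatWalks _ T.inWeight L hL.2.2 (fun v hv => ?_) (fun v hv i hi => ?_)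
      (fun v hv x hx => ?_) hS'
  · rw [mem_support_concatWalks]
    by_cases hx : x = T.root
    · exact .inl hx
    obtain ⟨b, hb, hxb⟩ := T.exists_leaf hx
    obtain ⟨v, hv⟩ := T.exists_dominates hb
    have hvL : v ∈ L := (hL.2.1 v).2 ⟨b, hv⟩
    refine .inr ⟨v, hvL, ?_⟩
    simp only [SimpleGraph.Walk.mem_support_append_iff]
    -- On the path to a leaf `b` below `x`, the vertex `x` comes before the dominating root `v`, on
    -- the way to it, or after it, in its collected subtree.
    rcases T.anc_total hxb hv.anc with h | h
    · exact .inl h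
    · exact .inr (.inl ((hc v hvL x).2 ⟨b, hv, hxb, h⟩))
  · obtain ⟨b, hb⟩ := (hL.2.1 v).1 hv
    exact ⟨v, hb.ne_root, T.inWeight_le_key v⟩
  · refine T.stepWeight_le _ (fun x hx => ?_) hi
    obtain ⟨b, hb, hxb⟩ := hsup v hv x hx
    exact hb.inWeight_le hxb
  · obtain ⟨b, hb, hxb⟩ := hsup v hv x hx
    exact ⟨b, hb.1.1, hb.le_key, hxb⟩

end Collected

end WTree

namespace WTree

/-! ### Stars with a single optimal leaf order -/

section Star

variable {m : ℕ} {T : WTree (Fin (m + 1)) ℝ} (hG : T.graph = SimpleGraph.starGraph 0)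
  (hr : T.root = 0)

include hG hr

lemma parent_star (v : Fin (m + 1)) : T.parent v = 0 := by
  by_cases hv : v = T.root
  · rw [hv, parent_root, hr]
  · have h := T.adj_parent hv
    rw [hG, SimpleGraph.starGraph_adj] at h
    rw [hr] at hv
    exact h.2.resolve_right hv

lemma isLeaf_star {b : Fin (m + 1)} : T.IsLeaf b ↔ b ≠ 0 := by
  rw [isLeaf_iff, hr]
  exact ⟨fun h => h.1, fun h => ⟨h, fun v _ => by rw [parent_star hG hr]; exact h.symm⟩⟩

lemma anc_star {x b : Fin (m + 1)} (hb : b ≠ 0) : T.Anc x b ↔ x = b ∨ x = 0 := by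
  rw [T.anc_iff (by rwa [hr]), parent_star hG hr, ← hr, anc_root]

lemma key_star (b : Fin (m + 1)) : T.key b = T.inWeight b := by
  by_cases hb : b = T.root
  · rw [hb, key_root, inWeight_root]
  · rw [T.key_eq hb, parent_star hG hr, ← hr, key_root, max_eq_right (T.inWeight_nonneg b)]

lemma length_leaves_star {l : List (Fin (m + 1))} (hl : ∀ b, b ∈ l ↔ T.IsLeaf b)
    (hnd : l.Nodup) : l.length = m := by
  have h : l.toFinset = Finset.univ.erase 0 := by
    ext b
    simp [hl, isLeaf_star hG hr]
  rw [← List.toFinset_card_of_nodup hnd, h]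
  simp

end Star

lemma IsLeafOrder.nodup {V : Type*} [DecidableEq V] {T : WTree V ℝ}
    {S : T.graph.Walk T.root T.root} {l : List V} (h : T.IsLeafOrder S l) : l.Nodup :=
  h.2.imp fun {a b} hab => by rintro rfl; exact lt_irrefl _ hab

lemma IsLeafOrder.idxOf_le {V : Type*} [DecidableEq V] {T : WTree V ℝ}
    {S : T.graph.Walk T.root T.root} {l : List V} (h : T.IsLeafOrder S l) {i j : ℕ}
    (hij : i ≤ j) (hj : j < l.length) : S.support.idxOf l[i] ≤ S.support.idxOf l[j] := by
  rcases hij.lt_or_eq with hij | rfl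
  · exact (List.pairwise_iff_getElem.1 h.2 _ _ _ _ hij).le
  · exact le_rfl

/-- Weights of the pending edges of a star, decreasing in the order of a permutation. -/
noncomputable def starWeight {m : ℕ} (σ : Equiv.Perm (Fin m)) : Fin (m + 1) → ℝ :=
  Fin.cons 0 fun i => 2 * m + 2 - (σ i : ℕ)

lemma starWeight_succ {m : ℕ} (σ : Equiv.Perm (Fin m)) (i : Fin m) :
    starWeight σ i.succ = 2 * m + 2 - (σ i : ℕ) := rfl

lemma starWeight_succ_pos {m : ℕ} (σ : Equiv.Perm (Fin m)) (i : Fin m) :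
    0 < starWeight σ i.succ := by
  have : ((σ i : ℕ) : ℝ) < m := by exact_mod_cast (σ i).2
  rw [starWeight_succ]
  have : (0 : ℝ) ≤ m := Nat.cast_nonneg m
  linarith

lemma starWeight_nonneg {m : ℕ} (σ : Equiv.Perm (Fin m)) (i : Fin (m + 1)) :
    0 ≤ starWeight σ i := by
  cases i using Fin.cases with
  | zero => exact le_rfl
  | succ i => exact (starWeight_succ_pos σ i).le

/-- A star with unit vertex weights. -/
noncomputable def starTree {m : ℕ} (σ : Equiv.Perm (Fin m)) : WTree (Fin (m + 1)) ℝ where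
  graph := SimpleGraph.starGraph 0
  isTree := SimpleGraph.isTree_starGraph 0
  root := 0
  vw _ := 1
  -- Symmetric in the two ends. As the centre has weight `0`, the edge from the centre to a leaf
  -- gets the weight of the leaf.
  ew := Sym2.lift ⟨fun a b => starWeight σ a + starWeight σ b, fun _ _ => add_comm _ _⟩
  vw_nonneg _ := zero_le_one
  ew_nonneg e _ := by
    induction e using Sym2.ind with
    | _ a b => exact add_nonneg (starWeight_nonneg σ a) (starWeight_nonneg σ b)

lemma starTree_positive {m : ℕ} (σ : Equiv.Perm (Fin m)) : (starTree σ).Positive := by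
  refine ⟨fun _ => zero_lt_one, fun e he => ?_⟩
  induction e using Sym2.ind with
  | _ a b =>
    have hab : a ≠ b := (SimpleGraph.starGraph_adj.1 he).1
    change 0 < starWeight σ a + starWeight σ b
    have ha := starWeight_nonneg σ a
    have hb := starWeight_nonneg σ b
    cases a using Fin.cases with
    | zero =>
      cases b using Fin.cases with
      | zero => exact absurd rfl hab
      | succ b => have := starWeight_succ_pos σ b; linarith
    | succ a => have := starWeight_succ_pos σ a; linarith

lemma inWeight_starTree {m : ℕ} (σ : Equiv.Perm (Fin m)) (i : Fin m) :
    (starTree σ).inWeight i.succ = 2 * m + 2 - (σ i : ℕ) := by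
  rw [inWeight_of_ne _ (Fin.succ_ne_zero i), parent_star rfl rfl]
  exact zero_add _

lemma upTo_star {m : ℕ} (σ : Equiv.Perm (Fin m)) (l : List (Fin (m + 1)))
    (hl : ∀ b ∈ l, b ≠ 0) (hnd : l.Nodup) :
    ∑ x ∈ (starTree σ).upTo l, (starTree σ).vw x ≤ l.length + 1 := by
  have h : (starTree σ).upTo l ⊆ insert 0 l.toFinset := by
    intro x hx
    rw [Finset.mem_insert, List.mem_toFinset]
    rcases (mem_upTo _).1 hx with rfl | ⟨b, hb, hx⟩
    · exact .inl rfl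
    · rcases (anc_star rfl rfl (hl b hb)).1 hx with rfl | rfl
      · exact .inr hb
      · exact .inl rfl
  have h2 := (Finset.card_le_card h).trans (Finset.card_insert_le _ _)
  rw [List.toFinset_card_of_nodup hnd] at h2
  have h3 : ∑ x ∈ (starTree σ).upTo l, (starTree σ).vw x = ((starTree σ).upTo l).card := by
    simp [starTree]
  rw [h3]
  exact_mod_cast h2

/-- The optimal number of agents for the star is at most the value for the sorted order. -/
lemma exists_isStrategy_starTree {m : ℕ} (σ : Equiv.Perm (Fin m)) :
    ∃ S, (starTree σ).IsStrategy (2 * m + 4) S := by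
  set l := List.ofFn fun i => (σ.symm i).succ with hl
  have hnd : l.Nodup := List.nodup_ofFn.2 fun i j hij => by simpa using hij
  have hmem : ∀ b, b ∈ l ↔ (starTree σ).IsLeaf b := fun b => by
    rw [isLeaf_star rfl rfl, hl, List.mem_ofFn]
    constructor
    · rintro ⟨i, rfl⟩
      exact Fin.succ_ne_zero _
    · intro hb
      obtain ⟨i, rfl⟩ := Fin.exists_succ_eq.2 hb
      exact ⟨σ i, by simp⟩
  -- In sorted order the weights drop by one per leaf while the number of settled agents, at most `i
  -- + 2` after leaf `i`, grows by one. So `2 * m + 4` agents suffice for every round trip.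
  have hget : ∀ i (h : i < l.length), (starTree σ).key l[i] = 2 * m + 2 - i := fun i h => by
    simp only [hl, List.getElem_ofFn]
    rw [key_star rfl rfl, inWeight_starTree]
    simp
  refine ⟨(starTree σ).leafWalk l, mem_support_leafWalk _ hmem, fun i _ => ?_, fun i hi => ?_⟩
  · refine ((starTree σ).settled_le _ i Finset.univ (by simp)).trans ?_
    have : (0 : ℝ) ≤ m := Nat.cast_nonneg m
    simp [starTree]
    linarith
  · obtain ⟨k, hk, ⟨j, hj, hj'⟩, h3⟩ := (starTree σ).concatWalks_step _ l hi
    have h1 : (starTree σ).settled ((starTree σ).leafWalk l) i ≤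
        ∑ x ∈ (starTree σ).upTo (l.take (k + 1)), (starTree σ).vw x := by
      refine settled_le _ _ i _ fun j hj => ?_
      obtain ⟨k', hk', h4, h5⟩ := h3 j hj
      refine (mem_upTo _).2 (.inr ⟨l[k'], ?_, (mem_support_roundTrip _).1 h5⟩)
      exact List.mem_take_iff_getElem.2 ⟨k', by omega, rfl⟩
    have h2 := upTo_star σ (l.take (k + 1))
      (fun b hb => ((hmem b).1 (List.mem_of_mem_take hb)).1) (hnd.sublist (List.take_sublist _ _))
    have h4 := stepWeight_roundTrip _ hj
    have h5 : ((l.take (k + 1)).length : ℝ) ≤ k + 1 := by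
      exact_mod_cast List.length_take_le _ _
    rw [hget k hk] at h4
    rw [leafWalk] at h1 ⊢
    rw [hj']
    linarith

/-- Only one visiting order of the leaves of the star is optimal. -/
lemma eq_of_isOptimalLeafOrder_starTree {m : ℕ} (σ : Equiv.Perm (Fin m))
    {l : List (Fin (m + 1))} (h : (starTree σ).IsOptimalLeafOrder l) :
    l = List.ofFn fun i => (σ.symm i).succ := by
  obtain ⟨K, S, hS, hl⟩ := h
  obtain ⟨S', hS'⟩ := exists_isStrategy_starTree σ
  have hK := hS.2 _ _ hS'
  have hnd := hl.nodup
  have hlen : l.length = m := length_leaves_star rfl rfl hl.1 hnd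
  have hne : ∀ i (hi : i < l.length), l[i] ≠ 0 := fun i hi =>
    (isLeaf_star rfl rfl).1 ((hl.1 _).1 (List.getElem_mem hi))
  have hvert : ∀ b, S.getVert (S.support.idxOf b) = b := fun b => by
    have hb := List.idxOf_lt_length_of_mem (hS.1.1 b)
    rw [← SimpleGraph.Walk.support_getElem_eq_getVert (h := hb), List.getElem_idxOf]
  -- At the first visit of `l[i]` the centre and `i + 1` leaves are settled, and the next step must
  -- recross the edge of `l[i]`. With at most `2 * m + 4` agents its weight is at most `2 * m + 2 -
  -- i`.
  have hge : ∀ i (hi : i < l.length), i ≤ (σ (l[i].pred (hne i hi)) : ℕ) := by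
    intro i hi
    set p := S.support.idxOf l[i] with hp
    have hpv : S.getVert p = l[i] := hvert _
    have hpl : p < S.length := by
      by_contra hlt
      rw [S.getVert_of_length_le (not_lt.1 hlt)] at hpv
      exact hne i hi hpv.symm
    have h1 : (starTree σ).stepWeight S p = 2 * m + 2 - (σ (l[i].pred (hne i hi)) : ℕ) := by
      rw [← inWeight_starTree, Fin.succ_pred]
      rcases (starTree σ).stepWeight_eq S hpl with ⟨-, h2, -⟩ | ⟨-, -, h3⟩
      · rw [hpv, parent_star rfl rfl] at h2
        exact absurd h2.symm (hne i hi)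
      · rw [h3, hpv]
    have h2 : ((insert 0 (l.take (i + 1)).toFinset : Finset (Fin (m + 1))).card : ℝ) ≤
        (starTree σ).settled S p := by
      have := (starTree σ).le_settled S p (insert 0 (l.take (i + 1)).toFinset) fun x hx => by
        rw [Finset.mem_insert, List.mem_toFinset, List.mem_take_iff_getElem] at hx
        rcases hx with rfl | ⟨j, hj, rfl⟩
        · exact ⟨0, Nat.zero_le _, S.getVert_zero⟩
        · exact ⟨_, hl.idxOf_le (by omega) hi, hvert _⟩
      simpa [starTree] using this
    have h3 : (insert 0 (l.take (i + 1)).toFinset : Finset (Fin (m + 1))).card = i + 2 := by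
      rw [Finset.card_insert_of_notMem,
        List.toFinset_card_of_nodup (hnd.sublist (List.take_sublist _ _)), List.length_take,
        min_eq_left (by omega)]
      rw [List.mem_toFinset]
      intro h0
      exact (isLeaf_star rfl rfl).1 ((hl.1 _).1 (List.mem_of_mem_take h0)) rfl
    have h4 := hS.1.2.2 p hpl
    rw [h3] at h2
    rw [h1] at h4
    push_cast at h2
    have : (i : ℝ) ≤ (σ (l[i].pred (hne i hi)) : ℕ) := by linarith
    exact_mod_cast this
  let f : Fin m → Fin m := fun i => σ (l[i].pred (hne i (by omega)))
  have hf : Function.Injective f := fun i j hij => by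
    have h1 := congrArg Fin.succ (σ.injective hij)
    rw [Fin.succ_pred, Fin.succ_pred] at h1
    exact Fin.ext ((List.Nodup.getElem_inj_iff hnd).1 h1)
  -- The injection `f` is a permutation with `i ≤ f i`. Equality of the sums forces equality in
  -- every term.
  have hsum : ∑ i, (f i : ℕ) = ∑ i : Fin m, (i : ℕ) :=
    (Equiv.ofBijective f (Finite.injective_iff_bijective.1 hf)).sum_comp fun i : Fin m => (i : ℕ)
  have heq := (Finset.sum_eq_sum_iff_of_le (s := Finset.univ) (f := fun i : Fin m => (i : ℕ))
    (g := fun i => (f i : ℕ)) (fun i _ => hge i (by omega))).1 hsum.symm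
  refine List.ext_getElem (by simp [hlen]) fun i h1 h2 => ?_
  have h3 : f ⟨i, by omega⟩ = ⟨i, by omega⟩ := Fin.ext (heq _ (Finset.mem_univ _)).symm
  simp only [List.getElem_ofFn]
  rw [← h3]
  simp [f]

end WTree

/-! ### Counting -/

/-- Pair the factors of one factorial with those of the other in reverse: each product `(i + 1) * (m
- i)` is at least `m`. -/
lemma pow_self_le_factorial_sq (m : ℕ) : m ^ m ≤ m.factorial ^ 2 := by
  have h1 : m.factorial = ∏ i ∈ Finset.range m, (m - 1 - i + 1) := by
    rw [Finset.prod_range_reflect (fun i => i + 1) m, Finset.prod_range_add_one_eq_factorial]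
  have h2 : m.factorial ^ 2 = ∏ i ∈ Finset.range m, (i + 1) * (m - 1 - i + 1) := by
    rw [Finset.prod_mul_distrib, ← h1, Finset.prod_range_add_one_eq_factorial, sq]
  rw [h2]
  calc m ^ m = ∏ _i ∈ Finset.range m, m := by simp
    _ ≤ _ := Finset.prod_le_prod' fun i hi => by
      obtain ⟨k, rfl⟩ := Nat.exists_eq_add_of_lt (Finset.mem_range.1 hi)
      rw [show i + k + 1 - 1 - i + 1 = k + 1 by omega]
      nlinarith [Nat.zero_le (i * k)]

/-- The constant for `2 ≤ m`: from `m ^ m ≤ 9 ^ F` and `log 3 ≤ 2` follows `m * log m ≤ 4 * F`;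
passing from `m` to `m + 1` costs a factor `3 / 2` and, in the logarithm, a factor `2`. For smaller
`m` the factorial says nothing and `hF` is needed. -/
lemma mul_log_le_of_factorial_le {m F : ℕ} (hF : 1 ≤ F) (h : m.factorial ≤ 3 ^ F) :
    1 / 12 * (((m + 1 : ℕ) : ℝ) * Real.log (m + 1 : ℕ)) ≤ F := by
  have hF' : (1 : ℝ) ≤ F := by exact_mod_cast hF
  rcases Nat.lt_or_ge m 2 with hm | hm
  · have h2 : Real.log 2 ≤ 1 := by
      have := Real.log_le_sub_one_of_pos (show (0 : ℝ) < 2 by norm_num); linarith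
    interval_cases m
    · simp
    · norm_num
      linarith
  · have hm' : (2 : ℝ) ≤ m := by exact_mod_cast hm
    have hm0 : (0 : ℝ) < m := by linarith
    have h3 : Real.log 3 ≤ 2 := by
      have := Real.log_le_sub_one_of_pos (show (0 : ℝ) < 3 by norm_num); linarith
    have h4 : (m : ℝ) * Real.log m ≤ 2 * (F * Real.log 3) := by
      have h5 : ((m : ℝ) ^ m) ≤ ((3 : ℝ) ^ F) ^ 2 := by
        exact_mod_cast (pow_self_le_factorial_sq m).trans (Nat.pow_le_pow_left h 2)
      have := Real.log_le_log (by positivity) h5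
      rw [Real.log_pow, Real.log_pow, Real.log_pow] at this
      exact_mod_cast this
    have h5 : Real.log (m + 1) ≤ 2 * Real.log m := by
      have : Real.log (m + 1) ≤ Real.log ((m : ℝ) ^ 2) :=
        Real.log_le_log (by linarith) (by nlinarith)
      rw [Real.log_pow] at this
      exact_mod_cast this
    have h6 : 0 ≤ Real.log m := Real.log_nonneg (by linarith)
    push_cast
    have h7 : ((m : ℝ) + 1) * Real.log (m + 1) ≤ (3 / 2 * m) * (2 * Real.log m) :=
      mul_le_mul (by linarith) h5 (Real.log_nonneg (by linarith)) (by linarith)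
    nlinarith

/-- Pure counting of the leaves of a ternary tree, which is why the degrees of the polynomials do
not matter. -/
lemma DecTree.exists_outputs {ι Out : Type*} (D : DecTree ι Out) :
    ∃ s : Finset Out, s.card ≤ 3 ^ D.depth ∧ ∀ x, D.eval x ∈ s := by
  classical
  induction D with
  | out o => exact ⟨{o}, by simp [depth], by simp [eval]⟩
  | test p neg zero pos ih1 ih2 ih3 =>
    obtain ⟨s1, h1, h1'⟩ := ih1
    obtain ⟨s2, h2, h2'⟩ := ih2
    obtain ⟨s3, h3, h3'⟩ := ih3
    refine ⟨s1 ∪ (s2 ∪ s3), ?_, fun x => ?_⟩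
    · have h4 := (Finset.card_union_le s1 (s2 ∪ s3)).trans
        (Nat.add_le_add_left (Finset.card_union_le s2 s3) _)
      rw [depth, pow_succ]
      set d := max neg.depth (max zero.depth pos.depth)
      have e1 : 3 ^ neg.depth ≤ 3 ^ d := Nat.pow_le_pow_right (by norm_num) (by omega)
      have e2 : 3 ^ zero.depth ≤ 3 ^ d := Nat.pow_le_pow_right (by norm_num) (by omega)
      have e3 : 3 ^ pos.depth ≤ 3 ^ d := Nat.pow_le_pow_right (by norm_num) (by omega)
      omega
    · rw [eval]
      split_ifs
      · exact Finset.mem_union_left _ (h1' x)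
      · exact Finset.mem_union_right _ (Finset.mem_union_left _ (h2' x))
      · exact Finset.mem_union_right _ (Finset.mem_union_right _ (h3' x))

/-- On the star, different permutations force different outputs, so `(n - 1)!` is at most `3 ^
D.depth`. -/
theorem decTree_lowerBound : ∃ c : ℝ, 0 < c ∧ ∀ n : ℕ, 3 ≤ n →
    ∃ (G : SimpleGraph (Fin n)) (r : Fin n), G.IsTree ∧
      ∀ D : DecTree (Fin n ⊕ Sym2 (Fin n)) (List (Fin n)),
        (∀ T : WTree (Fin n) ℝ, T.graph = G → T.root = r → T.Positive →
          T.IsOptimalLeafOrder (D.eval (Sum.elim T.vw T.ew))) →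
        c * (n * Real.log n) ≤ D.depth := by
  refine ⟨1 / 12, by norm_num, fun n hn => ?_⟩
  obtain ⟨m, rfl⟩ : ∃ m, n = m + 1 := ⟨n - 1, by omega⟩
  refine ⟨SimpleGraph.starGraph 0, 0, SimpleGraph.isTree_starGraph 0, fun D hD => ?_⟩
  obtain ⟨s, hs, hs'⟩ := D.exists_outputs
  have hinj : Function.Injective fun σ : Equiv.Perm (Fin m) =>
      List.ofFn fun i => (σ.symm i).succ := by
    intro σ τ h
    have h1 := List.ofFn_injective h
    refine Equiv.symm_bijective.injective (Equiv.ext fun i => ?_)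
    simpa using congrFun h1 i
  have hcard : m.factorial ≤ s.card := by
    have h0 : (Finset.univ : Finset (Equiv.Perm (Fin m))).card = m.factorial := by
      rw [Finset.card_univ, Fintype.card_perm, Fintype.card_fin]
    rw [← h0]
    refine Finset.card_le_card_of_injOn _ (fun σ _ => ?_) hinj.injOn
    have h := hD (WTree.starTree σ) rfl rfl (WTree.starTree_positive σ)
    rw [Finset.mem_coe, ← WTree.eq_of_isOptimalLeafOrder_starTree σ h]
    exact hs' _
  have h3 := hcard.trans hs
  refine mul_log_le_of_factorial_le ?_ h3
  -- A tree without tests has one output, but there are at least two permutations because `3 ≤ n`.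
  by_contra h0
  have h4 : D.depth = 0 := by omega
  have h5 := Nat.self_le_factorial m
  rw [h4] at h3
  omega

/-! ### Lower bounds for random access machines -/

namespace RAM

lemma Test.cost_pos (b : Test) : 1 ≤ b.cost := by cases b <;> simp [Test.cost]

lemma Runs.one_le {B : ℕ} {p : Prog} {m m' : Mem} {t : ℕ} (h : Runs B p m t m') : 1 ≤ t := by
  induction h with
  | iteTrue b => have := b.cost_pos; omega
  | iteFalse b => have := b.cost_pos; omega
  | whileTrue b => have := b.cost_pos; omega
  | whileFalse b => exact b.cost_pos
  | _ => omega

/-- In time `t` at most `t` entries of an array are changed. -/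
lemma Runs.exists_changed {B : ℕ} {p : Prog} {m m' : Mem} {t : ℕ} (h : Runs B p m t m')
    (a : ℕ) : ∃ F : Finset ℕ, F.card ≤ t ∧ ∀ i ∉ F, m'.na a i = m.na a i := by
  induction h with
  | putN m a' i e h =>
    refine ⟨{i.eval m}, by simp, fun j hj => ?_⟩
    simp only [Finset.mem_singleton] at hj
    simp only [Mem.putN, Function.update_apply]
    split_ifs with h1
    · rw [h1]; simp [hj]
    · rfl
  | seq p q m m₁ m₂ t₁ t₂ h₁ h₂ ih1 ih2 =>
    obtain ⟨F, hF, hF'⟩ := ih1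
    obtain ⟨G, hG, hG'⟩ := ih2
    refine ⟨F ∪ G, (Finset.card_union_le _ _).trans (by omega), fun i hi => ?_⟩
    rw [Finset.notMem_union] at hi
    rw [hG' i hi.2, hF' i hi.1]
  | iteTrue b p q m m₁ t hb h ih =>
    obtain ⟨F, hF, hF'⟩ := ih
    exact ⟨F, by omega, hF'⟩
  | iteFalse b p q m m₁ t hb h ih =>
    obtain ⟨F, hF, hF'⟩ := ih
    exact ⟨F, by omega, hF'⟩
  | whileTrue b p m m₁ m₂ t₁ t₂ hb h₁ h₂ ih1 ih2 =>
    obtain ⟨F, hF, hF'⟩ := ih1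
    obtain ⟨G, hG, hG'⟩ := ih2
    refine ⟨F ∪ G, (Finset.card_union_le _ _).trans (by omega), fun i hi => ?_⟩
    rw [Finset.notMem_union] at hi
    rw [hG' i hi.2, hF' i hi.1]
  | _ => exact ⟨∅, by simp, fun _ _ => rfl⟩

/-- The memory without its real part. -/
def Mem.natPart (m : Mem) : Mem := { m with rv := 0, ra := 0 }

lemma NExp.eval_natPart (m : Mem) (e : NExp) : e.eval m.natPart = e.eval m := by
  induction e <;> simp_all [NExp.eval, Mem.natPart]

/-- The computation on the natural part of the memory for given outcomes of the tests. -/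
inductive Traced : Prog → Mem → List Bool → Mem → Prop where
  | skip (m : Mem) : Traced .skip m [] m
  | setN (m : Mem) (x : ℕ) (e : NExp) : Traced (.setN x e) m [] (m.setN x (e.eval m))
  | setR (m : Mem) (x : ℕ) (e : RExp) : Traced (.setR x e) m [] m
  | putN (m : Mem) (a : ℕ) (i e : NExp) :
      Traced (.putN a i e) m [] (m.putN a (i.eval m) (e.eval m))
  | putR (m : Mem) (a : ℕ) (i : NExp) (e : RExp) : Traced (.putR a i e) m [] m
  | seq (p q : Prog) (m m₁ m₂ : Mem) (s₁ s₂ : List Bool) (h₁ : Traced p m s₁ m₁)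
      (h₂ : Traced q m₁ s₂ m₂) : Traced (.seq p q) m (s₁ ++ s₂) m₂
  | iteTrue (b : Test) (p q : Prog) (m m₁ : Mem) (s : List Bool) (h : Traced p m s m₁) :
      Traced (.ite b p q) m (true :: s) m₁
  | iteFalse (b : Test) (p q : Prog) (m m₁ : Mem) (s : List Bool) (h : Traced q m s m₁) :
      Traced (.ite b p q) m (false :: s) m₁
  | whileTrue (b : Test) (p : Prog) (m m₁ m₂ : Mem) (s₁ s₂ : List Bool) (h₁ : Traced p m s₁ m₁)
      (h₂ : Traced (.while b p) m₁ s₂ m₂) : Traced (.while b p) m (true :: (s₁ ++ s₂)) m₂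
  | whileFalse (b : Test) (p : Prog) (m : Mem) : Traced (.while b p) m [false] m

/-- Natural expressions never read reals, so the outcomes of the tests are all that the natural
memory learns about them. Every test costs at least one unit, which bounds the length of the trace.
-/
lemma Runs.exists_traced {B : ℕ} {p : Prog} {m m' : Mem} {t : ℕ} (h : Runs B p m t m') :
    ∃ s : List Bool, s.length ≤ t ∧ Traced p m.natPart s m'.natPart := by
  induction h with
  | skip m => exact ⟨[], by simp, .skip _⟩
  | setN m x e h => exact ⟨[], by simp, by
      have := Traced.setN m.natPart x e; rwa [NExp.eval_natPart] at this⟩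
  | setR m x e => exact ⟨[], by simp, .setR _ _ _⟩
  | putN m a i e h => exact ⟨[], by simp, by
      have := Traced.putN m.natPart a i e; rwa [NExp.eval_natPart, NExp.eval_natPart] at this⟩
  | putR m a i e => exact ⟨[], by simp, .putR _ _ _ _⟩
  | seq p q m m₁ m₂ t₁ t₂ h₁ h₂ ih1 ih2 =>
    obtain ⟨s, hs, hs'⟩ := ih1
    obtain ⟨u, hu, hu'⟩ := ih2
    exact ⟨s ++ u, by rw [List.length_append]; omega, .seq _ _ _ _ _ _ _ hs' hu'⟩
  | iteTrue b p q m m₁ t hb h ih =>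
    obtain ⟨s, hs, hs'⟩ := ih
    have := b.cost_pos
    exact ⟨true :: s, by rw [List.length_cons]; omega, .iteTrue _ _ _ _ _ _ hs'⟩
  | iteFalse b p q m m₁ t hb h ih =>
    obtain ⟨s, hs, hs'⟩ := ih
    have := b.cost_pos
    exact ⟨false :: s, by rw [List.length_cons]; omega, .iteFalse _ _ _ _ _ _ hs'⟩
  | whileTrue b p m m₁ m₂ t₁ t₂ hb h₁ h₂ ih1 ih2 =>
    obtain ⟨s, hs, hs'⟩ := ih1
    obtain ⟨u, hu, hu'⟩ := ih2
    have := b.cost_pos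
    exact ⟨true :: (s ++ u), by rw [List.length_cons, List.length_append]; omega,
      .whileTrue _ _ _ _ _ _ _ hs' hu'⟩
  | whileFalse b p m hb => exact ⟨[false], by simpa using b.cost_pos, .whileFalse _ _ _⟩

/-- Traces from the same memory are prefix-free, since the outcomes read so far determine whether
the program goes on. The arbitrary continuations `u₁`, `u₂` are needed to split the trace of a
sequence, where it is not known beforehand at which point the first part ends. -/
lemma Traced.unique {p : Prog} {m m₁ m₂ : Mem} {s₁ s₂ u₁ u₂ : List Bool}
    (h₁ : Traced p m s₁ m₁) (h₂ : Traced p m s₂ m₂) (h : s₁ ++ u₁ = s₂ ++ u₂) :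
    s₁ = s₂ ∧ m₁ = m₂ := by
  induction h₁ generalizing s₂ m₂ u₁ u₂ with
  | seq p q m m₁ m₂' s₁ s₁' h₁ h₁' ih1 ih2 =>
    cases h₂ with
    | seq _ _ _ m₃ _ s₂ s₂' h₃ h₃' =>
      rw [List.append_assoc, List.append_assoc] at h
      obtain ⟨rfl, rfl⟩ := ih1 h₃ h
      obtain ⟨rfl, rfl⟩ := ih2 h₃' (List.append_cancel_left h)
      exact ⟨rfl, rfl⟩
  | iteTrue b p q m m₁ s h₁ ih =>
    cases h₂ with
    | iteTrue _ _ _ _ _ s' h₃ =>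
      obtain ⟨rfl, rfl⟩ := ih h₃ (by simpa using h)
      exact ⟨rfl, rfl⟩
    | iteFalse => simp at h
  | iteFalse b p q m m₁ s h₁ ih =>
    cases h₂ with
    | iteFalse _ _ _ _ _ s' h₃ =>
      obtain ⟨rfl, rfl⟩ := ih h₃ (by simpa using h)
      exact ⟨rfl, rfl⟩
    | iteTrue => simp at h
  | whileTrue b p m m₁ m₂' s₁ s₁' h₁ h₁' ih1 ih2 =>
    cases h₂ with
    | whileTrue _ _ _ m₃ _ s₂ s₂' h₃ h₃' =>
      simp only [List.cons_append, List.append_assoc, List.cons.injEq, true_and] at h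
      obtain ⟨rfl, rfl⟩ := ih1 h₃ h
      obtain ⟨rfl, rfl⟩ := ih2 h₃' (List.append_cancel_left h)
      exact ⟨rfl, rfl⟩
    | whileFalse => simp at h
  | whileFalse b p m =>
    cases h₂ with
    | whileTrue => simp at h
    | whileFalse => exact ⟨rfl, rfl⟩
  | _ => cases h₂; exact ⟨rfl, rfl⟩

lemma natPart_realInput_starTree {m : ℕ} (σ τ : Equiv.Perm (Fin m)) :
    (realInput (WTree.starTree σ)).natPart = (realInput (WTree.starTree τ)).natPart := by
  simp only [Mem.natPart, realInput, WTree.parent_star (T := WTree.starTree σ) rfl rfl,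
    WTree.parent_star (T := WTree.starTree τ) rfl rfl]
  rfl

/-- Star inputs differ only in real memory, so by `Traced.unique` different permutations need
different traces. The word bound `B` plays no part in this count. -/
theorem real_lowerBound : ∃ c : ℝ, 0 < c ∧ ∀ (P : Prog) (B f : ℕ → ℕ),
    (∀ (n : ℕ) (T : WTree (Fin n) ℝ), T.Positive → ∃ t ≤ f n, ∃ m : Mem,
      Runs (B n) P (realInput T) t m ∧ HasOrder T m) →
    ∀ n : ℕ, 1 ≤ n → c * (n * Real.log n) ≤ f n := by
  refine ⟨1 / 12, by norm_num, fun P B f hP n hn => ?_⟩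
  obtain ⟨m, rfl⟩ : ∃ m, n = m + 1 := ⟨n - 1, by omega⟩
  have h1 : ∀ σ : Equiv.Perm (Fin m), ∃ v : List.Vector Bool (f (m + 1)), ∃ s u : List Bool,
      v.1 = s ++ u ∧ ∃ M : Mem, Traced P (realInput (WTree.starTree σ)).natPart s M ∧
        ∀ i : Fin m, M.na 3 i = ((σ.symm i).succ : ℕ) := by
    intro σ
    obtain ⟨t, ht, M, hM, l, hl, hl'⟩ := hP _ _ (WTree.starTree_positive σ)
    obtain ⟨s, hs, hs'⟩ := hM.exists_traced
    -- Padding to the common length `f (m + 1)` loses nothing, because traces are prefix-free.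
    refine ⟨⟨s ++ List.replicate (f (m + 1) - s.length) false, by simp; omega⟩, s, _, rfl, _,
      hs', fun i => ?_⟩
    have := WTree.eq_of_isOptimalLeafOrder_starTree σ hl
    subst this
    have := hl' i (by simp)
    simpa [Mem.natPart] using this
  choose v s u hv M hM hM' using h1
  have hinj : Function.Injective v := by
    intro σ τ h
    have h2 := hM τ
    rw [natPart_realInput_starTree τ σ] at h2
    have h3 := ((hM σ).unique h2 (by rw [← hv, ← hv, h])).2
    refine Equiv.symm_bijective.injective (Equiv.ext fun i => ?_)
    have h4 := hM' σ i
    rw [h3, hM' τ i] at h4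
    exact Fin.succ_injective _ (Fin.ext h4.symm)
  have hcard := Fintype.card_le_of_injective v hinj
  rw [Fintype.card_perm, Fintype.card_fin, card_vector, Fintype.card_bool] at hcard
  obtain ⟨t, ht, M, hM, -⟩ := hP _ _ (WTree.starTree_positive (1 : Equiv.Perm (Fin m)))
  exact mul_log_le_of_factorial_le (hM.one_le.trans ht)
    (hcard.trans (Nat.pow_le_pow_left (by norm_num) _))

/-- A star without weights. -/
def zeroStar (m : ℕ) : WTree (Fin (m + 1)) ℕ where
  graph := SimpleGraph.starGraph 0
  isTree := SimpleGraph.isTree_starGraph 0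
  root := 0
  vw _ := 0
  ew _ := 0
  vw_nonneg _ := le_rfl
  ew_nonneg _ _ := le_rfl

/-- The output array is initially `0`, and `0` is the centre of the star, which is not a leaf. So
each of the `n - 1` output entries must be changed. Zero weights satisfy the bound for every `k`. -/
theorem nat_lowerBound : ∃ c : ℝ, 0 < c ∧ ∀ (k : ℕ) (P : Prog) (B f : ℕ → ℕ),
    (∀ (n : ℕ) (T : WTree (Fin n) ℕ), T.BoundedBy ((n + 1) ^ k) → ∃ t ≤ f n, ∃ m : Mem,
      Runs (B n) P (natInput T) t m ∧ HasOrder T.toReal m) →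
    ∀ n : ℕ, 1 ≤ n → c * n ≤ f n := by
  refine ⟨1 / 2, by norm_num, fun k P B f hP n hn => ?_⟩
  obtain ⟨m, rfl⟩ : ∃ m, n = m + 1 := ⟨n - 1, by omega⟩
  obtain ⟨t, ht, M, hM, l, ⟨K, S, -, hl⟩, hl'⟩ := hP (m + 1) (zeroStar m)
    ⟨fun _ => Nat.zero_le _, fun _ _ => Nat.zero_le _⟩
  obtain ⟨F, hF, hF'⟩ := hM.exists_changed 3
  have hlen : l.length = m := WTree.length_leaves_star rfl rfl hl.1 hl.nodup
  have hsub : Finset.range m ⊆ F := by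
    intro i hi
    by_contra hiF
    have hil : i < l.length := by rw [hlen]; simpa using hi
    have h1 := hF' i hiF
    rw [hl' i hil] at h1
    have h2 := (WTree.isLeaf_star (T := (zeroStar m).toReal) rfl rfl).1
      ((hl.1 _).1 (List.getElem_mem hil))
    exact h2 (Fin.ext h1)
  have h1 := Finset.card_le_card hsub
  rw [Finset.card_range] at h1
  have h2 := hM.one_le
  have h3 : m + 1 ≤ 2 * f (m + 1) := by omega
  have h4 : ((m + 1 : ℕ) : ℝ) ≤ 2 * f (m + 1) := by exact_mod_cast h3
  linarith

end RAM

/-! ### Verification of programs -/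

namespace RAM

section Memory

variable (m : Mem) (x y a b i j k : ℕ) (r : ℝ)

@[simp] lemma setN_nv : (m.setN x k).nv y = if y = x then k else m.nv y :=
  Function.update_apply _ _ _ _

@[simp] lemma setN_na : (m.setN x k).na = m.na := rfl

@[simp] lemma setN_rv : (m.setN x k).rv = m.rv := rfl

@[simp] lemma setN_ra : (m.setN x k).ra = m.ra := rfl

@[simp] lemma setR_rv : (m.setR x r).rv y = if y = x then r else m.rv y :=
  Function.update_apply _ _ _ _

@[simp] lemma setR_nv : (m.setR x r).nv = m.nv := rfl

@[simp] lemma setR_na : (m.setR x r).na = m.na := rfl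

@[simp] lemma setR_ra : (m.setR x r).ra = m.ra := rfl

@[simp] lemma putN_na :
    (m.putN a i k).na b j = if b = a then (if j = i then k else m.na b j) else m.na b j := by
  simp only [Mem.putN, Function.update_apply]
  split_ifs with h1 h2 <;> simp_all

@[simp] lemma putN_nv : (m.putN a i k).nv = m.nv := rfl

@[simp] lemma putN_rv : (m.putN a i k).rv = m.rv := rfl

@[simp] lemma putN_ra : (m.putN a i k).ra = m.ra := rfl

@[simp] lemma putR_ra :
    (m.putR a i r).ra b j = if b = a then (if j = i then r else m.ra b j) else m.ra b j := by
  simp only [Mem.putR, Function.update_apply]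
  split_ifs with h1 h2 <;> simp_all

@[simp] lemma putR_nv : (m.putR a i r).nv = m.nv := rfl

@[simp] lemma putR_na : (m.putR a i r).na = m.na := rfl

@[simp] lemma putR_rv : (m.putR a i r).rv = m.rv := rfl

end Memory

attribute [simp] NExp.eval RExp.eval Test.Holds NExp.cost RExp.cost Test.cost

/-- The natural variables that a program assigns. -/
def Prog.setsN : Prog → ℕ → Bool
  | .setN x _, y => y == x
  | .seq p q, y => p.setsN y || q.setsN y
  | .ite _ p q, y => p.setsN y || q.setsN y
  | .while _ p, y => p.setsN y
  | _, _ => false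

/-- The natural arrays that a program writes to. -/
def Prog.putsN : Prog → ℕ → Bool
  | .putN a _ _, b => b == a
  | .seq p q, b => p.putsN b || q.putsN b
  | .ite _ p q, b => p.putsN b || q.putsN b
  | .while _ p, b => p.putsN b
  | _, _ => false

/-- The real variables that a program assigns. -/
def Prog.setsR : Prog → ℕ → Bool
  | .setR x _, y => y == x
  | .seq p q, y => p.setsR y || q.setsR y
  | .ite _ p q, y => p.setsR y || q.setsR y
  | .while _ p, y => p.setsR y
  | _, _ => false

/-- The real arrays that a program writes to. -/
def Prog.putsR : Prog → ℕ → Bool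
  | .putR a _ _, b => b == a
  | .seq p q, b => p.putsR b || q.putsR b
  | .ite _ p q, b => p.putsR b || q.putsR b
  | .while _ p, b => p.putsR b
  | _, _ => false

/-- The parts of the memory that are not mentioned as targets in the program agree. -/
structure Same (p : Prog) (m m' : Mem) : Prop where
  nv : ∀ x, p.setsN x = false → m'.nv x = m.nv x
  na : ∀ a, p.putsN a = false → m'.na a = m.na a
  rv : ∀ x, p.setsR x = false → m'.rv x = m.rv x
  ra : ∀ a, p.putsR a = false → m'.ra a = m.ra a

lemma Same.refl (p : Prog) (m : Mem) : Same p m m :=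
  ⟨fun _ _ => rfl, fun _ _ => rfl, fun _ _ => rfl, fun _ _ => rfl⟩

lemma Same.trans {p : Prog} {m m' m'' : Mem} (h : Same p m m') (h' : Same p m' m'') :
    Same p m m'' :=
  ⟨fun x hx => (h'.nv x hx).trans (h.nv x hx), fun x hx => (h'.na x hx).trans (h.na x hx),
    fun x hx => (h'.rv x hx).trans (h.rv x hx), fun x hx => (h'.ra x hx).trans (h.ra x hx)⟩

lemma Same.weaken {p q : Prog} {m m' : Mem} (h : Same p m m')
    (hN : ∀ x, q.setsN x = false → p.setsN x = false)
    (hA : ∀ x, q.putsN x = false → p.putsN x = false)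
    (hR : ∀ x, q.setsR x = false → p.setsR x = false)
    (hB : ∀ x, q.putsR x = false → p.putsR x = false) : Same q m m' :=
  ⟨fun x hx => h.nv x (hN x hx), fun x hx => h.na x (hA x hx), fun x hx => h.rv x (hR x hx),
    fun x hx => h.ra x (hB x hx)⟩

/-- A frame rule read off the program text: for a concrete program, that a variable or array is not
a target holds by `rfl`. -/
lemma Runs.same {B : ℕ} {p : Prog} {m m' : Mem} {t : ℕ} (h : Runs B p m t m') :
    Same p m m' := by
  induction h with
  | skip m => exact Same.refl _ _
  | setN m x e h =>
    refine ⟨fun y hy => ?_, fun _ _ => rfl, fun _ _ => rfl, fun _ _ => rfl⟩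
    simp only [Prog.setsN, beq_eq_false_iff_ne] at hy
    simp [hy]
  | setR m x e =>
    refine ⟨fun _ _ => rfl, fun _ _ => rfl, fun y hy => ?_, fun _ _ => rfl⟩
    simp only [Prog.setsR, beq_eq_false_iff_ne] at hy
    simp [hy]
  | putN m a i e h =>
    refine ⟨fun _ _ => rfl, fun y hy => ?_, fun _ _ => rfl, fun _ _ => rfl⟩
    simp only [Prog.putsN, beq_eq_false_iff_ne] at hy
    funext j
    simp [hy]
  | putR m a i e =>
    refine ⟨fun _ _ => rfl, fun _ _ => rfl, fun _ _ => rfl, fun y hy => ?_⟩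
    simp only [Prog.putsR, beq_eq_false_iff_ne] at hy
    funext j
    simp [hy]
  | seq p q m m₁ m₂ t₁ t₂ h₁ h₂ ih1 ih2 =>
    exact (ih1.weaken (by simp [Prog.setsN]; tauto) (by simp [Prog.putsN]; tauto)
      (by simp [Prog.setsR]; tauto) (by simp [Prog.putsR]; tauto)).trans
      (ih2.weaken (by simp [Prog.setsN]) (by simp [Prog.putsN])
        (by simp [Prog.setsR]) (by simp [Prog.putsR]))
  | iteTrue b p q m m₁ t hb h ih =>
    exact ih.weaken (by simp [Prog.setsN]; tauto) (by simp [Prog.putsN]; tauto)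
      (by simp [Prog.setsR]; tauto) (by simp [Prog.putsR]; tauto)
  | iteFalse b p q m m₁ t hb h ih =>
    exact ih.weaken (by simp [Prog.setsN]) (by simp [Prog.putsN])
      (by simp [Prog.setsR]) (by simp [Prog.putsR])
  | whileTrue b p m m₁ m₂ t₁ t₂ hb h₁ h₂ ih1 ih2 =>
    exact Same.trans (p := .while b p)
      (ih1.weaken (fun _ h => h) (fun _ h => h) (fun _ h => h) (fun _ h => h)) ih2
  | whileFalse b p m hb => exact Same.refl _ _

/-- The program halts, and its running time and its result satisfy `Q`. -/
def WP (B : ℕ) (p : Prog) (m : Mem) (Q : ℕ → Mem → Prop) : Prop :=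
  ∃ t m', Runs B p m t m' ∧ Q t m'

section WP

variable {B : ℕ} {p q : Prog} {m : Mem} {Q Q' : ℕ → Mem → Prop} {b : Test}

/-- The new postcondition may use the frame, so specifications need to mention only what a program
changes. -/
lemma WP.mono (h : WP B p m Q) (hQ : ∀ t m', Same p m m' → Q t m' → Q' t m') :
    WP B p m Q' := by
  obtain ⟨t, m', h1, h2⟩ := h
  exact ⟨t, m', h1, hQ t m' h1.same h2⟩

@[simp] lemma wp_skip : WP B .skip m Q ↔ Q 1 m := by
  constructor
  · rintro ⟨t, m', h1, h2⟩
    cases h1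
    exact h2
  · exact fun h => ⟨_, _, .skip m, h⟩

@[simp] lemma wp_setN {x : ℕ} {e : NExp} :
    WP B (.setN x e) m Q ↔ e.eval m ≤ B ∧ Q (e.cost + 1) (m.setN x (e.eval m)) := by
  constructor
  · rintro ⟨t, m', h1, h2⟩
    cases h1 with
    | setN _ _ _ h => exact ⟨h, h2⟩
  · exact fun h => ⟨_, _, .setN m x e h.1, h.2⟩

@[simp] lemma wp_setR {x : ℕ} {e : RExp} :
    WP B (.setR x e) m Q ↔ Q (e.cost + 1) (m.setR x (e.eval m)) := by
  constructor
  · rintro ⟨t, m', h1, h2⟩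
    cases h1
    exact h2
  · exact fun h => ⟨_, _, .setR m x e, h⟩

@[simp] lemma wp_putN {a : ℕ} {i e : NExp} : WP B (.putN a i e) m Q ↔
    e.eval m ≤ B ∧ Q (i.cost + e.cost + 1) (m.putN a (i.eval m) (e.eval m)) := by
  constructor
  · rintro ⟨t, m', h1, h2⟩
    cases h1 with
    | putN _ _ _ _ h => exact ⟨h, h2⟩
  · exact fun h => ⟨_, _, .putN m a i e h.1, h.2⟩

@[simp] lemma wp_putR {a : ℕ} {i : NExp} {e : RExp} : WP B (.putR a i e) m Q ↔
    Q (i.cost + e.cost + 1) (m.putR a (i.eval m) (e.eval m)) := by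
  constructor
  · rintro ⟨t, m', h1, h2⟩
    cases h1
    exact h2
  · exact fun h => ⟨_, _, .putR m a i e, h⟩

@[simp] lemma wp_seq : WP B (.seq p q) m Q ↔
    WP B p m fun t m' => WP B q m' fun t' m'' => Q (t + t') m'' := by
  constructor
  · rintro ⟨t, m', h1, h2⟩
    cases h1 with
    | seq _ _ _ m₁ _ t₁ t₂ h3 h4 => exact ⟨_, _, h3, _, _, h4, h2⟩
  · rintro ⟨t₁, m₁, h1, t₂, m₂, h2, h3⟩
    exact ⟨_, _, .seq _ _ _ _ _ _ _ h1 h2, h3⟩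

@[simp] lemma wp_ite : WP B (.ite b p q) m Q ↔
    (b.Holds m → WP B p m fun t m' => Q (b.cost + t) m') ∧
    (¬ b.Holds m → WP B q m fun t m' => Q (b.cost + t) m') := by
  constructor
  · rintro ⟨t, m', h1, h2⟩
    cases h1 with
    | iteTrue _ _ _ _ _ t hb h => exact ⟨fun _ => ⟨_, _, h, h2⟩, fun h' => absurd hb h'⟩
    | iteFalse _ _ _ _ _ t hb h => exact ⟨fun h' => absurd h' hb, fun _ => ⟨_, _, h, h2⟩⟩
  · rintro ⟨h1, h2⟩
    by_cases hb : b.Holds m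
    · obtain ⟨t, m', h3, h4⟩ := h1 hb
      exact ⟨_, _, .iteTrue _ _ _ _ _ _ hb h3, h4⟩
    · obtain ⟨t, m', h3, h4⟩ := h2 hb
      exact ⟨_, _, .iteFalse _ _ _ _ _ _ hb h3, h4⟩

/-- Loops with an invariant and a potential that bounds the remaining time. -/
lemma wp_while (I : Mem → ℕ → Prop) {k : ℕ} (h0 : I m k)
    (hstep : ∀ m' k', Same p m m' → I m' k' → b.Holds m' →
      WP B p m' fun t m'' => ∃ k'', b.cost + t + k'' ≤ k' ∧ I m'' k'') :
    WP B (.while b p) m fun t m' =>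
      ¬ b.Holds m' ∧ ∃ k', I m' k' ∧ t + k' ≤ k + b.cost := by
  induction k using Nat.strong_induction_on generalizing m with
  | _ k ih =>
    by_cases hb : b.Holds m
    · obtain ⟨t, m₁, hr, k₁, hk, hI⟩ := hstep m k (Same.refl _ _) h0 hb
      -- A test is never free, so each round lowers the potential strictly and the loop ends.
      have hc := b.cost_pos
      obtain ⟨t', m₂, hr', hb', k', hI', hk'⟩ := ih k₁ (by omega) hI fun m' k' hs hI hb =>
        hstep m' k' (hr.same.trans hs) hI hb
      exact ⟨_, _, .whileTrue _ _ _ _ _ _ _ hb hr hr', hb', k', hI', by omega⟩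
    · exact ⟨_, _, .whileFalse _ _ _ hb, hb, k, h0, by omega⟩

/-- Count a natural variable up from `0` to the value of another one. -/
def Prog.for (i lim : ℕ) (p : Prog) : Prog :=
  .seq (.setN i (.const 0)) (.while (.ltN (.var i) (.var lim))
    (.seq p (.setN i (.add (.var i) (.const 1)))))

/-- Each round has the allowance `c` and may also draw on the potential `k`, which makes amortised
bounds possible. The `7` is the test (`3`) and the increment (`4`); the `5` is the initial
assignment (`2`) and the failing test (`3`). -/
lemma wp_for {i lim : ℕ} (I : ℕ → Mem → ℕ → Prop) (c : ℕ) {k : ℕ}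
    (h0 : I 0 (m.setN i 0) k) (hne : lim ≠ i) (hi : p.setsN i = false)
    (hlim : p.setsN lim = false) (hB : m.nv lim ≤ B)
    (hstep : ∀ j m' k', j < m.nv lim → Same (Prog.for i lim p) m m' → m'.nv i = j → I j m' k' →
      WP B p m' fun t m'' => ∃ k'', t + k'' ≤ k' + c ∧ I (j + 1) (m''.setN i (j + 1)) k'') :
    WP B (Prog.for i lim p) m fun t m' =>
      ∃ k', t + k' ≤ k + m.nv lim * (c + 7) + 5 ∧ I (m.nv lim) m' k' := by
  have hsame : ∀ m', Same (.seq p (.setN i (.add (.var i) (.const 1)))) (m.setN i 0) m' →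
      Same (Prog.for i lim p) m m' := fun m' h => by
    refine ⟨fun x hx => ?_, fun x hx => ?_, fun x hx => ?_, fun x hx => ?_⟩
    · simp only [Prog.for, Prog.setsN, Bool.or_eq_false_iff, beq_eq_false_iff_ne] at hx
      rw [h.nv x (by simp [Prog.setsN, hx])]
      simp [hx]
    · simp only [Prog.for, Prog.putsN, Bool.or_eq_false_iff] at hx
      exact h.na x (by simp [Prog.putsN, hx])
    · simp only [Prog.for, Prog.setsR, Bool.or_eq_false_iff] at hx
      exact h.rv x (by simp [Prog.setsR, hx])
    · simp only [Prog.for, Prog.putsR, Bool.or_eq_false_iff] at hx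
      exact h.ra x (by simp [Prog.putsR, hx])
  rw [Prog.for, wp_seq, wp_setN]
  refine ⟨Nat.zero_le _, ?_⟩
  refine WP.mono (wp_while (fun m' k' => ∃ j k'', j ≤ m.nv lim ∧ m'.nv i = j ∧ I j m' k'' ∧
    k' = k'' + (m.nv lim - j) * (c + 7)) (k := k + m.nv lim * (c + 7))
    ⟨0, k, Nat.zero_le _, by simp, h0, by simp⟩ ?_) ?_
  · rintro m' k' hs ⟨j, k'', hj, hij, hI, rfl⟩ hb
    have hl : m'.nv lim = m.nv lim := by
      rw [hs.nv lim (by simp [Prog.setsN, hlim, hne])]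
      simp [hne]
    simp only [Test.Holds, NExp.eval, hij, hl] at hb
    rw [wp_seq]
    refine WP.mono (hstep j m' k'' hb (hsame m' hs) hij hI) ?_
    rintro t m'' hs' ⟨k₁, hk₁, hI'⟩
    have hi' : m''.nv i = j := by rw [hs'.nv i hi, hij]
    simp only [wp_setN, NExp.eval, hi', NExp.cost, Test.cost]
    refine ⟨by omega, k₁ + (m.nv lim - (j + 1)) * (c + 7), ?_, j + 1, k₁, hb, by simp, hI', rfl⟩
    obtain ⟨d, hd⟩ := Nat.exists_eq_add_of_lt hb
    rw [show m.nv lim - j = d + 1 by omega, show m.nv lim - (j + 1) = d by omega, Nat.add_mul]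
    omega
  · rintro t m' hs ⟨hb, k', ⟨j, k'', hj, hij, hI, rfl⟩, hk⟩
    have hl : m'.nv lim = m.nv lim := by
      rw [hs.nv lim (by simp [Prog.setsN, hlim, hne])]
      simp [hne]
    simp only [Test.Holds, NExp.eval, hij, hl] at hb
    obtain rfl : j = m.nv lim := by omega
    refine ⟨k'', ?_, hI⟩
    simp only [NExp.cost, Test.cost] at hk ⊢
    omega

end WP

end RAM

/-! ### Marking inner vertices and finding heaviest edges on root paths -/

namespace RAM

/-- The memory holds the input: a tree with real weights, and natural weights `f`, `g`. -/
structure Input {n : ℕ} (T : WTree (Fin n) ℝ) (f g : Fin n → ℕ) (m : Mem) : Prop where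
  nv0 : m.nv 0 = n
  nv1 : m.nv 1 = T.root
  na0 : ∀ v : Fin n, m.na 0 v = T.parent v
  na1 : ∀ v : Fin n, m.na 1 v = f v
  na2 : ∀ v : Fin n, m.na 2 v = g v
  ra0 : ∀ v : Fin n, m.ra 0 v = T.vw v
  ra1 : ∀ v : Fin n, m.ra 1 v = T.inWeight v

/-- The program does not change the input. -/
def Prog.keepsInput (p : Prog) : Bool :=
  !p.setsN 0 && !p.setsN 1 && !p.putsN 0 && !p.putsN 1 && !p.putsN 2 && !p.putsR 0 && !p.putsR 1

lemma Input.of_same {n : ℕ} {T : WTree (Fin n) ℝ} {f g : Fin n → ℕ} {m m' : Mem} {p : Prog}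
    (h : Input T f g m) (hs : Same p m m') (hp : p.keepsInput = true) : Input T f g m' := by
  simp only [Prog.keepsInput, Bool.and_eq_true, Bool.not_eq_true'] at hp
  obtain ⟨⟨⟨⟨⟨⟨h0, h1⟩, h2⟩, h3⟩, h4⟩, h5⟩, h6⟩ := hp
  exact ⟨(hs.nv _ h0).trans h.nv0, (hs.nv _ h1).trans h.nv1, by rw [hs.na _ h2]; exact h.na0,
    by rw [hs.na _ h3]; exact h.na1, by rw [hs.na _ h4]; exact h.na2,
    by rw [hs.ra _ h5]; exact h.ra0, by rw [hs.ra _ h6]; exact h.ra1⟩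

section

variable {n : ℕ} {T : WTree (Fin n) ℝ} {f g : Fin n → ℕ} {m : Mem} {B : ℕ}

/-- Mark the vertices that are predecessors in natural array `4`. -/
def markParents : Prog :=
  .for 3 0 (.ite (.eqN (.var 3) (.var 1)) .skip (.putN 4 (.get 0 (.var 3)) (.const 1)))

/-- Natural array `4` is `0` exactly at vertices without successor. -/
def ParentsMarked (T : WTree (Fin n) ℝ) (m : Mem) : Prop :=
  ∀ v : Fin n, m.na 4 v = 0 ↔ ∀ u, u ≠ T.root → T.parent u ≠ v

lemma wp_markParents (hin : Input T f g m) (h4 : ∀ i, m.na 4 i = 0) (hB : n ≤ B) (hB1 : 1 ≤ B) :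
    WP B markParents m fun t m' => t ≤ 20 * n + 5 ∧ ParentsMarked T m' := by
  refine WP.mono (wp_for (fun j m' k' => ∀ v : Fin n, m'.na 4 v = 0 ↔
    ∀ u : Fin n, (u : ℕ) < j → u ≠ T.root → T.parent u ≠ v) 10 (k := 0) ?_ (by decide) rfl rfl
    (by rw [hin.nv0]; exact hB) ?_) ?_
  · simp [h4]
  · intro j m' k' hj hs hij hI
    have hin' := hin.of_same hs rfl
    rw [hin.nv0] at hj
    have hp := hin'.na0 ⟨j, hj⟩
    have hroot : (j = (T.root : ℕ)) ↔ (⟨j, hj⟩ : Fin n) = T.root := by rw [Fin.ext_iff]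
    simp only [wp_ite, Test.Holds, NExp.eval, hij, hin'.nv1, wp_skip, wp_putN, hB1]
    simp only at hp
    have hlt : ∀ u : Fin n, (u : ℕ) < j + 1 ↔ (u : ℕ) < j ∨ u = ⟨j, hj⟩ := fun u => by
      rw [Fin.ext_iff]; simp only []; omega
    refine ⟨fun h => ⟨0, by simp, fun v => ?_⟩, fun h => ⟨trivial, 0, by simp, fun v => ?_⟩⟩
    · simp only [setN_na, hI v]
      refine forall_congr' fun u => ?_
      rw [hlt]
      constructor
      · rintro h1 (h2 | rfl) h3
        · exact h1 h2 h3
        · exact absurd (hroot.1 h) h3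
      · exact fun h1 h2 => h1 (.inl h2)
    · simp only [setN_na, putN_na, hp, if_true]
      split_ifs with h1
      · simp only [false_iff, not_forall, not_not]
        exact ⟨⟨j, hj⟩, by simp, fun h2 => h (hroot.2 h2), (Fin.ext h1).symm⟩
      · rw [hI v]
        refine forall_congr' fun u => ?_
        rw [hlt]
        constructor
        · rintro h2 (h3 | rfl) h4
          · exact h2 h3 h4
          · exact fun h5 => h1 (by rw [h5])
        · exact fun h1 h2 => h1 (.inl h2)
  · rintro t m' hs ⟨k', hk, hI⟩
    rw [hin.nv0] at hk hI
    refine ⟨by omega, fun v => (hI v).trans ?_⟩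
    exact forall_congr' fun u => by simp [u.2]

lemma ParentsMarked.isLeaf_iff (h : ParentsMarked T m) (v : Fin n) :
    T.IsLeaf v ↔ v ≠ T.root ∧ m.na 4 v = 0 := by
  rw [T.isLeaf_iff, h v]

/-- Push the vertices on the path from vertex variable `4` up to the first vertex that is
marked in array `6`, and mark them. -/
def climb : Prog :=
  .while (.eqN (.get 6 (.var 4)) (.const 0))
    (.seq (.putN 7 (.var 5) (.var 4)) (.seq (.putN 6 (.var 4) (.const 1))
      (.seq (.setN 5 (.add (.var 5) (.const 1))) (.setN 4 (.get 0 (.var 4))))))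

/-- Pop the vertices from the stack and compute their dominating vertices in array `5`. -/
def descend : Prog :=
  .while (.ltN (.const 0) (.var 5))
    (.seq (.setN 5 (.sub (.var 5) (.const 1))) (.seq (.setN 4 (.get 7 (.var 5)))
      (.seq (.setN 6 (.get 5 (.get 0 (.var 4))))
        (.ite (.ltR (.get 1 (.var 6)) (.get 1 (.var 4)))
          (.putN 5 (.var 4) (.var 4)) (.putN 5 (.var 4) (.var 6))))))

/-- Compute for each vertex the lower end of a heaviest edge on the path from the root. -/
def dominators : Prog :=
  .seq (.putN 6 (.var 1) (.const 1)) (.seq (.putN 5 (.var 1) (.var 1))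
    (.for 3 0 (.seq (.setN 4 (.var 3)) (.seq (.setN 5 (.const 0)) (.seq climb descend)))))

/-- Array `5` holds a vertex with a heaviest edge on the path to `v`. -/
def DomAt (T : WTree (Fin n) ℝ) (m : Mem) (v : Fin n) : Prop :=
  ∃ d : Fin n, m.na 5 v = d ∧ T.inWeight d = T.key v

end

end RAM

namespace WTree

variable {V : Type*} (T : WTree V ℝ)

lemma depth_iterate_parent {b : V} {s : ℕ} (h : ∀ r < s, T.parent^[r] b ≠ T.root) :
    T.depth (T.parent^[s] b) + s = T.depth b := by
  induction s with
  | zero => rfl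
  | succ s ih =>
    have h1 := ih fun r hr => h r (by omega)
    rw [T.depth_parent (h s (by omega))] at h1
    rw [Function.iterate_succ_apply']
    omega

/-- Depth drops at every step of a climb. Thus the marked vertex that stops a climb is not one
marked during this climb. -/
lemma iterate_parent_ne {b : V} {r s : ℕ} (h : ∀ r < s, T.parent^[r] b ≠ T.root) (hr : r < s) :
    T.parent^[s] b ≠ T.parent^[r] b := by
  intro he
  have h1 := T.depth_iterate_parent h
  have h2 := T.depth_iterate_parent (s := r) fun q hq => h q (by omega)
  rw [he] at h1
  omega

end WTree

namespace RAM

section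

variable {n : ℕ} {T : WTree (Fin n) ℝ} {f g : Fin n → ℕ} {m : Mem} {B : ℕ}

/-- `A` is the set of vertices treated before. Each round marks a new vertex, so the number of
unmarked vertices is the potential; the marked root stops the climb at the latest. -/
lemma wp_climb (hin : Input T f g m) (hB : n ≤ B) (A : Finset (Fin n)) (hroot : T.root ∈ A)
    (b : Fin n) (h6 : ∀ v : Fin n, m.na 6 v = if v ∈ A then 1 else 0) (h4 : m.nv 4 = b)
    (h5 : m.nv 5 = 0) :
    WP B climb m fun t m' => ∃ (s : ℕ) (A' : Finset (Fin n)),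
      (∀ v, v ∈ A' ↔ v ∈ A ∨ ∃ r < s, v = T.parent^[r] b) ∧
      (∀ v : Fin n, m'.na 6 v = if v ∈ A' then 1 else 0) ∧ m'.nv 5 = s ∧
      (∀ r < s, m'.na 7 r = T.parent^[r] b) ∧ (∀ r < s, T.parent^[r] b ∉ A) ∧
      T.parent^[s] b ∈ A ∧ A'ᶜ.card + s = Aᶜ.card ∧ t ≤ 17 * s + 4 := by
  refine WP.mono (wp_while (fun m' k => ∃ (s : ℕ) (A' : Finset (Fin n)),
      (∀ v, v ∈ A' ↔ v ∈ A ∨ ∃ r < s, v = T.parent^[r] b) ∧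
      (∀ v : Fin n, m'.na 6 v = if v ∈ A' then 1 else 0) ∧ m'.nv 5 = s ∧
      m'.nv 4 = T.parent^[s] b ∧
      (∀ r < s, m'.na 7 r = T.parent^[r] b) ∧ (∀ r < s, T.parent^[r] b ∉ A) ∧
      A'ᶜ.card + s = Aᶜ.card ∧ k = 17 * A'ᶜ.card) (k := 17 * Aᶜ.card)
      ⟨0, A, by simp, h6, h5, h4, by simp, by simp, by simp, rfl⟩ ?_) ?_
  · rintro m' k hs ⟨s, A', hA', h6', h5', h4', h7', hnA, hcard, rfl⟩ hb
    have hin' := hin.of_same hs rfl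
    simp only [Test.Holds, NExp.eval, h4', h6', ite_eq_right_iff, one_ne_zero, imp_false] at hb
    have hx : T.parent^[s] b ∉ A := fun h => hb ((hA' _).2 (.inl h))
    have hc : (insert (T.parent^[s] b) A')ᶜ.card + 1 = A'ᶜ.card := by
      rw [Finset.compl_insert, Finset.card_erase_of_mem (by simpa using hb)]
      have : 0 < A'ᶜ.card := Finset.card_pos.2 ⟨_, by simpa using hb⟩
      omega
    have hAn := Finset.card_le_univ Aᶜ
    rw [Fintype.card_fin] at hAn
    have hlt := (T.parent^[s] b).2
    have hlt' := (T.parent (T.parent^[s] b)).2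
    simp only [wp_seq, wp_putN, wp_setN, NExp.eval, NExp.cost, Test.cost, setN_nv, setN_na, putN_na,
      putN_nv, h4', h5', hin'.na0, if_true, Nat.reduceEqDiff, if_false]
    refine ⟨by omega, by omega, by omega, by omega, _, ?_, s + 1, insert (T.parent^[s] b) A',
      fun v => ?_, fun v => ?_, rfl, ?_, fun r hr => ?_, fun r hr => ?_, by omega, rfl⟩
    · omega
    · rw [Finset.mem_insert, hA']
      constructor
      · rintro (rfl | h | ⟨r, hr, h⟩)
        · exact .inr ⟨s, by omega, rfl⟩
        · exact .inl h
        · exact .inr ⟨r, by omega, h⟩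
      · rintro (h | ⟨r, hr, h⟩)
        · exact .inr (.inl h)
        · rcases (Nat.lt_succ_iff.1 hr).lt_or_eq with hr | rfl
          · exact .inr (.inr ⟨r, hr, h⟩)
          · exact .inl h
    · simp only [h6', ← Fin.ext_iff, Finset.mem_insert]
      by_cases h : v = T.parent^[s] b <;> simp [h]
    · rw [Function.iterate_succ_apply']
    · by_cases h : r = s
      · simp [h]
      · simp [h, h7' r (by omega)]
    · rcases (Nat.lt_succ_iff.1 hr).lt_or_eq with hr | rfl
      · exact hnA r hr
      · exact hx
  · rintro t m' hs ⟨hb, k, ⟨s, A', hA', h6', h5', h4', h7', hnA, hcard, rfl⟩, ht⟩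
    simp only [Test.Holds, NExp.eval, h4', h6', ite_eq_right_iff, one_ne_zero, imp_false,
      not_not] at hb
    simp only [Test.cost, NExp.cost] at ht
    refine ⟨s, A', hA', h6', h5', h7', hnA, ?_, hcard, by omega⟩
    rcases (hA' _).1 hb with h | ⟨r, hr, h⟩
    · exact h
    · exact absurd h (T.iterate_parent_ne (fun q hq h => hnA q hq (h ▸ hroot)) hr)

/-- The stack returns the climbed vertices from the top of the tree downwards. So the predecessor
always has its heaviest edge already, and `key_eq` reduces the next one to a single comparison. -/
lemma wp_descend (hin : Input T f g m) (hB : n ≤ B) (b : Fin n) (s : ℕ)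
    (hr : ∀ r < s, T.parent^[r] b ≠ T.root) (h5 : m.nv 5 = s) (hs : s ≤ n)
    (h7 : ∀ r < s, m.na 7 r = T.parent^[r] b) (hx : DomAt T m (T.parent^[s] b)) :
    WP B descend m fun t m' => (∀ v : Fin n, (∀ r < s, v ≠ T.parent^[r] b) → m'.na 5 v = m.na 5 v) ∧
      (∀ r ≤ s, DomAt T m' (T.parent^[r] b)) ∧ t ≤ 22 * s + 3 := by
  refine WP.mono (wp_while (fun m' k => ∃ q ≤ s, m'.nv 5 = q ∧
    (∀ v : Fin n, (∀ r < s, v ≠ T.parent^[r] b) → m'.na 5 v = m.na 5 v) ∧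
    (∀ r ≤ s, q ≤ r → DomAt T m' (T.parent^[r] b)) ∧ k = 22 * q)
    ⟨s, le_rfl, h5, fun _ _ => rfl, fun r h1 h2 => by rwa [le_antisymm h1 h2], rfl⟩ ?_) ?_
  · rintro m' k hsame ⟨q, hq, h5', hfix, hdom, rfl⟩ hb
    have hin' := hin.of_same hsame rfl
    simp only [Test.Holds, NExp.eval, h5'] at hb
    obtain ⟨q, rfl⟩ : ∃ p, q = p + 1 := ⟨q - 1, by omega⟩
    obtain ⟨d, hd, hd'⟩ := hdom (q + 1) hq le_rfl
    rw [Function.iterate_succ_apply'] at hd hd'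
    have h7' : m'.na 7 q = T.parent^[q] b := by
      rw [hsame.na 7 rfl]; exact h7 q (by omega)
    have hne := hr q (by omega)
    have hk := T.key_eq hne
    have hlt := (T.parent^[q] b).2
    have hdl := d.2
    simp only [wp_seq, wp_putN, wp_setN, wp_ite, NExp.eval, NExp.cost, RExp.cost, Test.cost, setN_nv,
      setN_na, RExp.eval, Test.Holds, h5', h7', hin'.na0, if_true, Nat.reduceEqDiff, if_false,
      add_tsub_cancel_right, hd, setN_ra, hin'.ra1]
    have hmain : ∀ e : Fin n, T.inWeight e = T.key (T.parent^[q] b) →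
        ∃ q' ≤ s, q = q' ∧
        (∀ v : Fin n, (∀ r < s, v ≠ T.parent^[r] b) →
          (if (v : ℕ) = T.parent^[q] b then (e : ℕ) else m'.na 5 v) = m.na 5 v) ∧
        (∀ r ≤ s, q' ≤ r → ∃ d : Fin n,
          (if (T.parent^[r] b : ℕ) = T.parent^[q] b then (e : ℕ) else m'.na 5 (T.parent^[r] b)) = d ∧
          T.inWeight d = T.key (T.parent^[r] b)) ∧ 22 * q = 22 * q' := by
      intro e he
      refine ⟨q, by omega, rfl, fun v hv => ?_, fun r hrs hqr => ?_, rfl⟩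
      · rw [if_neg fun h => hv q (by omega) (Fin.ext h)]
        exact hfix v hv
      · by_cases hrq : T.parent^[r] b = T.parent^[q] b
        · exact ⟨e, by simp [hrq], by rw [he, hrq]⟩
        · have hqr' : q ≠ r := fun h => hrq (by rw [h])
          obtain ⟨d', h1, h2⟩ := hdom r hrs (by omega)
          exact ⟨d', by rw [if_neg fun h => hrq (Fin.ext h), h1], h2⟩
    refine ⟨by omega, by omega, by omega, fun h => ⟨by omega, 22 * q, by omega, ?_⟩,
      fun h => ⟨by omega, 22 * q, by omega, ?_⟩⟩
    · simpa [DomAt] using hmain (T.parent^[q] b) (by rw [hk, max_eq_right (by rw [← hd']; exact h.le)])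
    · simpa [DomAt] using hmain d (by rw [hk, max_eq_left (by rw [← hd']; exact not_lt.1 h), hd'])
  · rintro t m' hsame ⟨hb, k, ⟨q, hq, h5', hfix, hdom, rfl⟩, ht⟩
    simp only [Test.Holds, NExp.eval, h5'] at hb
    simp only [Test.cost, NExp.cost] at ht
    obtain rfl : q = 0 := by omega
    exact ⟨hfix, fun r hr => hdom r hr (Nat.zero_le _), by omega⟩

/-- A single climb may be long, but every vertex is climbed over and come back to once in total. It
pays `17 + 22 = 39` units from the potential when it is marked. Storing a vertex instead of a weight
lets the result serve real and natural weights alike. -/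
lemma wp_dominators (hin : Input T f g m) (h6 : ∀ i, m.na 6 i = 0) (hB : n ≤ B) (hB1 : 1 ≤ B) :
    WP B dominators m fun t m' => t ≤ 100 * n + 20 ∧ ∀ v, DomAt T m' v := by
  have hroot := T.root.2
  simp only [dominators, wp_seq, wp_putN, NExp.eval, NExp.cost, putN_nv, hin.nv1, hB1, true_and]
  refine ⟨by omega, ?_⟩
  have hm0 : ∀ v : Fin n, ((m.putN 6 T.root 1).putN 5 T.root T.root).na 6 v =
      if v = T.root then 1 else 0 := fun v => by
    simp [Fin.ext_iff, h6]
  have hm5 : DomAt T ((m.putN 6 T.root 1).putN 5 T.root T.root) T.root :=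
    ⟨T.root, by simp, by rw [T.inWeight_root, T.key_root]⟩
  have hm : Input T f g ((m.putN 6 T.root 1).putN 5 T.root T.root) :=
    ⟨hin.nv0, hin.nv1, by simpa using hin.na0, by simpa using hin.na1, by simpa using hin.na2,
      hin.ra0, hin.ra1⟩
  generalize (m.putN 6 T.root 1).putN 5 T.root T.root = m₀ at hm0 hm5 hm
  refine WP.mono (wp_for (fun j m' k => ∃ A : Finset (Fin n), T.root ∈ A ∧
    (∀ v ∈ A, T.parent v ∈ A) ∧ (∀ v : Fin n, (v : ℕ) < j → v ∈ A) ∧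
    (∀ v : Fin n, m'.na 6 v = if v ∈ A then 1 else 0) ∧ (∀ v ∈ A, DomAt T m' v) ∧
    k = 39 * Aᶜ.card) 20 (k := 39 * ({T.root} : Finset (Fin n))ᶜ.card) ?_ (by decide) rfl rfl
    (by rw [hm.nv0]; exact hB) ?_) ?_
  · refine ⟨{T.root}, by simp, by simp [T.parent_root], by simp, fun v => ?_, fun v hv => ?_, rfl⟩
    · rw [setN_na, hm0 v]
      simp
    · rw [Finset.mem_singleton.1 hv]
      exact hm5
  · rintro j m' k hj hs hij ⟨A, hA, hAp, hjA, h6', hdom, rfl⟩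
    rw [hm.nv0] at hj
    simp only [wp_seq, wp_setN, NExp.eval, NExp.cost, hij]
    refine ⟨by omega, by omega, ?_⟩
    have hin' := hm.of_same hs rfl
    refine WP.mono (wp_climb (f := f) (g := g) (b := ⟨j, hj⟩) (A := A) ?_ hB hA h6' (by simp) (by simp)) ?_
    · exact ⟨hin'.nv0, hin'.nv1, hin'.na0, hin'.na1, hin'.na2, hin'.ra0, hin'.ra1⟩
    rintro t m₁ hs₁ ⟨s, A', hA', h6₁, h5₁, h7₁, hsA, hxA, hcard, ht⟩
    have hin₁ : Input T f g m₁ := by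
      refine Input.of_same (p := climb) (m := (m'.setN 4 j).setN 5 0) ?_ hs₁ rfl
      exact ⟨hin'.nv0, hin'.nv1, hin'.na0, hin'.na1, hin'.na2, hin'.ra0, hin'.ra1⟩
    have h5eq : m₁.na 5 = m'.na 5 := hs₁.na 5 rfl
    have hdom₁ : ∀ v ∈ A, DomAt T m₁ v := fun v hv => by
      obtain ⟨d, h1, h2⟩ := hdom v hv
      exact ⟨d, by rw [h5eq, h1], h2⟩
    have hsn : s ≤ n := by
      have := Finset.card_le_univ Aᶜ
      rw [Fintype.card_fin] at this
      omega
    refine WP.mono (wp_descend hin₁ hB ⟨j, hj⟩ s (fun r hr h => hsA r hr (h ▸ hA)) h5₁ hsn h7₁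
      (hdom₁ _ hxA)) ?_
    rintro t₂ m₂ hs₂ ⟨hfix, hdom₂, ht₂⟩
    refine ⟨39 * A'ᶜ.card, by omega, A', (hA' _).2 (.inl hA), fun v hv => ?_, fun v hv => ?_,
      fun v => ?_, fun v hv => ?_, rfl⟩
    · rcases (hA' v).1 hv with h | ⟨r, hr, rfl⟩
      · exact (hA' _).2 (.inl (hAp v h))
      · rw [← Function.iterate_succ_apply' T.parent r]
        rcases (show r + 1 ≤ s from hr).lt_or_eq with h | h
        · exact (hA' _).2 (.inr ⟨r + 1, h, rfl⟩)
        · rw [Nat.succ_eq_add_one, h]; exact (hA' _).2 (.inl hxA)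
    · rcases (Nat.lt_succ_iff.1 hv).lt_or_eq with h | h
      · exact (hA' _).2 (.inl (hjA v h))
      · obtain rfl : v = ⟨j, hj⟩ := Fin.ext h
        cases s with
        | zero => exact (hA' _).2 (.inl hxA)
        | succ s => exact (hA' _).2 (.inr ⟨0, by omega, rfl⟩)
    · rw [setN_na, hs₂.na 6 rfl]
      exact h6₁ v
    · by_cases hvs : ∃ r ≤ s, v = T.parent^[r] ⟨j, hj⟩
      · obtain ⟨r, hr, rfl⟩ := hvs
        exact hdom₂ r hr
      · push Not at hvs
        have hvA : v ∈ A := by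
          rcases (hA' v).1 hv with h | ⟨r, hr, rfl⟩
          · exact h
          · exact absurd rfl (hvs r hr.le)
        obtain ⟨d, h1, h2⟩ := hdom₁ v hvA
        exact ⟨d, by rw [setN_na, hfix v fun r hr => hvs r hr.le, h1], h2⟩
  · rintro t m' hs ⟨k, hk, A, -, -, hA, -, hdom, rfl⟩
    rw [hm.nv0] at hk hA
    have hcn := Finset.card_le_univ ({T.root} : Finset (Fin n))ᶜ
    rw [Fintype.card_fin] at hcn
    exact ⟨by omega, fun v => hdom v (hA v v.2)⟩

end

end RAM

/-! ### Evaluating the number of agents for a list of leaves -/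

namespace RAM

section

variable {n : ℕ} {T : WTree (Fin n) ℝ} {f g : Fin n → ℕ} {m : Mem} {B : ℕ}

/-- Settle the vertices on the path from vertex variable `4` up to the first settled one. -/
def settlePath : Prog :=
  .while (.eqN (.get 9 (.var 4)) (.const 0))
    (.seq (.putN 9 (.var 4) (.const 1)) (.seq (.setR 1 (.add (.var 1) (.get 0 (.var 4))))
      (.seq (.setN 6 (.add (.var 6) (.get 1 (.var 4)))) (.setN 4 (.get 0 (.var 4))))))

/-- Compute the number of agents for visiting the leaves in array `3` one after the other. -/
def agents : Prog :=
  .seq (.putN 9 (.var 1) (.const 1)) (.seq (.setR 1 (.get 0 (.var 1))) (.seq (.setR 0 (.var 1))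
    (.seq (.setN 6 (.get 1 (.var 1))) (.seq (.setN 2 (.var 6))
      (.for 3 7 (.seq (.setN 5 (.get 3 (.var 3))) (.seq (.setN 4 (.var 5)) (.seq settlePath
        (.ite (.ltR (.var 0) (.add (.get 1 (.get 5 (.var 5))) (.var 1)))
          (.seq (.setR 0 (.add (.get 1 (.get 5 (.var 5))) (.var 1)))
            (.setN 2 (.add (.get 2 (.get 5 (.var 5))) (.var 6)))) .skip)))))))))

/-- Array `3` lists the leaves of the tree. -/
structure ListsLeaves (T : WTree (Fin n) ℝ) (l : List (Fin n)) (m : Mem) : Prop where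
  mem : ∀ b, b ∈ l ↔ T.IsLeaf b
  nodup : l.Nodup
  nv7 : m.nv 7 = l.length
  na3 : ∀ i (h : i < l.length), m.na 3 i = l[i]

lemma ListsLeaves.length_le {l : List (Fin n)} (h : ListsLeaves T l m) : l.length ≤ n := by
  rw [← List.toFinset_card_of_nodup h.nodup]
  exact (Finset.card_le_univ _).trans (by rw [Fintype.card_fin])

/-- The settled set `A` is closed under ancestors. So climbing from `b` may stop at the first
settled vertex, and the whole root path of `b` is settled afterwards. -/
lemma wp_settlePath (hin : Input T f g m) (hB : n ≤ B) (hB1 : 1 ≤ B) (hf : ∑ v, f v ≤ B)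
    (A : Finset (Fin n)) (hroot : T.root ∈ A) (hA : ∀ u v, T.Anc u v → v ∈ A → u ∈ A) (b : Fin n)
    (h9 : ∀ v : Fin n, m.na 9 v = if v ∈ A then 1 else 0) (h4 : m.nv 4 = b)
    (h6 : m.nv 6 = ∑ v ∈ A, f v) (h1 : m.rv 1 = ∑ v ∈ A, T.vw v) :
    WP B settlePath m fun t m' => ∃ A' : Finset (Fin n), (∀ v, v ∈ A' ↔ v ∈ A ∨ T.Anc v b) ∧
      (∀ v : Fin n, m'.na 9 v = if v ∈ A' then 1 else 0) ∧ m'.nv 6 = ∑ v ∈ A', f v ∧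
      m'.rv 1 = ∑ v ∈ A', T.vw v ∧ t + 20 * A'ᶜ.card ≤ 20 * Aᶜ.card + 4 := by
  refine WP.mono (wp_while (fun m' k => ∃ (x : Fin n) (A' : Finset (Fin n)), T.Anc x b ∧
    (∀ v, v ∈ A' ↔ v ∈ A ∨ (T.Anc v b ∧ ¬ T.Anc v x)) ∧
    (∀ v : Fin n, m'.na 9 v = if v ∈ A' then 1 else 0) ∧ m'.nv 6 = ∑ v ∈ A', f v ∧
    m'.rv 1 = ∑ v ∈ A', T.vw v ∧ m'.nv 4 = x ∧ k = 20 * A'ᶜ.card)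
    ⟨b, A, T.anc_refl b, by simp, h9, h6, h1, h4, rfl⟩ ?_) ?_
  · rintro m' k hs ⟨x, A', hxb, hA', h9', h6', h1', h4', rfl⟩ hb
    have hin' := hin.of_same hs rfl
    simp only [Test.Holds, NExp.eval, h4', h9', ite_eq_right_iff, one_ne_zero, imp_false] at hb
    have hxA : x ∉ A := fun h => hb ((hA' _).2 (.inl h))
    have hxr : x ≠ T.root := fun h => hxA (h ▸ hroot)
    have hc : (insert x A')ᶜ.card + 1 = A'ᶜ.card := by
      rw [Finset.compl_insert, Finset.card_erase_of_mem (by simpa using hb)]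
      have : 0 < A'ᶜ.card := Finset.card_pos.2 ⟨_, by simpa using hb⟩
      omega
    have hle : ∑ v ∈ A', f v + f x ≤ B := by
      rw [add_comm, ← Finset.sum_insert hb]
      exact (Finset.sum_le_sum_of_subset (Finset.subset_univ _)).trans hf
    have hlt' := (T.parent x).2
    simp only [wp_seq, wp_putN, wp_setN, wp_setR, NExp.eval, NExp.cost, Test.cost, RExp.cost,
      RExp.eval, setN_nv, setN_na, putN_na, setN_rv, setR_rv, setR_nv, setR_na,
      putN_nv, putN_rv, putN_ra, h4', h6', h1', hin'.na0, hin'.na1, hin'.ra0, if_true,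
      Nat.reduceEqDiff, if_false]
    refine ⟨hB1, hle, by omega, _, ?_, T.parent x, insert x A', (WTree.Anc.parent T (T.anc_refl _)).trans hxb,
      fun v => ?_, fun v => ?_, ?_, ?_, rfl, rfl⟩
    · omega
    · rw [Finset.mem_insert, hA', T.anc_iff hxr]
      constructor
      · rintro (rfl | h | ⟨h1, h2⟩)
        · refine .inr ⟨hxb, fun h => ?_⟩
          have h2 := h.depth_le
          rw [T.depth_parent hxr] at h2
          omega
        · exact .inl h
        · exact .inr ⟨h1, fun h => h2 (.inr h)⟩
      · rintro (h | ⟨h1, h2⟩)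
        · exact .inr (.inl h)
        · by_cases hvx : v = x
          · exact .inl hvx
          · exact .inr (.inr ⟨h1, fun h => h.elim hvx h2⟩)
    · simp only [h9', ← Fin.ext_iff, Finset.mem_insert]
      by_cases h : v = x <;> simp [h]
    · rw [Finset.sum_insert hb, add_comm]
    · rw [Finset.sum_insert hb, add_comm]
  · rintro t m' hs ⟨hb, k, ⟨x, A', hxb, hA', h9', h6', h1', h4', rfl⟩, ht⟩
    simp only [Test.Holds, NExp.eval, h4', h9', ite_eq_right_iff, one_ne_zero, imp_false,
      not_not] at hb
    simp only [Test.cost, NExp.cost] at ht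
    refine ⟨A', fun v => ?_, h9', h6', h1', by omega⟩
    have hxA : x ∈ A := ((hA' x).1 hb).elim id fun h => absurd (T.anc_refl x) h.2
    rw [hA']
    constructor
    · exact fun h => h.imp_right fun h => h.1
    · rintro (h | h)
      · exact .inl h
      · by_cases hvx : T.Anc v x
        · exact .inl (hA _ _ hvx hxA)
        · exact .inr ⟨h, hvx⟩

/-- Computes the maximum in `isOptimalStrategy_leafWalk` as a running maximum that starts with the
weight of the root. A natural copy is kept in step with the real one; it is meaningful only if `f`
and `g` are the actual weights, and `hf` makes it fit into a word. -/
lemma wp_agents (hin : Input T f g m) (hB : n ≤ B) (hB1 : 1 ≤ B)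
    (hf : ∀ v, g v + ∑ v, f v ≤ B) (hdom : ∀ v, DomAt T m v) {l : List (Fin n)}
    (hl : ListsLeaves T l m) (hsort : l.Pairwise fun a b => T.key b ≤ T.key a)
    (h9 : ∀ i, m.na 9 i = 0) :
    WP B agents m fun t m' => t ≤ 100 * n + 40 ∧ HasOrder T m' ∧ T.IsOptimalNumber (m'.rv 0) ∧
      ((∀ v, (f v : ℝ) = T.vw v) → (∀ v, (g v : ℝ) = T.inWeight v) →
        (m'.nv 2 : ℝ) = m'.rv 0) := by
  have hfB : ∑ v, f v ≤ B := le_trans (Nat.le_add_left _ _) (hf T.root)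
  have hfr : f T.root ≤ B := le_trans (Finset.single_le_sum (f := f) (fun _ _ => Nat.zero_le _)
    (Finset.mem_univ T.root)) hfB
  simp only [agents, wp_seq, wp_putN, wp_setN, wp_setR, NExp.eval, NExp.cost, RExp.cost,
      RExp.eval, setN_nv, setR_rv, setR_nv, setR_na,
      putN_nv, putN_na, putN_ra, hin.nv1, hin.na1, hin.ra0, if_true,
      Nat.reduceEqDiff, if_false]
  refine ⟨hB1, hfr, hfr, ?_⟩
  have key : ∀ m₀ : Mem, Input T f g m₀ → (∀ v, DomAt T m₀ v) → ListsLeaves T l m₀ →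
      (∀ v : Fin n, m₀.na 9 v = if v = T.root then 1 else 0) → m₀.rv 0 = T.vw T.root →
      m₀.rv 1 = T.vw T.root → m₀.nv 6 = f T.root → m₀.nv 2 = f T.root →
      WP B (.for 3 7 (.seq (.setN 5 (.get 3 (.var 3))) (.seq (.setN 4 (.var 5)) (.seq settlePath
        (.ite (.ltR (.var 0) (.add (.get 1 (.get 5 (.var 5))) (.var 1)))
          (.seq (.setR 0 (.add (.get 1 (.get 5 (.var 5))) (.var 1)))
            (.setN 2 (.add (.get 2 (.get 5 (.var 5))) (.var 6)))) .skip))))) m₀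
      fun t m' => t ≤ 100 * n + 5 ∧ HasOrder T m' ∧ T.IsOptimalNumber (m'.rv 0) ∧
      ((∀ v, (f v : ℝ) = T.vw v) → (∀ v, (g v : ℝ) = T.inWeight v) →
        (m'.nv 2 : ℝ) = m'.rv 0) := by
    clear hin hdom h9 hl
    intro m₀ hin hdom hl h9 hr0 hr1 h6 h2
    have hln := hl.length_le
    refine WP.mono (wp_for (fun j m' k =>
      (∀ v : Fin n, m'.na 9 v = if v ∈ T.upTo (l.take j) then 1 else 0) ∧
      m'.nv 6 = ∑ v ∈ T.upTo (l.take j), f v ∧ m'.rv 1 = ∑ v ∈ T.upTo (l.take j), T.vw v ∧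
      T.vw T.root ≤ m'.rv 0 ∧
      (∀ i (h : i < l.length), i < j →
        T.key l[i] + ∑ v ∈ T.upTo (l.take (i + 1)), T.vw v ≤ m'.rv 0) ∧
      (m'.rv 0 = T.vw T.root ∨ ∃ (i : ℕ) (h : i < l.length),
        m'.rv 0 = T.key l[i] + ∑ v ∈ T.upTo (l.take (i + 1)), T.vw v) ∧
      ((∀ v, (f v : ℝ) = T.vw v) → (∀ v, (g v : ℝ) = T.inWeight v) → (m'.nv 2 : ℝ) = m'.rv 0) ∧
      k = 20 * (T.upTo (l.take j))ᶜ.card) 40 (k := 20 * (T.upTo [])ᶜ.card) ?_ (by decide) rfl rfl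
      (by rw [hl.nv7]; omega) ?_) ?_
    · have hup : T.upTo [] = {T.root} := by ext v; simp [T.mem_upTo]
      simp [hup, h9, h6, h2, hr0, hr1]
      exact fun h _ => h _
    · rintro j m' k hj hs hij ⟨h9', h6', hr1', hge, hall, hex, hcast, rfl⟩
      rw [hl.nv7] at hj
      have hin' := hin.of_same hs rfl
      have hdom' : ∀ v, DomAt T m' v := fun v => by
        rw [DomAt, hs.na 5 rfl]; exact hdom v
      have h3 : m'.na 3 j = l[j] := by rw [hs.na 3 rfl]; exact hl.na3 j hj
      have hlt := l[j].2
      simp only [wp_seq, wp_setN, NExp.eval, NExp.cost, hij, h3, setN_nv, if_true]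
      refine ⟨by omega, by omega, ?_⟩
      have hm' : Input T f g ((m'.setN 5 l[j]).setN 4 l[j]) :=
        ⟨hin'.nv0, hin'.nv1, hin'.na0, hin'.na1, hin'.na2, hin'.ra0, hin'.ra1⟩
      refine WP.mono (wp_settlePath hm' hB hB1 hfB (T.upTo (l.take j)) ?_ ?_ l[j] h9' (by simp)
        (by simpa using h6') (by simpa using hr1')) ?_
      · exact T.mem_upTo.2 (.inl rfl)
      · intro u v huv hv
        rw [WTree.mem_upTo] at hv ⊢
        rcases hv with rfl | ⟨b, hb, hvb⟩
        · exact .inl (T.anc_root.1 huv)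
        · exact .inr ⟨b, hb, huv.trans hvb⟩
      rintro t m₁ hs₁ ⟨A', hA', h9₁, h6₁, hr1₁, ht⟩
      -- Settling the root path of `l[j]` turns the union of the first `j` root paths into that of
      -- the first `j + 1`.
      obtain rfl : A' = T.upTo (l.take (j + 1)) := by
        ext v
        rw [hA', WTree.mem_upTo, WTree.mem_upTo, List.take_succ_eq_append_getElem hj]
        simp only [List.mem_append, List.mem_singleton]
        constructor
        · rintro ((h | ⟨b, hb, h⟩) | h)
          · exact .inl h
          · exact .inr ⟨b, .inl hb, h⟩
          · exact .inr ⟨_, .inr rfl, h⟩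
        · rintro (h | ⟨b, hb | rfl, h⟩)
          · exact .inl (.inl h)
          · exact .inl (.inr ⟨b, hb, h⟩)
          · exact .inr h
      obtain ⟨d, hd, hd'⟩ := hdom' l[j]
      have hin₁ := hm'.of_same hs₁ rfl
      have e5 : m₁.nv 5 = l[j] := by rw [hs₁.nv 5 rfl]; simp
      have e0 : m₁.rv 0 = m'.rv 0 := by rw [hs₁.rv 0 rfl]; simp
      have e2 : m₁.nv 2 = m'.nv 2 := by rw [hs₁.nv 2 rfl]; simp
      have ed : m₁.na 5 l[j] = d := by rw [hs₁.na 5 rfl]; exact hd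
      simp only [wp_ite, wp_seq, wp_setN, wp_setR, wp_skip, NExp.eval, NExp.cost, RExp.eval,
        RExp.cost, Test.Holds, Test.cost, e5, e0, ed, hin₁.ra1, hin₁.na2, hr1₁, h6₁, setR_na,
        setR_nv, setN_na, setN_nv, setN_rv, setR_rv, hd', e2, if_true, Nat.reduceEqDiff, if_false]
      have hB' : g d + ∑ v ∈ T.upTo (l.take (j + 1)), f v ≤ B :=
        (Nat.add_le_add_left (Finset.sum_le_sum_of_subset (Finset.subset_univ _)) _).trans (hf d)
      refine ⟨fun hlt => ⟨hB', 20 * (T.upTo (l.take (j + 1)))ᶜ.card, by omega, h9₁, trivial,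
        trivial, hge.trans hlt.le, fun i h hi => ?_, .inr ⟨j, hj, rfl⟩, fun hc1 hc2 => ?_, rfl⟩,
        fun hnlt => ⟨20 * (T.upTo (l.take (j + 1)))ᶜ.card, by omega, h9₁, trivial, trivial, hge, fun i h hi => ?_,
        hex, hcast, rfl⟩⟩
      · rcases (Nat.lt_succ_iff.1 hi).lt_or_eq with hi | rfl
        · exact (hall i h hi).trans hlt.le
        · exact le_rfl
      · push_cast
        rw [hc2, hd', Finset.sum_congr rfl fun v _ => hc1 v]
      · rcases (Nat.lt_succ_iff.1 hi).lt_or_eq with hi | rfl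
        · exact hall i h hi
        · exact not_lt.1 hnlt
    · rintro t m' hs ⟨k, ht, h9', h6', hr1', hge, hall, hex, hcast, rfl⟩
      rw [hl.nv7] at ht hall
      have hopt := T.isOptimalStrategy_leafWalk hl.mem hsort hge (fun i h => hall i h h) hex
      have hcn := Finset.card_le_univ (T.upTo [])ᶜ
      rw [Fintype.card_fin] at hcn
      refine ⟨by omega, ⟨l, ⟨_, _, hopt, T.isLeafOrder_leafWalk hl.mem hl.nodup⟩, fun i h => ?_⟩,
        ⟨_, hopt⟩, hcast⟩
      rw [hs.na 3 rfl]
      exact hl.na3 i h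
  refine WP.mono (key _ ⟨?_, ?_, ?_, ?_, ?_, ?_, ?_⟩ ?_ ⟨hl.mem, hl.nodup, ?_, ?_⟩ ?_ ?_ ?_ ?_ ?_)
    fun t m' _ h => ⟨by omega, h.2⟩
  · simpa using hin.nv0
  · simpa using hin.nv1
  · simpa using hin.na0
  · simpa using hin.na1
  · simpa using hin.na2
  · simpa using hin.ra0
  · simpa using hin.ra1
  · simpa [DomAt] using hdom
  · simpa using hl.nv7
  · simpa using hl.na3
  · simp [Fin.ext_iff, h9]
  all_goals simp

end

end RAM

/-! ### Sorting real keys by a tournament -/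

namespace RAM

section

variable {n : ℕ} {T : WTree (Fin n) ℝ} {f g : Fin n → ℕ} {m : Mem} {B : ℕ}

/-- Play the match at the node in natural variable `3` of the tournament in natural array `8`;
the values of the players are in real array `2`. -/
def playMatch : Prog :=
  .seq (.setN 4 (.get 8 (.mul (.const 2) (.var 3))))
    (.seq (.setN 5 (.get 8 (.add (.mul (.const 2) (.var 3)) (.const 1))))
      (.ite (.ltR (.get 2 (.var 4)) (.get 2 (.var 5)))
        (.putN 8 (.var 3) (.var 5)) (.putN 8 (.var 3) (.var 4))))

/-- Repeat the matches from the node in natural variable `3` up to the final. -/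
def replay : Prog :=
  .while (.ltN (.const 0) (.var 3))
    (.seq playMatch (.setN 3 (.div (.var 3) (.const 2))))

/-- The winner of the match at node `j` is one of the two best players. -/
def MatchOK (m : Mem) (j : ℕ) : Prop :=
  (m.na 8 j = m.na 8 (2 * j) ∨ m.na 8 j = m.na 8 (2 * j + 1)) ∧
    m.ra 2 (m.na 8 (2 * j)) ≤ m.ra 2 (m.na 8 j) ∧ m.ra 2 (m.na 8 (2 * j + 1)) ≤ m.ra 2 (m.na 8 j)

/-- The player at node `j` has started below this node. -/
def FromBelow (n : ℕ) (m : Mem) (j : ℕ) : Prop :=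
  m.na 8 j < n ∧ ∃ i, (n + m.na 8 j) / 2 ^ i = j

/-- A finished tournament. -/
structure Tournament (n : ℕ) (m : Mem) : Prop where
  start : ∀ v : Fin n, m.na 8 (n + v) = v
  matchOK : ∀ j, 1 ≤ j → j < n → MatchOK m j
  fromBelow : ∀ j, 1 ≤ j → j < 2 * n → FromBelow n m j

/-- Values do not decrease from a node `j` to `j / 2`. The numbering with starting places `n + v`
works for every `n`, not only for powers of two. -/
lemma Tournament.le_winner (h : Tournament n m) (v : Fin n) : m.ra 2 v ≤ m.ra 2 (m.na 8 1) := by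
  have : ∀ j, 1 ≤ j → j < 2 * n → m.ra 2 (m.na 8 j) ≤ m.ra 2 (m.na 8 1) := by
    intro j
    induction j using Nat.strong_induction_on with
    | _ j ih =>
      intro h1 h2
      rcases h1.eq_or_lt with rfl | h1
      · exact le_rfl
      · refine le_trans ?_ (ih (j / 2) (by omega) (by omega) (by omega))
        have h3 := h.matchOK (j / 2) (by omega) (by omega)
        rcases Nat.mod_two_eq_zero_or_one j with h4 | h4
        · have := h3.2.1; rwa [show 2 * (j / 2) = j by omega] at this
        · have := h3.2.2; rwa [show 2 * (j / 2) + 1 = j by omega] at this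
  have h1 := this (n + v) (by have := v.2; omega) (by have := v.2; omega)
  rwa [h.start] at h1

lemma wp_playMatch {j : ℕ} (h3 : m.nv 3 = j) (hB : n ≤ B) (h1 : FromBelow n m (2 * j))
    (h2 : FromBelow n m (2 * j + 1)) (hj : 1 ≤ j) :
    WP B playMatch m fun t m' => t ≤ 20 ∧ MatchOK m' j ∧ FromBelow n m' j ∧
      ∀ i, i ≠ j → m'.na 8 i = m.na 8 i := by
  obtain ⟨h1, i₁, h1'⟩ := h1
  obtain ⟨h2, i₂, h2'⟩ := h2
  have e1 : 2 * j ≠ j := by omega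
  have e2 : 2 * j + 1 ≠ j := by omega
  simp only [playMatch, wp_seq, wp_setN, wp_ite, wp_putN, NExp.eval, NExp.cost, Test.Holds, Test.cost,
    RExp.eval, RExp.cost, setN_nv, setN_na, setN_ra, h3, if_true, Nat.reduceEqDiff, if_false]
  refine ⟨by omega, by omega, fun h => ⟨by omega, by omega, ⟨.inr ?_, ?_, ?_⟩, ⟨?_, i₂ + 1, ?_⟩,
    fun i hi => ?_⟩, fun h => ⟨by omega, by omega, ⟨.inl ?_, ?_, ?_⟩, ⟨?_, i₁ + 1, ?_⟩,
    fun i hi => ?_⟩⟩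
  all_goals simp only [putN_na, putN_ra, setN_na, setN_ra, e1, e2, if_true, if_false]
  · exact h.le
  · exact le_rfl
  · exact h2
  · rw [pow_succ, ← Nat.div_div_eq_div_mul, h2']; omega
  · rw [if_neg hi]
  · exact le_rfl
  · exact not_lt.1 h
  · exact h1
  · rw [pow_succ, ← Nat.div_div_eq_div_mul, h1']; omega
  · rw [if_neg hi]

lemma MatchOK.congr {m' : Mem} {j i : ℕ} (h : MatchOK m j) (hra : m'.ra 2 = m.ra 2)
    (hna : ∀ i', i' ≠ i → m'.na 8 i' = m.na 8 i') (h1 : j ≠ i) (h2 : 2 * j ≠ i)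
    (h3 : 2 * j + 1 ≠ i) : MatchOK m' j := by
  rw [MatchOK, hra, hna _ h1, hna _ h2, hna _ h3]
  exact h

/-- Only matches on the way from `j` to the final may be wrong. Replaying `j` corrects it and leaves
`j / 2` and the nodes above it; `r` bounds the number of halvings. -/
lemma wp_replay {j r : ℕ} (hB : n ≤ B) (h3 : m.nv 3 = j) (hj : j < n) (hr : j < 2 ^ r)
    (hstart : ∀ v : Fin n, m.na 8 (n + v) = v)
    (hok : ∀ i, 1 ≤ i → i < n → (∀ k, j / 2 ^ k ≠ i) → MatchOK m i)
    (hfrom : ∀ i, 1 ≤ i → i < 2 * n → FromBelow n m i) :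
    WP B replay m fun t m' => t ≤ 27 * r + 3 ∧ Tournament n m' := by
  refine WP.mono (wp_while (fun m' k => ∃ j r : ℕ, m'.nv 3 = j ∧ j < n ∧ j < 2 ^ r ∧
    (∀ v : Fin n, m'.na 8 (n + v) = v) ∧
    (∀ i, 1 ≤ i → i < n → (∀ k, j / 2 ^ k ≠ i) → MatchOK m' i) ∧
    (∀ i, 1 ≤ i → i < 2 * n → FromBelow n m' i) ∧ k = 27 * r)
    ⟨j, r, h3, hj, hr, hstart, hok, hfrom, rfl⟩ ?_) ?_
  · clear hr h3 hj hok hfrom hstart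
    rintro m' k hs ⟨j, r, h3, hj, hr, hstart, hok, hfrom, rfl⟩ hb
    simp only [Test.Holds, NExp.eval, h3] at hb
    rw [wp_seq]
    refine WP.mono (wp_playMatch h3 hB (hfrom _ (by omega) (by omega))
      (hfrom _ (by omega) (by omega)) hb) ?_
    rintro t m₁ hs₁ ⟨ht, hok₁, hfrom₁, hna⟩
    have e3 : m₁.nv 3 = j := by rw [hs₁.nv 3 rfl, h3]
    simp only [wp_setN, NExp.eval, NExp.cost, Test.cost, e3]
    obtain ⟨r, rfl⟩ : ∃ q, r = q + 1 := by
      cases r with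
      | zero => simp at hr; omega
      | succ r => exact ⟨r, rfl⟩
    refine ⟨by omega, 27 * r, by omega, j / 2, r, by simp, by omega, ?_, fun v => ?_,
      fun i h1 h2 h => ?_, fun i h1 h2 => ?_, rfl⟩
    · rw [pow_succ] at hr; omega
    · rw [setN_na, hna _ (by omega)]
      exact hstart v
    · by_cases hij : i = j
      · rw [hij]; exact hok₁
      · have hi2 : j / 2 ≠ i := by simpa using h 0
        refine (hok i h1 h2 fun k => ?_).congr (i := j) (hs₁.ra 2 rfl) hna hij (by omega) (by omega)
        cases k with
        | zero => simpa using Ne.symm hij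
        | succ k =>
          have := h k
          rwa [Nat.div_div_eq_div_mul, ← pow_succ'] at this
    · by_cases hij : i = j
      · rw [hij]; exact hfrom₁
      · have := hfrom i h1 h2
        rw [FromBelow] at this ⊢
        rwa [setN_na, hna i hij]
  · rintro t m' hs ⟨hb, k, ⟨j, r, h3, hj, hr, hstart, hok, hfrom, rfl⟩, ht⟩
    simp only [Test.Holds, NExp.eval, h3] at hb
    simp only [Test.cost, NExp.cost] at ht
    obtain rfl : j = 0 := by omega
    exact ⟨by omega, hstart, fun j h1 h2 => hok j h1 h2 fun k => by simp; omega, hfrom⟩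

/-- The leaves start the tournament with their keys, the other vertices with value `-1`. -/
def seed : Prog :=
  .for 3 0 (.seq (.putN 8 (.add (.var 0) (.var 3)) (.var 3))
    (.ite (.eqN (.get 4 (.var 3)) (.const 0))
      (.ite (.eqN (.var 3) (.var 1)) (.putR 2 (.var 3) (.sub (.ofNat (.const 0)) (.ofNat (.const 1))))
        (.putR 2 (.var 3) (.get 1 (.get 5 (.var 3)))))
      (.putR 2 (.var 3) (.sub (.ofNat (.const 0)) (.ofNat (.const 1))))))

/-- Play all matches. -/
def playAll : Prog :=
  .seq (.setN 3 (.var 0)) (.while (.ltN (.const 1) (.var 3))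
    (.seq (.setN 3 (.sub (.var 3) (.const 1))) playMatch))

/-- Remove the winner of the tournament again and again. -/
def extractAll : Prog :=
  .seq (.setN 7 (.const 0))
    (.while (.ltR (.sub (.ofNat (.const 0)) (.ofNat (.const 1))) (.get 2 (.get 8 (.const 1))))
      (.seq (.setN 8 (.get 8 (.const 1))) (.seq (.putN 3 (.var 7) (.var 8))
        (.seq (.setN 7 (.add (.var 7) (.const 1)))
          (.seq (.putR 2 (.var 8) (.sub (.ofNat (.const 0)) (.ofNat (.const 1))))
            (.seq (.setN 3 (.div (.add (.var 0) (.var 8)) (.const 2))) replay))))))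

/-- Sort the leaves by decreasing keys. -/
def tournamentSort : Prog := .seq seed (.seq playAll extractAll)

open Classical in
lemma wp_seed (hin : Input T f g m) (hB : n ≤ B) (h4 : ParentsMarked T m)
    (hdom : ∀ v, DomAt T m v) : WP B seed m fun t m' => t ≤ 40 * n + 5 ∧
      ∀ v : Fin n, m'.na 8 (n + v) = v ∧ m'.ra 2 v = if T.IsLeaf v then T.key v else -1 := by
  refine WP.mono (wp_for (fun j m' k => ∀ v : Fin n, (v : ℕ) < j →
    m'.na 8 (n + v) = v ∧ m'.ra 2 v = if T.IsLeaf v then T.key v else -1) 30 (k := 0)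
    (by simp) (by decide) rfl rfl (by rw [hin.nv0]; exact hB) ?_) ?_
  · rintro j m' k hj hs hij hI
    rw [hin.nv0] at hj
    have hin' := hin.of_same hs rfl
    obtain ⟨d, hd, hd'⟩ := hdom ⟨j, hj⟩
    have h5 : m'.na 5 j = d := by rw [hs.na 5 rfl]; exact hd
    have hleaf := h4.isLeaf_iff ⟨j, hj⟩
    have h4' : m'.na 4 j = m.na 4 j := by rw [hs.na 4 rfl]
    have hroot : (j = (T.root : ℕ)) ↔ (⟨j, hj⟩ : Fin n) = T.root := by rw [Fin.ext_iff]
    have fin : ∀ (r : ℝ), (r = if T.IsLeaf ⟨j, hj⟩ then T.key ⟨j, hj⟩ else -1) →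
        ∀ v : Fin n, (v : ℕ) < j + 1 →
        (if n + (v : ℕ) = n + j then j else m'.na 8 (n + v)) = v ∧
        (if (v : ℕ) = j then r else m'.ra 2 v) = if T.IsLeaf v then T.key v else -1 := by
      intro r hr v hv
      by_cases hvj : (v : ℕ) = j
      · obtain rfl : v = ⟨j, hj⟩ := Fin.ext hvj
        simp [hr]
      · rw [if_neg (by omega), if_neg hvj]
        exact hI v (by omega)
    simp only [wp_seq, wp_putN, wp_ite, wp_putR, NExp.eval, NExp.cost, RExp.eval, RExp.cost,
      Test.Holds, Test.cost, putN_nv, putN_na, putN_ra, hij, hin'.nv0, hin'.nv1, h4', h5,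
      hin'.ra1, Nat.reduceEqDiff, if_false]
    refine ⟨by omega, fun h1 => ⟨fun h2 => ⟨0, by omega, ?_⟩, fun h2 => ⟨0, by omega, ?_⟩⟩,
      fun h1 => ⟨0, by omega, ?_⟩⟩
    · simpa using fin _ (by rw [if_neg fun h => (hleaf.1 h).1 (hroot.1 h2)])
    · simpa using fin _ (by rw [if_pos (hleaf.2 ⟨fun h => h2 (hroot.2 h), h1⟩), hd'])
    · simpa using fin _ (by rw [if_neg fun h => h1 (hleaf.1 h).2])
  · rintro t m' hs ⟨k, ht, hI⟩
    rw [hin.nv0] at ht hI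
    exact ⟨by omega, fun v => hI v v.2⟩

/-- Nodes are treated from `n - 1` down, so that both entrants of a match are known when it is
played. -/
lemma wp_playAll (h0 : m.nv 0 = n) (hB : n ≤ B) (hstart : ∀ v : Fin n, m.na 8 (n + v) = v) :
    WP B playAll m fun t m' => t ≤ 27 * n + 5 ∧ Tournament n m' := by
  simp only [playAll, wp_seq, wp_setN, NExp.eval, NExp.cost, h0]
  refine ⟨hB, ?_⟩
  refine WP.mono (wp_while (fun m' k => ∃ j : ℕ, m'.nv 3 = j ∧ j ≤ n ∧
    (∀ v : Fin n, m'.na 8 (n + v) = v) ∧ (∀ i, 1 ≤ i → j ≤ i → i < n → MatchOK m' i) ∧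
    (∀ i, 1 ≤ i → j ≤ i → i < 2 * n → FromBelow n m' i) ∧ k = 27 * j)
    ⟨n, by simp, le_rfl, hstart, fun i _ h h' => by omega, fun i h1 h h' => ?_, rfl⟩ ?_) ?_
  · have := hstart ⟨i - n, by omega⟩
    simp only [Nat.add_sub_cancel' h] at this
    rw [FromBelow, setN_na, this]
    exact ⟨by omega, 0, by simp; omega⟩
  · rintro m' k hs ⟨j, h3, hj, hstart, hok, hfrom, rfl⟩ hb
    simp only [Test.Holds, NExp.eval, h3] at hb
    simp only [wp_seq, wp_setN, NExp.eval, NExp.cost, h3]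
    obtain ⟨j, rfl⟩ : ∃ i, j = i + 1 := ⟨j - 1, by omega⟩
    simp only [Nat.add_sub_cancel]
    refine ⟨by omega, ?_⟩
    refine WP.mono (wp_playMatch (n := n) (j := j) (by simp) hB (hfrom _ (by omega) (by omega) (by omega))
      (hfrom _ (by omega) (by omega) (by omega)) (by omega)) ?_
    rintro t m₁ hs₁ ⟨ht, hok₁, hfrom₁, hna⟩
    simp only [Test.cost, NExp.cost]
    refine ⟨27 * j, by omega, j, ?_, by omega, fun v => ?_, fun i h1 h2 h3 => ?_,
      fun i h1 h2 h3 => ?_, rfl⟩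
    · rw [hs₁.nv 3 rfl]; simp
    · rw [hna _ (by omega)]
      exact hstart v
    · by_cases hij : i = j
      · rw [hij]; exact hok₁
      · exact (hok i h1 (by omega) h3).congr (i := j) (hs₁.ra 2 rfl) hna hij (by omega) (by omega)
    · by_cases hij : i = j
      · rw [hij]; exact hfrom₁
      · have := hfrom i h1 (by omega) h3
        rw [FromBelow] at this ⊢
        rwa [hna i hij]
  · rintro t m' hs ⟨hb, k, ⟨j, h3, hj, hstart, hok, hfrom, rfl⟩, ht⟩
    simp only [Test.Holds, NExp.eval, h3] at hb
    simp only [Test.cost, NExp.cost] at ht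
    exact ⟨by omega, hstart, fun i h1 h2 => hok i h1 (by omega) h2,
      fun i h1 h2 => hfrom i h1 (by omega) h2⟩

-- The value `-1` is below all keys. It marks vertices that are not leaves or already extracted, and
-- the loop ends when it wins. The potential counts the vertices not yet listed.
open Classical in
lemma wp_extractAll (h0 : m.nv 0 = n) (hn : 1 ≤ n) (hB : n ≤ B) (ht : Tournament n m) {r : ℕ}
    (hr : n < 2 ^ r)
    (hra : ∀ v : Fin n, m.ra 2 v = if T.IsLeaf v then T.key v else -1) :
    WP B extractAll m fun t m' => t ≤ n * (27 * r + 35) + 20 ∧ ∃ l, ListsLeaves T l m' ∧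
      l.Pairwise fun a b => T.key b ≤ T.key a := by
  simp only [extractAll, wp_seq, wp_setN, NExp.eval, NExp.cost]
  refine ⟨Nat.zero_le _, ?_⟩
  refine WP.mono (wp_while (fun m' k => ∃ l : List (Fin n), Tournament n m' ∧ l.Nodup ∧
    (∀ b ∈ l, T.IsLeaf b) ∧ (l.Pairwise fun a b => T.key b ≤ T.key a) ∧ m'.nv 7 = l.length ∧
    (∀ i (h : i < l.length), m'.na 3 i = l[i]) ∧
    (∀ v : Fin n, m'.ra 2 v = if T.IsLeaf v ∧ v ∉ l then T.key v else -1) ∧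
    (∀ b ∈ l, ∀ v, T.IsLeaf v → v ∉ l → T.key v ≤ T.key b) ∧
    k = (n - l.length) * (27 * r + 35)) (k := n * (27 * r + 35))
    ⟨[], ⟨ht.start, ht.matchOK, ht.fromBelow⟩, by simp, by simp, by simp, by simp, by simp,
      by simpa using hra, by simp, by simp⟩ ?_) ?_
  · rintro m' k hs ⟨l, ht', hnd, hleaf, hsort, h7, h3, hra', hle, rfl⟩ hb
    have h0' : m'.nv 0 = n := by rw [hs.nv 0 rfl]; exact h0
    obtain ⟨hxn, -⟩ := ht'.fromBelow 1 le_rfl (by omega)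
    obtain ⟨x, hx⟩ : ∃ x : Fin n, m'.na 8 1 = x := ⟨⟨_, hxn⟩, rfl⟩
    simp only [Test.Holds, NExp.eval, RExp.eval, hx] at hb
    norm_num at hb
    have hxl : T.IsLeaf x ∧ x ∉ l := by
      by_contra h
      rw [hra' x, if_neg h] at hb
      exact lt_irrefl _ hb
    have hmax : ∀ v, T.IsLeaf v → v ∉ l → T.key v ≤ T.key x := fun v h1 h2 => by
      have := ht'.le_winner v
      rwa [hx, hra' v, hra' x, if_pos ⟨h1, h2⟩, if_pos hxl] at this
    have hnd' : (x :: l).Nodup := List.nodup_cons.2 ⟨hxl.2, hnd⟩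
    have hlen : l.length + 1 ≤ n := by
      have := List.toFinset_card_of_nodup hnd'
      have h2 := Finset.card_le_univ (x :: l).toFinset
      rw [this, Fintype.card_fin] at h2
      exact h2
    have hxlt := x.2
    simp only [wp_seq, wp_setN, wp_putN, wp_putR, NExp.eval, NExp.cost, RExp.eval, RExp.cost,
      setN_nv, putN_nv, putR_nv, hx, h7, h0', if_true, Nat.reduceEqDiff, if_false]
    refine ⟨by omega, by omega, by omega, by omega, ?_⟩
    have hcur : (n + (x : ℕ)) / 2 < n := by omega
    refine WP.mono (wp_replay (n := n) (j := (n + (x : ℕ)) / 2) (r := r) hB (by simp) hcur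
      (by omega) (fun v => ?_) (fun i h1 h2 h => ?_) (fun i h1 h2 => ?_)) ?_
    · simpa using ht'.start v
    · have hno : ∀ k, (n + (x : ℕ)) / 2 ^ k ≠ i := fun k => by
        cases k with
        | zero => simp; omega
        | succ k =>
          have := h k
          rwa [Nat.div_div_eq_div_mul, ← pow_succ'] at this
      -- By `FromBelow`, nodes that hold `x` lie above its starting place. A match off this way
      -- involves `x` neither as winner nor as entrant, so lowering the value of `x` leaves it
      -- correct.
      have hne : ∀ i', 1 ≤ i' → i' < 2 * n → (i' = i ∨ i' / 2 = i) → m'.na 8 i' ≠ x := by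
        intro i' h1' h2' h3' h4'
        obtain ⟨-, e, he⟩ := ht'.fromBelow i' h1' h2'
        rw [h4'] at he
        rcases h3' with rfl | rfl
        · exact hno e he
        · exact hno (e + 1) (by rw [pow_succ, ← Nat.div_div_eq_div_mul, he])
      have h4 := hne i h1 (by omega) (.inl rfl)
      have h5 := hne (2 * i) (by omega) (by omega) (.inr (by omega))
      have h6 := hne (2 * i + 1) (by omega) (by omega) (.inr (by omega))
      have := ht'.matchOK i h1 h2
      simpa [MatchOK, h4, h5, h6] using this
    · simpa [FromBelow] using ht'.fromBelow i h1 h2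
    rintro t m₁ hs₁ ⟨ht₁, htour⟩
    simp only [Test.cost, NExp.cost, RExp.cost]
    refine ⟨(n - (l.length + 1)) * (27 * r + 35), ?_, l ++ [x], htour, ?_, ?_, ?_, ?_, ?_, ?_,
      ?_, by simp⟩
    · obtain ⟨q, hq⟩ := Nat.exists_eq_add_of_le hlen
      rw [show n - l.length = q + 1 by omega, show n - (l.length + 1) = q by omega, Nat.add_mul]
      omega
    · simpa [List.nodup_append] using ⟨hnd, fun a ha h => hxl.2 (h ▸ ha)⟩
    · intro b hb'
      rcases List.mem_append.1 hb' with h | h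
      · exact hleaf b h
      · rw [List.mem_singleton.1 h]; exact hxl.1
    · rw [List.pairwise_append]
      refine ⟨hsort, List.pairwise_singleton _ _, fun a ha b hb' => ?_⟩
      rw [List.mem_singleton.1 hb']
      exact hle a ha x hxl.1 hxl.2
    · rw [hs₁.nv 7 rfl]; simp
    · intro i hi
      rw [hs₁.na 3 rfl]
      simp only [setN_na, putR_na, putN_na, if_true]
      rw [List.length_append, List.length_singleton] at hi
      by_cases hil : i = l.length
      · simp [hil]
      · rw [if_neg hil, List.getElem_append_left (by omega)]
        exact h3 i (by omega)
    · intro v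
      rw [hs₁.ra 2 rfl]
      simp only [setN_ra, putR_ra, putN_ra, if_true, ← Fin.ext_iff]
      by_cases hvx : v = x
      · simp [hvx]
      · simp [hvx, hra' v]
    · intro b hb' v h1 h2
      rw [List.mem_append, not_or] at h2
      rcases List.mem_append.1 hb' with h | h
      · exact hle b h v h1 h2.1
      · rw [List.mem_singleton.1 h]; exact hmax v h1 h2.1
  · rintro t m' hs ⟨hb, k, ⟨l, ht', hnd, hleaf, hsort, h7, h3, hra', hle, rfl⟩, htk⟩
    simp only [Test.Holds, NExp.eval, RExp.eval] at hb
    norm_num at hb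
    simp only [Test.cost, NExp.cost, RExp.cost] at htk
    refine ⟨by omega, l, ⟨fun b => ⟨hleaf b, fun h => ?_⟩, hnd, h7, h3⟩, hsort⟩
    by_contra hbl
    have h1 := (ht'.le_winner b).trans hb
    rw [hra' b, if_pos ⟨h, hbl⟩] at h1
    have := T.key_nonneg b
    linarith

lemma wp_tournamentSort (hin : Input T f g m) (hB : n ≤ B) (h4 : ParentsMarked T m)
    (hdom : ∀ v, DomAt T m v) {r : ℕ} (hr : n < 2 ^ r) :
    WP B tournamentSort m fun t m' => t ≤ n * (27 * r + 110) + 40 ∧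
      ∃ l, ListsLeaves T l m' ∧ l.Pairwise fun a b => T.key b ≤ T.key a := by
  rw [tournamentSort, wp_seq]
  refine WP.mono (wp_seed hin hB h4 hdom) fun t₁ m₁ hs₁ ⟨ht₁, h₁⟩ => ?_
  have hin₁ := hin.of_same hs₁ rfl
  rw [wp_seq]
  refine WP.mono (wp_playAll hin₁.nv0 hB fun v => (h₁ v).1) fun t₂ m₂ hs₂ ⟨ht₂, h₂⟩ => ?_
  have hin₂ := hin₁.of_same hs₂ rfl
  refine WP.mono (wp_extractAll (T := T) hin₂.nv0 (by have := T.root.2; omega) hB h₂ hr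
    fun v => by rw [hs₂.ra 2 rfl, (h₁ v).2]) fun t₃ m₃ hs₃ ⟨ht₃, h₃⟩ => ⟨?_, h₃⟩
  rw [Nat.mul_add] at ht₃ ⊢
  omega

end

end RAM

/-! ### Stable distribution into buckets -/

section Buckets

variable (dig : ℕ → ℕ)

/-- The number of indices below `j` with digit `d`. -/
def countEq (j d : ℕ) : ℕ := ((Finset.range j).filter fun i => dig i = d).card

/-- The number of indices below `c` with a digit of at least `d`. -/
def countGe (c d : ℕ) : ℕ := ((Finset.range c).filter fun i => d ≤ dig i).card

/-- The position of index `j` after stable sorting by decreasing digits. -/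
def bucketRank (c j : ℕ) : ℕ := countGe dig c (dig j + 1) + countEq dig j (dig j)

lemma countEq_succ (j d : ℕ) :
    countEq dig (j + 1) d = countEq dig j d + if dig j = d then 1 else 0 := by
  rw [countEq, Finset.range_add_one, Finset.filter_insert]
  split_ifs with h
  · rw [Finset.card_insert_of_notMem (by simp)]; rfl
  · rfl

lemma countEq_mono {i j : ℕ} (h : i ≤ j) (d : ℕ) : countEq dig i d ≤ countEq dig j d :=
  Finset.card_le_card (Finset.filter_subset_filter _ (Finset.range_mono h))

lemma countEq_lt {i j : ℕ} (h : i < j) : countEq dig i (dig i) < countEq dig j (dig i) := by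
  have h1 := countEq_succ dig i (dig i)
  have h2 := countEq_mono dig (show i + 1 ≤ j from h) (dig i)
  rw [if_pos rfl] at h1
  omega

lemma countGe_anti (c : ℕ) {d e : ℕ} (h : d ≤ e) : countGe dig c e ≤ countGe dig c d :=
  Finset.card_le_card fun i hi => by
    simp only [Finset.mem_filter] at hi ⊢
    exact ⟨hi.1, h.trans hi.2⟩

lemma countGe_succ_add (c d : ℕ) :
    countGe dig c (d + 1) + countEq dig c d = countGe dig c d := by
  rw [countGe, countEq, ← Finset.card_union_of_disjoint, ← Finset.filter_or]
  · rw [countGe]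
    congr 1
    ext i
    simp only [Finset.mem_filter]
    refine and_congr_right fun _ => ?_
    omega
  · rw [Finset.disjoint_filter]
    intros
    omega

lemma countGe_le (c d : ℕ) : countGe dig c d ≤ c :=
  (Finset.card_filter_le _ _).trans (by rw [Finset.card_range])

variable {dig}

/-- The bucket of digit `d` occupies the positions from `countGe c (d + 1)` up to, but excluding,
`countGe c d`. Buckets of larger digits come first, and inside a bucket the old order is kept. -/
lemma bucketRank_lt_bucketRank {c i j : ℕ} (hi : i < c)
    (h : dig j < dig i ∨ dig i = dig j ∧ i < j) : bucketRank dig c i < bucketRank dig c j := by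
  rcases h with h | ⟨h, hij⟩
  · have h1 := countEq_lt dig hi
    have h2 := countGe_succ_add dig c (dig i)
    have h3 := countGe_anti dig c (show dig j + 1 ≤ dig i from h)
    simp only [bucketRank]
    omega
  · have h1 := countEq_lt dig hij
    rw [bucketRank, bucketRank, ← h]
    omega

lemma bucketRank_lt {c i : ℕ} (hi : i < c) : bucketRank dig c i < c := by
  have h1 := countEq_lt dig hi
  have h2 := countGe_succ_add dig c (dig i)
  have h3 := countGe_le dig c (dig i)
  rw [bucketRank]
  omega

lemma bucketRank_injOn {c i j : ℕ} (hi : i < c) (hj : j < c)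
    (h : bucketRank dig c i = bucketRank dig c j) : i = j := by
  by_contra hne
  have h1 : (dig j < dig i ∨ dig i = dig j ∧ i < j) ∨ dig i < dig j ∨ dig j = dig i ∧ j < i := by
    omega
  rcases h1 with h1 | h1
  · exact (bucketRank_lt_bucketRank hi h1).ne h
  · exact (bucketRank_lt_bucketRank hj h1).ne h.symm

/-- A list in the order of the bucket ranks. -/
lemma exists_bucketSorted {α : Type*} (l : List α) (dig : ℕ → ℕ) : ∃ l' : List α,
    l'.Perm l ∧ (∀ i (hi : i < l.length) (hi' : bucketRank dig l.length i < l'.length),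
      l'[bucketRank dig l.length i] = l[i]) ∧
    ∀ p q (hp : p < l'.length) (hq : q < l'.length), p < q → ∃ i j, ∃ (hi : i < l.length) (hj : j < l.length),
      l'[p] = l[i] ∧ l'[q] = l[j] ∧ (dig j < dig i ∨ dig i = dig j ∧ i < j) := by
  let ρ : Fin l.length → Fin l.length := fun i => ⟨bucketRank dig l.length i, bucketRank_lt i.2⟩
  have hρ : Function.Injective ρ := fun i j h =>
    Fin.ext (bucketRank_injOn i.2 j.2 (congrArg Fin.val h))
  let e := Equiv.ofBijective ρ (Finite.injective_iff_bijective.1 hρ)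
  refine ⟨List.ofFn fun p => l[e.symm p], ?_, fun i hi hi' => ?_, fun p q hp hq hpq => ?_⟩
  · have := Equiv.Perm.ofFn_comp_perm e.symm fun i : Fin l.length => l[i]
    refine this.trans ?_
    rw [show (List.ofFn fun i : Fin l.length => l[i]) = l from List.ofFn_getElem]
  · have h1 : e.symm ⟨bucketRank dig l.length i, bucketRank_lt hi⟩ = ⟨i, hi⟩ := by
      rw [Equiv.symm_apply_eq]; rfl
    simp only [List.getElem_ofFn, h1, Fin.getElem_fin]
  · rw [List.length_ofFn] at hp hq
    refine ⟨e.symm ⟨p, hp⟩, e.symm ⟨q, hq⟩, Fin.is_lt _, Fin.is_lt _, by simp, by simp, ?_⟩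
    set i := e.symm ⟨p, hp⟩ with hi
    set j := e.symm ⟨q, hq⟩ with hj
    have h1 : bucketRank dig l.length i = p := by
      have : e i = ⟨p, hp⟩ := by rw [hi, Equiv.apply_symm_apply]
      exact congrArg Fin.val this
    have h2 : bucketRank dig l.length j = q := by
      have : e j = ⟨q, hq⟩ := by rw [hj, Equiv.apply_symm_apply]
      exact congrArg Fin.val this
    by_contra h
    have hne : (i : ℕ) ≠ j := fun h => by rw [h] at h1; omega
    have h3 := bucketRank_lt_bucketRank (dig := dig) (c := l.length) (i := j) (j := i) j.2 (by omega)
    omega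

end Buckets

namespace RAM

section

variable {m : Mem} {B c β D : ℕ} {dig : ℕ → ℕ}

/-- The current digit of the key of entry number `i` in array `3`, for `i` in natural
variable `3`. -/
def digit : NExp :=
  .mod (.div (.get 2 (.get 5 (.get 3 (.var 3)))) (.var 10)) (.var 8)

def clearBuckets : Prog := .for 3 8 (.putN 10 (.var 3) (.const 0))

def countBuckets : Prog :=
  .for 3 7 (.seq (.setN 4 digit) (.putN 10 (.var 4) (.add (.get 10 (.var 4)) (.const 1))))

/-- Compute the first positions of the buckets from their sizes. -/
def locateBuckets : Prog :=
  .seq (.setN 3 (.var 8)) (.seq (.setN 5 (.const 0)) (.while (.ltN (.const 0) (.var 3))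
    (.seq (.setN 3 (.sub (.var 3) (.const 1))) (.seq (.setN 4 (.get 10 (.var 3)))
      (.seq (.putN 10 (.var 3) (.var 5)) (.setN 5 (.add (.var 5) (.var 4))))))))

def fillBuckets : Prog :=
  .for 3 7 (.seq (.setN 4 digit) (.seq (.putN 11 (.get 10 (.var 4)) (.get 3 (.var 3)))
    (.putN 10 (.var 4) (.add (.get 10 (.var 4)) (.const 1)))))

def copyBack : Prog := .for 3 7 (.putN 3 (.var 3) (.get 11 (.var 3)))

/-- Sort array `3` stably by decreasing digits. -/
def bucketPass : Prog :=
  .seq clearBuckets (.seq countBuckets (.seq locateBuckets (.seq fillBuckets copyBack)))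

/-- The memory before a stable distribution of `c` entries with digits `dig` below `β`. -/
structure HasDigits (c β B : ℕ) (dig : ℕ → ℕ) (m : Mem) : Prop where
  nv7 : m.nv 7 = c
  nv8 : m.nv 8 = β
  digit_eq : ∀ i < c, m.na 2 (m.na 5 (m.na 3 i)) / m.nv 10 % m.nv 8 = dig i
  digit_lt : ∀ i < c, dig i < β
  na3_le : ∀ i < c, m.na 3 i ≤ B
  c_le : c ≤ B
  β_le : β ≤ B

/-- The program does not change entries and digits. -/
def Prog.keepsDigits (p : Prog) : Bool :=
  !p.setsN 7 && !p.setsN 8 && !p.setsN 10 && !p.putsN 2 && !p.putsN 3 && !p.putsN 5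

lemma HasDigits.of_same {p : Prog} {m' : Mem} (h : HasDigits c β B dig m) (hs : Same p m m')
    (hp : p.keepsDigits = true) : HasDigits c β B dig m' := by
  simp only [Prog.keepsDigits, Bool.and_eq_true, Bool.not_eq_true'] at hp
  obtain ⟨⟨⟨⟨⟨h1, h2⟩, h3⟩, h4⟩, h5⟩, h6⟩ := hp
  refine ⟨(hs.nv _ h1).trans h.nv7, (hs.nv _ h2).trans h.nv8, ?_, h.digit_lt, ?_, h.c_le, h.β_le⟩
  · rw [hs.na _ h4, hs.na _ h5, hs.na _ h6, hs.nv _ h2, hs.nv _ h3]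
    exact h.digit_eq
  · rw [hs.na _ h5]; exact h.na3_le

lemma wp_clearBuckets (h : HasDigits c β B dig m) : WP B clearBuckets m fun t m' =>
    t ≤ 10 * β + 5 ∧ ∀ d < β, m'.na 10 d = 0 := by
  refine WP.mono (wp_for (fun j m' k => ∀ d < j, m'.na 10 d = 0) 3 (k := 0) (by simp) (by decide)
    rfl rfl (by rw [h.nv8]; exact h.β_le) ?_) ?_
  · rintro j m' k hj hs hij hI
    simp only [wp_putN, NExp.eval, NExp.cost, hij]
    refine ⟨Nat.zero_le _, 0, by omega, fun d hd => ?_⟩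
    simp only [setN_na, putN_na, if_true]
    split_ifs with h1
    · rfl
    · exact hI d (by omega)
  · rintro t m' hs ⟨k, ht, hI⟩
    rw [h.nv8] at ht hI
    exact ⟨by omega, hI⟩

lemma wp_countBuckets (h : HasDigits c β B dig m) (h0 : ∀ d < β, m.na 10 d = 0) :
    WP B countBuckets m fun t m' => t ≤ 22 * c + 5 ∧ ∀ d < β, m'.na 10 d = countEq dig c d := by
  refine WP.mono (wp_for (fun j m' k => ∀ d < β, m'.na 10 d = countEq dig j d) 15 (k := 0) ?_
    (by decide) rfl rfl (by rw [h.nv7]; exact h.c_le) ?_) ?_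
  · simpa [countEq] using h0
  · rintro j m' k hj hs hij hI
    rw [h.nv7] at hj
    have h' := h.of_same hs rfl
    have hd := h'.digit_eq j hj
    have hlt := h'.digit_lt j hj
    have hc := countEq_lt dig hj
    have hc' := countEq_succ dig j (dig j)
    have h1 := countGe_succ_add dig c (dig j)
    have h2 := countGe_le dig c (dig j)
    have h3 := h.c_le
    have h4 := h.β_le
    rw [if_pos rfl] at hc'
    simp only [wp_seq, wp_setN, wp_putN, digit, NExp.eval, NExp.cost, hij, hd, setN_nv, setN_na,
      if_true, hI _ hlt]
    refine ⟨by omega, by omega, 0, by omega, fun d hdβ => ?_⟩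
    simp only [putN_na, setN_na, if_true, countEq_succ]
    by_cases hdd : dig j = d
    · subst hdd; simp
    · rw [if_neg (Ne.symm hdd), if_neg hdd, hI d hdβ, add_zero]
  · rintro t m' hs ⟨k, ht, hI⟩
    rw [h.nv7] at ht hI
    exact ⟨by omega, hI⟩

/-- Going down from the largest digit, variable `5` accumulates the sizes of the buckets passed,
which is the first position of the next bucket. -/
lemma wp_locateBuckets (h : HasDigits c β B dig m) (h0 : ∀ d < β, m.na 10 d = countEq dig c d) :
    WP B locateBuckets m fun t m' => t ≤ 17 * β + 7 ∧
      ∀ d < β, m'.na 10 d = countGe dig c (d + 1) := by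
  have hβ := h.β_le
  have hc := h.c_le
  simp only [locateBuckets, wp_seq, wp_setN, NExp.eval, NExp.cost, h.nv8]
  refine ⟨h.β_le, Nat.zero_le _, ?_⟩
  refine WP.mono (wp_while (fun m' k => ∃ e ≤ β, m'.nv 3 = e ∧ m'.nv 5 = countGe dig c e ∧
    (∀ d < e, m'.na 10 d = countEq dig c d) ∧
    (∀ d < β, e ≤ d → m'.na 10 d = countGe dig c (d + 1)) ∧ k = 17 * e)
    ⟨β, le_rfl, by simp, ?_, h0, fun d h1 h2 => by omega, rfl⟩ ?_) ?_
  · rw [setN_nv, if_pos rfl, countGe, eq_comm, Finset.card_eq_zero, Finset.filter_eq_empty_iff]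
    intro i hi
    have := h.digit_lt i (by simpa using hi)
    omega
  · rintro m' k hs ⟨e, he, h3, h5, hlow, hhigh, rfl⟩ hb
    simp only [Test.Holds, NExp.eval, h3] at hb
    obtain ⟨e, rfl⟩ : ∃ i, e = i + 1 := ⟨e - 1, by omega⟩
    have h1 := countGe_succ_add dig c e
    have h2 := countGe_le dig c e
    simp only [wp_seq, wp_setN, wp_putN, NExp.eval, NExp.cost, Test.cost, h3, h5, setN_nv, setN_na,
      putN_nv, if_true, Nat.reduceEqDiff, if_false, Nat.add_sub_cancel, hlow e (Nat.lt_succ_self e), h1]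
    refine ⟨by omega, by omega, by omega, by omega, 17 * e, by omega, e, by omega, rfl, rfl,
      fun d hd => ?_, fun d hd hd' => ?_, rfl⟩
    · simp only [putN_na, setN_na, if_true]
      rw [if_neg (by omega)]
      exact hlow d (by omega)
    · simp only [putN_na, setN_na, if_true]
      split_ifs with hde
      · rw [hde]
      · exact hhigh d hd (by omega)
  · rintro t m' hs ⟨hb, k, ⟨e, he, h3, h5, hlow, hhigh, rfl⟩, ht⟩
    simp only [Test.Holds, NExp.eval, h3] at hb
    simp only [Test.cost, NExp.cost] at ht
    exact ⟨by omega, fun d hd => hhigh d hd (by omega)⟩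

/-- Array `10` holds the next free position of each bucket. For the digit of entry `j` this is
`bucketRank dig c j` when its turn comes. -/
lemma wp_fillBuckets (h : HasDigits c β B dig m)
    (h0 : ∀ d < β, m.na 10 d = countGe dig c (d + 1)) :
    WP B fillBuckets m fun t m' => t ≤ 27 * c + 5 ∧
      ∀ i < c, m'.na 11 (bucketRank dig c i) = m.na 3 i := by
  refine WP.mono (wp_for (fun j m' k =>
    (∀ d < β, m'.na 10 d = countGe dig c (d + 1) + countEq dig j d) ∧
    ∀ i < j, m'.na 11 (bucketRank dig c i) = m.na 3 i) 20 (k := 0) ?_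
    (by decide) rfl rfl (by rw [h.nv7]; exact h.c_le) ?_) ?_
  · simpa [countEq] using h0
  · rintro j m' k hj hs hij ⟨hI, hI'⟩
    rw [h.nv7] at hj
    have h' := h.of_same hs rfl
    have hd := h'.digit_eq j hj
    have hlt := h'.digit_lt j hj
    have h3 := h.c_le
    have h4 := h.β_le
    have h5 := bucketRank_lt (dig := dig) hj
    have e3 : m'.na 3 j = m.na 3 j := by rw [hs.na 3 rfl]
    simp only [wp_seq, wp_setN, wp_putN, digit, NExp.eval, NExp.cost, hij, hd, setN_nv, setN_na,
      putN_nv, putN_na, if_true, hI _ hlt, Nat.reduceEqDiff, if_false]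
    rw [← bucketRank]
    refine ⟨by omega, h'.na3_le j hj, by omega, 0, by omega, fun d hdβ => ?_, fun i hi => ?_⟩
    · rw [countEq_succ]
      by_cases hdd : dig j = d
      · subst hdd; simp [bucketRank, add_assoc]
      · rw [if_neg (Ne.symm hdd), if_neg hdd, hI d hdβ, add_zero]
    · rcases (Nat.lt_succ_iff.1 hi).lt_or_eq with hi | rfl
      · rw [if_neg fun h => hi.ne (bucketRank_injOn (hi.trans hj) hj h)]
        exact hI' i hi
      · rw [if_pos rfl, e3]
  · rintro t m' hs ⟨k, ht, hI, hI'⟩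
    rw [h.nv7] at ht hI'
    exact ⟨by omega, hI'⟩

lemma wp_copyBack (h : HasDigits c β B dig m) (h11 : ∀ i < c, m.na 11 i ≤ B) :
    WP B copyBack m fun t m' => t ≤ 11 * c + 5 ∧ ∀ i < c, m'.na 3 i = m.na 11 i := by
  refine WP.mono (wp_for (fun j m' k => ∀ i < j, m'.na 3 i = m.na 11 i) 4 (k := 0) (by simp)
    (by decide) rfl rfl (by rw [h.nv7]; exact h.c_le) ?_) ?_
  · rintro j m' k hj hs hij hI
    rw [h.nv7] at hj
    have e : m'.na 11 = m.na 11 := hs.na 11 rfl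
    simp only [wp_putN, NExp.eval, NExp.cost, hij, e]
    refine ⟨h11 j hj, 0, by omega, fun i hi => ?_⟩
    simp only [setN_na, putN_na, if_true]
    split_ifs with h1
    · rw [h1]
    · exact hI i (by omega)
  · rintro t m' hs ⟨k, ht, hI⟩
    rw [h.nv7] at ht hI
    exact ⟨by omega, hI⟩

lemma wp_bucketPass (h : HasDigits c β B dig m) : WP B bucketPass m fun t m' =>
    t ≤ 27 * β + 60 * c + 40 ∧ ∀ i < c, m'.na 3 (bucketRank dig c i) = m.na 3 i := by
  rw [bucketPass, wp_seq]
  refine WP.mono (wp_clearBuckets h) fun t₁ m₁ hs₁ ⟨ht₁, h₁⟩ => ?_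
  have hd₁ := h.of_same hs₁ rfl
  rw [wp_seq]
  refine WP.mono (wp_countBuckets hd₁ h₁) fun t₂ m₂ hs₂ ⟨ht₂, h₂⟩ => ?_
  have hd₂ := hd₁.of_same hs₂ rfl
  rw [wp_seq]
  refine WP.mono (wp_locateBuckets hd₂ h₂) fun t₃ m₃ hs₃ ⟨ht₃, h₃⟩ => ?_
  have hd₃ := hd₂.of_same hs₃ rfl
  rw [wp_seq]
  refine WP.mono (wp_fillBuckets hd₃ h₃) fun t₄ m₄ hs₄ ⟨ht₄, h₄⟩ => ?_
  have hd₄ := hd₃.of_same hs₄ rfl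
  -- The new array is known only at the ranks. They exhaust all positions, so every entry to be
  -- copied back respects the word bound.
  have hmap : ∀ p < c, ∃ i < c, bucketRank dig c i = p := fun p hp => by
    have hinj : Function.Injective fun i : Fin c =>
        (⟨bucketRank dig c i, bucketRank_lt i.2⟩ : Fin c) := fun i j hij =>
      Fin.ext (bucketRank_injOn i.2 j.2 (congrArg Fin.val hij))
    obtain ⟨i, hi⟩ := (Finite.injective_iff_surjective.1 hinj) ⟨p, hp⟩
    exact ⟨i, i.2, congrArg Fin.val hi⟩
  refine WP.mono (wp_copyBack hd₄ fun p hp => ?_) fun t₅ m₅ hs₅ ⟨ht₅, h₅⟩ =>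
    ⟨by omega, fun i hi => ?_⟩
  · obtain ⟨i, hi, rfl⟩ := hmap p hp
    rw [h₄ i hi]
    exact hd₃.na3_le i hi
  · rw [h₅ _ (bucketRank_lt hi), h₄ i hi, hs₃.na 3 rfl, hs₂.na 3 rfl, hs₁.na 3 rfl]

end

/-! ### Radix sort of the leaves by natural keys -/

section

variable {n : ℕ} {T : WTree (Fin n) ℝ} {f g : Fin n → ℕ} {m : Mem} {B : ℕ}

/-- Collect the leaves in array `3`. -/
def collectLeaves : Prog :=
  .seq (.setN 7 (.const 0)) (.for 3 0 (.ite (.eqN (.get 4 (.var 3)) (.const 0))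
    (.ite (.eqN (.var 3) (.var 1)) .skip
      (.seq (.putN 3 (.var 7) (.var 3)) (.setN 7 (.add (.var 7) (.const 1))))) .skip))

/-- The maximal natural weight of an edge. -/
def maxWeight : Prog :=
  .seq (.setN 9 (.const 0)) (.for 3 0
    (.ite (.ltN (.var 9) (.get 2 (.var 3))) (.setN 9 (.get 2 (.var 3))) .skip))

def radixLoop : Prog :=
  .while (.ltN (.var 10) (.add (.var 9) (.const 1)))
    (.seq bucketPass (.setN 10 (.mul (.var 10) (.var 8))))

/-- Sort the leaves by decreasing natural keys. -/
def radixSort : Prog :=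
  .seq collectLeaves (.seq maxWeight (.seq (.setN 8 (.add (.var 0) (.const 1)))
    (.seq (.setN 10 (.const 1)) radixLoop)))

lemma wp_collectLeaves (hin : Input T f g m) (hB : n ≤ B) (h4 : ParentsMarked T m) :
    WP B collectLeaves m fun t m' => t ≤ 30 * n + 10 ∧ ∃ l, ListsLeaves T l m' := by
  simp only [collectLeaves, wp_seq, wp_setN, NExp.eval, NExp.cost]
  refine ⟨Nat.zero_le _, ?_⟩
  refine WP.mono (wp_for (fun j m' k => ∃ l : List (Fin n),
    (∀ v, v ∈ l ↔ T.IsLeaf v ∧ (v : ℕ) < j) ∧ l.Nodup ∧ m'.nv 7 = l.length ∧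
    ∀ i (h : i < l.length), m'.na 3 i = l[i]) 20 (k := 0) ⟨[], by simp⟩ (by decide) rfl rfl
    (by simpa [hin.nv0] using hB) ?_) ?_
  · rintro j m' k hj hs hij ⟨l, hl, hnd, h7, h3⟩
    simp only [setN_nv, OfNat.zero_ne_ofNat, if_false, hin.nv0] at hj
    have hin' : Input T f g m' := by
      refine Input.of_same (m := m.setN 7 0) ?_ hs rfl
      exact ⟨hin.nv0, hin.nv1, hin.na0, hin.na1, hin.na2, hin.ra0, hin.ra1⟩
    have e4 : m'.na 4 j = m.na 4 j := by rw [hs.na 4 rfl]; rfl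
    have hleaf := h4.isLeaf_iff ⟨j, hj⟩
    have hroot : (j = (T.root : ℕ)) ↔ (⟨j, hj⟩ : Fin n) = T.root := by rw [Fin.ext_iff]
    have hlen : l.length ≤ j := by
      have h1 := List.toFinset_card_of_nodup hnd
      have h2 : (l.toFinset.image Fin.val).card ≤ (Finset.range j).card := by
        refine Finset.card_le_card fun i hi => ?_
        simp only [Finset.mem_image, List.mem_toFinset] at hi
        obtain ⟨v, hv, rfl⟩ := hi
        simpa using ((hl v).1 hv).2
      rw [Finset.card_image_of_injective _ Fin.val_injective, Finset.card_range, h1] at h2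
      exact h2
    have hno : ¬ T.IsLeaf ⟨j, hj⟩ → ∀ v, v ∈ l ↔ T.IsLeaf v ∧ (v : ℕ) < j + 1 := fun h v => by
      rw [hl]
      refine and_congr_right fun hv => ?_
      have : (v : ℕ) ≠ j := fun hvj => h (by rwa [← (Fin.ext hvj : v = ⟨j, hj⟩)])
      omega
    simp only [wp_ite, wp_seq, wp_setN, wp_putN, wp_skip, Test.Holds, Test.cost, NExp.eval,
      NExp.cost, putN_nv, hij, hin'.nv1, e4, h7]
    refine ⟨fun h1 => ⟨fun h2 => ⟨0, by omega, l, ?_, hnd, h7, h3⟩,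
      fun h2 => ⟨by omega, by omega, 0, by omega, l ++ [⟨j, hj⟩], fun v => ?_, ?_, by simp,
        fun i hi => ?_⟩⟩, fun h1 => ⟨0, by omega, l, ?_, hnd, h7, h3⟩⟩
    · exact hno fun h => (hleaf.1 h).1 (hroot.1 h2)
    · rw [List.mem_append, hl, List.mem_singleton]
      have hj' : T.IsLeaf ⟨j, hj⟩ := hleaf.2 ⟨fun h => h2 (hroot.2 h), h1⟩
      constructor
      · rintro (h | rfl)
        · exact ⟨h.1, by omega⟩
        · exact ⟨hj', by simp⟩
      · rintro ⟨h, h'⟩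
        by_cases hvj : (v : ℕ) = j
        · exact .inr (Fin.ext hvj)
        · exact .inl ⟨h, by omega⟩
    · simp only [List.nodup_append, hnd, List.nodup_singleton, List.mem_singleton, true_and]
      rintro a ha b rfl rfl
      simpa using ((hl _).1 ha).2
    · rw [List.length_append, List.length_singleton] at hi
      simp only [setN_na, putN_na, if_true]
      by_cases hil : i = l.length
      · simp [hil]
      · rw [if_neg hil, List.getElem_append_left (by omega)]
        exact h3 i (by omega)
    · exact hno fun h => h1 (hleaf.1 h).2
  · rintro t m' hs ⟨k, ht, l, hl, hnd, h7, h3⟩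
    simp only [setN_nv, OfNat.zero_ne_ofNat, if_false, hin.nv0] at ht hl
    exact ⟨by omega, l, fun b => by rw [hl]; simp, hnd, h7, h3⟩

lemma wp_maxWeight (hin : Input T f g m) (hB : n ≤ B) {M : ℕ} (hM : ∀ v, g v ≤ M) (hMB : M ≤ B) :
    WP B maxWeight m fun t m' => t ≤ 20 * n + 10 ∧ (∀ v, g v ≤ m'.nv 9) ∧ m'.nv 9 ≤ M := by
  simp only [maxWeight, wp_seq, wp_setN, NExp.eval, NExp.cost]
  refine ⟨Nat.zero_le _, ?_⟩
  refine WP.mono (wp_for (fun j m' k => (∀ v : Fin n, (v : ℕ) < j → g v ≤ m'.nv 9) ∧ m'.nv 9 ≤ M)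
    13 (k := 0) (by simp) (by decide) rfl rfl (by simpa [hin.nv0] using hB) ?_) ?_
  · rintro j m' k hj hs hij ⟨hI, hI'⟩
    simp only [setN_nv, OfNat.zero_ne_ofNat, if_false, hin.nv0] at hj
    have hin' : Input T f g m' := by
      refine Input.of_same (m := m.setN 9 0) ?_ hs rfl
      exact ⟨hin.nv0, hin.nv1, hin.na0, hin.na1, hin.na2, hin.ra0, hin.ra1⟩
    have h2 := hin'.na2 ⟨j, hj⟩
    simp only at h2
    simp only [wp_ite, wp_setN, wp_skip, Test.Holds, Test.cost, NExp.eval, NExp.cost, hij, h2,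
      setN_nv, if_true, Nat.reduceEqDiff, if_false]
    refine ⟨fun h => ⟨(hM _).trans hMB, 0, by omega, fun v hv => ?_, hM _⟩,
      fun h => ⟨0, by omega, fun v hv => ?_, hI'⟩⟩
    · by_cases hvj : (v : ℕ) = j
      · rw [(Fin.ext hvj : v = ⟨j, hj⟩)]
      · exact (hI v (by omega)).trans h.le
    · by_cases hvj : (v : ℕ) = j
      · rw [(Fin.ext hvj : v = ⟨j, hj⟩)]; exact not_lt.1 h
      · exact hI v (by omega)
  · rintro t m' hs ⟨k, ht, hI, hI'⟩
    simp only [setN_nv, OfNat.zero_ne_ofNat, if_false, hin.nv0] at ht hI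
    exact ⟨by omega, fun v => hI v v.2, hI'⟩

/-- After `p` passes the list is sorted by the keys modulo `(n + 1) ^ p`. The loop stops once this
power exceeds the maximal weight, so the program need not know `K`. -/
lemma wp_radixLoop (hn : 1 ≤ n) {K : ℕ} (hB : (n + 1) ^ (K + 1) ≤ B) (κ : Fin n → ℕ)
    (hκ : ∀ v : Fin n, m.na 2 (m.na 5 v) = κ v) (h9 : ∀ v, κ v ≤ m.nv 9)
    (h9' : m.nv 9 ≤ (n + 1) ^ K) (h8 : m.nv 8 = n + 1) (h10 : m.nv 10 = 1) {l : List (Fin n)}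
    (hl : ListsLeaves T l m) :
    WP B radixLoop m fun t m' => t ≤ (K + 1) * (87 * n + 90) + 5 ∧
      ∃ l', ListsLeaves T l' m' ∧ l'.Pairwise fun a b => κ b ≤ κ a := by
  have hnB : n + 1 ≤ B := le_trans (by
    conv_lhs => rw [← pow_one (n + 1)]
    exact Nat.pow_le_pow_right (by omega) (by omega)) hB
  refine WP.mono (wp_while (fun m' k => ∃ p, ∃ l : List (Fin n), m'.nv 10 = (n + 1) ^ p ∧
    ListsLeaves T l m' ∧ (l.Pairwise fun a b => κ b % (n + 1) ^ p ≤ κ a % (n + 1) ^ p) ∧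
    k = (K + 1 - p) * (87 * n + 90)) (k := (K + 1) * (87 * n + 90))
    ⟨0, l, by simpa using h10, hl, by simp [Nat.mod_one, List.pairwise_iff_getElem], rfl⟩ ?_) ?_
  · clear hl h10 l
    rintro m' k hs ⟨p, l, h10, hl, hp, rfl⟩ hb
    have e9 : m'.nv 9 = m.nv 9 := hs.nv 9 rfl
    have e8 : m'.nv 8 = n + 1 := by rw [hs.nv 8 rfl, h8]
    have hκ' : ∀ v : Fin n, m'.na 2 (m'.na 5 v) = κ v := by
      rw [hs.na 2 rfl, hs.na 5 rfl]; exact hκ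
    simp only [Test.Holds, NExp.eval, h10, e9] at hb
    -- The test is passed only for `p ≤ K`. This gives at most `K + 1` passes and keeps the next
    -- power within the word bound.
    have hpK : p ≤ K := (Nat.pow_le_pow_iff_right (by omega : 1 < n + 1)).1 (by omega : (n + 1) ^ p ≤ (n + 1) ^ K)
    have hln := hl.length_le
    let dig : ℕ → ℕ := fun i => if h : i < l.length then κ l[i] / (n + 1) ^ p % (n + 1) else 0
    have hdig : HasDigits l.length (n + 1) B dig m' := by
      refine ⟨hl.nv7, e8, fun i hi => ?_, fun i hi => ?_, fun i hi => ?_, by omega, hnB⟩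
      · simp only [hl.na3 i hi, hκ', h10, e8, dig, dif_pos hi]
      · simp only [dig, dif_pos hi]
        exact Nat.mod_lt _ (Nat.succ_pos n)
      · rw [hl.na3 i hi]
        have := l[i].2
        omega
    rw [wp_seq]
    refine WP.mono (wp_bucketPass hdig) fun t m₁ hs₁ ⟨ht, h₁⟩ => ?_
    have e10 : m₁.nv 10 = (n + 1) ^ p := by rw [hs₁.nv 10 rfl, h10]
    have e8' : m₁.nv 8 = n + 1 := by rw [hs₁.nv 8 rfl, e8]
    simp only [wp_setN, NExp.eval, NExp.cost, Test.cost, e10, e8', ← pow_succ]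
    obtain ⟨l', hperm, hget, hsort⟩ := exists_bucketSorted l dig
    have hlen := hperm.length_eq
    refine ⟨le_trans (Nat.pow_le_pow_right (by omega) (by omega)) hB,
      (K + 1 - (p + 1)) * (87 * n + 90), ?_, p + 1, l', by simp,
      ⟨fun b => by rw [hperm.mem_iff, hl.mem], hperm.nodup_iff.2 hl.nodup, ?_, fun i hi => ?_⟩,
      ?_, rfl⟩
    · obtain ⟨q, rfl⟩ := Nat.exists_eq_add_of_le hpK
      rw [show p + q + 1 - p = q + 1 by omega, show p + q + 1 - (p + 1) = q by omega, Nat.add_mul]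
      omega
    · rw [setN_nv, if_neg (by decide), hs₁.nv 7 rfl, hl.nv7, hlen]
    · rw [setN_na]
      have hinj : Function.Injective fun i : Fin l.length =>
          (⟨bucketRank dig l.length i, bucketRank_lt i.2⟩ : Fin l.length) := fun i j hij =>
        Fin.ext (bucketRank_injOn i.2 j.2 (congrArg Fin.val hij))
      obtain ⟨⟨j, hj⟩, hji⟩ := (Finite.injective_iff_surjective.1 hinj) ⟨i, by omega⟩
      have hji' : bucketRank dig l.length j = i := congrArg Fin.val hji
      subst hji'
      rw [h₁ j hj, hget j hj hi, hl.na3 j hj]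
    · rw [List.pairwise_iff_getElem]
      intro i j hi hj hij
      obtain ⟨a, b, ha, hb', ea, eb, hab⟩ := hsort i j hi hj hij
      -- The new digit is the leading one of the residue. If it differs it decides; if not,
      -- stability preserves the order by the lower digits.
      rw [ea, eb, pow_succ, Nat.mod_mul, Nat.mod_mul]
      simp only [dig, dif_pos ha, dif_pos hb'] at hab
      rcases hab with hab | ⟨hab, hlt⟩
      · have h1 : κ l[b] % (n + 1) ^ p < (n + 1) ^ p := Nat.mod_lt _ (by positivity)
        have h2 := Nat.mul_le_mul_left ((n + 1) ^ p) (Nat.succ_le_of_lt hab)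
        rw [Nat.succ_eq_add_one, Nat.mul_add, Nat.mul_one] at h2
        linarith [Nat.zero_le (κ l[a] % (n + 1) ^ p)]
      · have h1 := List.pairwise_iff_getElem.1 hp a b ha hb' hlt
        rw [hab]
        omega
  · rintro t m' hs ⟨hb, k, ⟨p, l, h10, hl, hp, rfl⟩, ht⟩
    have e9 : m'.nv 9 = m.nv 9 := hs.nv 9 rfl
    simp only [Test.Holds, NExp.eval, h10, e9] at hb
    simp only [Test.cost, NExp.cost] at ht
    refine ⟨by omega, l, hl, hp.imp fun {a b} hab => ?_⟩
    rwa [Nat.mod_eq_of_lt (lt_of_le_of_lt (h9 b) (by omega)),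
      Nat.mod_eq_of_lt (lt_of_le_of_lt (h9 a) (by omega))] at hab

lemma wp_radixSort (hin : Input T f g m) (h4 : ParentsMarked T m) (hdom : ∀ v, DomAt T m v)
    {K : ℕ} (hB : (n + 1) ^ (K + 1) ≤ B) (hg : ∀ v, g v ≤ (n + 1) ^ K)
    (hgT : ∀ v, (g v : ℝ) = T.inWeight v) :
    WP B radixSort m fun t m' => t ≤ (K + 1) * (87 * n + 90) + 50 * n + 50 ∧
      ∃ l, ListsLeaves T l m' ∧ l.Pairwise fun a b => T.key b ≤ T.key a := by
  have hn : 1 ≤ n := by have := T.root.2; omega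
  have hKB : (n + 1) ^ K ≤ B := (Nat.pow_le_pow_right (by omega) (by omega)).trans hB
  have hnB : n + 1 ≤ B := le_trans (by
    conv_lhs => rw [← pow_one (n + 1)]
    exact Nat.pow_le_pow_right (by omega) (by omega)) hB
  choose d hd hd' using hdom
  rw [radixSort, wp_seq]
  refine WP.mono (wp_collectLeaves hin (by omega) h4) fun t₁ m₁ hs₁ ⟨ht₁, l, hl⟩ => ?_
  have hin₁ := hin.of_same hs₁ rfl
  rw [wp_seq]
  refine WP.mono (wp_maxWeight hin₁ (by omega) hg hKB) fun t₂ m₂ hs₂ ⟨ht₂, h9, h9'⟩ => ?_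
  have hin₂ := hin₁.of_same hs₂ rfl
  simp only [wp_seq, wp_setN, NExp.eval, NExp.cost, hin₂.nv0]
  refine ⟨hnB, by omega, ?_⟩
  have e5 : m₂.na 5 = m.na 5 := by rw [hs₂.na 5 rfl, hs₁.na 5 rfl]
  refine WP.mono (wp_radixLoop (T := T) hn hB (fun v => g (d v)) (fun v => ?_) (fun v => h9 (d v))
    h9' (by simp) (by simp) (l := l) ⟨hl.mem, hl.nodup, ?_, ?_⟩) fun t m' _ ⟨ht, l', h1, h2⟩ =>
    ⟨by omega, l', h1, h2.imp fun {a b} hab => ?_⟩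
  · simp only [setN_na, e5, hd, hin₂.na2]
  · rw [setN_nv, if_neg (by decide), setN_nv, if_neg (by decide), hs₂.nv 7 rfl, hl.nv7]
  · rw [setN_na, setN_na, hs₂.na 3 rfl]
    exact hl.na3
  · rw [← hd', ← hd', ← hgT, ← hgT]
    exact_mod_cast hab

end

end RAM

/-! ### The complete programs and their running times -/

namespace RAM

section

variable {n : ℕ} {T : WTree (Fin n) ℝ} {f g : Fin n → ℕ} {m : Mem} {B : ℕ}

lemma arr_apply {R : Type*} [Zero R] (h : Fin n → R) (v : Fin n) : arr h v = h v := by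
  rw [arr, dif_pos v.2]

/-- The program for real weights. -/
def realProgram : Prog :=
  .seq markParents (.seq dominators (.seq tournamentSort agents))

/-- Convert natural weights to real weights. -/
def convert : Prog :=
  .for 3 0 (.seq (.putR 0 (.var 3) (.ofNat (.get 1 (.var 3))))
    (.putR 1 (.var 3) (.ofNat (.get 2 (.var 3)))))

/-- The program for natural weights. -/
def natProgram : Prog :=
  .seq convert (.seq markParents (.seq dominators (.seq radixSort agents)))

/-- Natural arrays `1` and `2` are empty here, so the shared programs run with natural weights `0`.
-/
lemma input_realInput (T : WTree (Fin n) ℝ) :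
    Input T (fun _ => 0) (fun _ => 0) (realInput T) := by
  constructor <;> simp [realInput, arr_apply]

lemma wp_realProgram (T : WTree (Fin n) ℝ) (hB : n ≤ B) (hB1 : 1 ≤ B) {r : ℕ} (hr : n < 2 ^ r) :
    WP B realProgram (realInput T) fun t m' => t ≤ n * (27 * r + 330) + 110 ∧ HasOrder T m' ∧
      T.IsOptimalNumber (m'.rv 0) := by
  have hin := input_realInput T
  rw [realProgram, wp_seq]
  refine WP.mono (wp_markParents hin (by simp [realInput]) hB hB1) fun t₁ m₁ hs₁ ⟨ht₁, h₁⟩ => ?_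
  have hin₁ := hin.of_same hs₁ rfl
  rw [wp_seq]
  refine WP.mono (wp_dominators hin₁ (by rw [hs₁.na 6 rfl]; simp [realInput]) hB hB1)
    fun t₂ m₂ hs₂ ⟨ht₂, h₂⟩ => ?_
  have hin₂ := hin₁.of_same hs₂ rfl
  have h4₂ : ParentsMarked T m₂ := by rw [ParentsMarked, hs₂.na 4 rfl]; exact h₁
  rw [wp_seq]
  refine WP.mono (wp_tournamentSort hin₂ hB h4₂ h₂ hr) fun t₃ m₃ hs₃ ⟨ht₃, l, hl, hsort⟩ => ?_
  have hin₃ := hin₂.of_same hs₃ rfl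
  refine WP.mono (wp_agents hin₃ hB hB1 (by simp) (fun v => ?_) hl hsort ?_)
    fun t₄ m₄ hs₄ ⟨ht₄, h1, h2, _⟩ => ⟨?_, h1, h2⟩
  · rw [DomAt, hs₃.na 5 rfl]; exact h₂ v
  · rw [hs₃.na 9 rfl, hs₂.na 9 rfl, hs₁.na 9 rfl]; simp [realInput]
  · rw [Nat.mul_add] at ht₃ ⊢
    omega

theorem real_upperBound : ∃ (P : Prog) (C : ℕ), ∀ (n : ℕ) (T : WTree (Fin n) ℝ),
    ∃ (t : ℕ) (m : Mem), Runs ((n + 1) ^ C) P (realInput T) t m ∧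
      (t : ℝ) ≤ C * (n * Real.log n + 1) ∧ HasOrder T m ∧ T.IsOptimalNumber (m.rv 0) := by
  suffices h : ∀ C : ℕ, 1000 ≤ C → ∀ (n : ℕ) (T : WTree (Fin n) ℝ),
      ∃ (t : ℕ) (m : Mem), Runs ((n + 1) ^ C) realProgram (realInput T) t m ∧
        (t : ℝ) ≤ C * (n * Real.log n + 1) ∧ HasOrder T m ∧ T.IsOptimalNumber (m.rv 0) from
    ⟨realProgram, 1000, h 1000 le_rfl⟩
  intro C hC n T
  have hn : 1 ≤ n := by have := T.root.2; omega
  have hB : n ≤ (n + 1) ^ C := (Nat.le_succ n).trans (Nat.le_self_pow (by omega) _)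
  obtain ⟨t, m, hr, ht, h1, h2⟩ := wp_realProgram T hB (hn.trans hB)
    (Nat.lt_pow_succ_log_self (b := 2) (by norm_num) n)
  refine ⟨t, m, hr, ?_, h1, h2⟩
  have ht' : (t : ℝ) ≤ n * (27 * (Nat.log 2 n + 1) + 330) + 110 := by exact_mod_cast ht
  have hC' : (1000 : ℝ) ≤ C := by exact_mod_cast hC
  have h0 : 0 ≤ (n : ℝ) * Real.log n := mul_nonneg (Nat.cast_nonneg n) (Real.log_natCast_nonneg n)
  refine (ht'.trans ?_).trans (mul_le_mul_of_nonneg_right hC' (by linarith))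
  clear hr hB
  -- For `n = 1` the logarithm vanishes and the summand `1` of the bound pays for everything.
  rcases hn.eq_or_lt with rfl | hn
  · norm_num
  · have hn' : (2 : ℝ) ≤ n := by exact_mod_cast hn
    have hl2 : (1 / 2 : ℝ) < Real.log 2 := by have := Real.log_two_gt_d9; linarith
    have hlog : (Nat.log 2 n : ℝ) * Real.log 2 ≤ Real.log n := by
      rw [← Real.log_pow]
      refine Real.log_le_log (by positivity) ?_
      exact_mod_cast Nat.pow_log_le_self 2 (by omega)
    have hln : Real.log 2 ≤ Real.log n := Real.log_le_log (by norm_num) hn'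
    -- Since `log 2` exceeds `1 / 2`. The same inequality absorbs the constants `27 + 330` into a
    -- multiple of `log n` below.
    have h3 : (Nat.log 2 n : ℝ) ≤ 2 * Real.log n := by nlinarith [Nat.cast_nonneg (α := ℝ) (Nat.log 2 n)]
    have h4 : (n : ℝ) * (27 * (Nat.log 2 n + 1) + 330) ≤ n * (800 * Real.log n) :=
      mul_le_mul_of_nonneg_left (by linarith) (by linarith)
    linarith

lemma inWeight_toReal (T : WTree (Fin n) ℕ) (v : Fin n) :
    T.toReal.inWeight v = (T.inWeight v : ℝ) := by
  by_cases h : v = T.root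
  · rw [WTree.inWeight, WTree.inWeight, if_pos h, if_pos (show v = T.toReal.root from h),
      Nat.cast_zero]
  · rw [WTree.inWeight, WTree.inWeight, if_neg h, if_neg (show v ≠ T.toReal.root from h)]
    rfl

/-- The programs shared with the real case compare real weights, which an integer input does not
contain; they are filled in here. -/
lemma wp_convert (T : WTree (Fin n) ℕ) (hB : n ≤ B) :
    WP B convert (natInput T) fun t m' => t ≤ 20 * n + 5 ∧ Input T.toReal T.vw T.inWeight m' := by
  refine WP.mono (wp_for (fun j m' k => ∀ v : Fin n, (v : ℕ) < j →
    m'.ra 0 v = T.vw v ∧ m'.ra 1 v = T.inWeight v) 10 (k := 0) (by simp) (by decide) rfl rfl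
    (by simpa [natInput] using hB) ?_) ?_
  · rintro j m' k hj hs hij hI
    have hj : j < n := hj
    have h1 := hs.na 1 rfl
    have h2 := hs.na 2 rfl
    simp only [wp_seq, wp_putR, NExp.eval, NExp.cost, RExp.eval, RExp.cost, putR_nv, putR_na,
      hij, h1, h2]
    refine ⟨0, by omega, fun v hv => ?_⟩
    by_cases hvj : (v : ℕ) = j
    · subst hvj
      simp [natInput, arr_apply]
    · simpa [hvj] using hI v (by omega)
  · rintro t m' hs ⟨k, ht, hI⟩
    have h0 : (natInput T).nv 0 = n := rfl
    rw [h0] at ht hI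
    refine ⟨by omega, (hs.nv 0 rfl).trans h0, hs.nv 1 rfl, fun v => ?_, fun v => ?_, fun v => ?_,
      fun v => (hI v v.2).1, fun v => (hI v v.2).2.trans (inWeight_toReal T v).symm⟩
    · rw [hs.na 0 rfl]; exact arr_apply (fun v => (T.parent v : ℕ)) v
    · rw [hs.na 1 rfl]; exact arr_apply _ v
    · rw [hs.na 2 rfl]; exact arr_apply _ v

lemma inWeight_le_of_boundedBy {T : WTree (Fin n) ℕ} {M : ℕ} (hT : T.BoundedBy M) (v : Fin n) :
    T.inWeight v ≤ M := by
  rw [WTree.inWeight]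
  split_ifs with h
  · exact Nat.zero_le _
  · exact hT.2 _ (T.toReal.adj_parent h)

lemma wp_natProgram (T : WTree (Fin n) ℕ) {K : ℕ} (hB : (n + 1) ^ (K + 1) ≤ B)
    (hT : T.BoundedBy ((n + 1) ^ K)) :
    WP B natProgram (natInput T) fun t m' => t ≤ (K + 1) * (87 * n + 90) + 300 * n + 150 ∧
      HasOrder T.toReal m' ∧ T.toReal.IsOptimalNumber (m'.nv 2) := by
  have hn : 1 ≤ n := by have := T.root.2; omega
  have hnB : n + 1 ≤ B := le_trans (by
    conv_lhs => rw [← pow_one (n + 1)]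
    exact Nat.pow_le_pow_right (by omega) (by omega)) hB
  have hg := inWeight_le_of_boundedBy hT
  -- One edge weight and `n` vertex weights, each at most `(n + 1) ^ K`, add up to at most `(n + 1)
  -- ^ (K + 1)`. So the number of agents fits into a word.
  have hf : ∀ v, T.inWeight v + ∑ u, T.vw u ≤ B := fun v => by
    refine le_trans ?_ hB
    have h1 : ∑ u, T.vw u ≤ n * (n + 1) ^ K := by
      refine (Finset.sum_le_sum fun u _ => hT.1 u).trans ?_
      simp
    have h2 := hg v
    rw [pow_succ, Nat.mul_add, Nat.mul_one, Nat.mul_comm _ n]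
    omega
  rw [natProgram, wp_seq]
  refine WP.mono (wp_convert T (by omega)) fun t₀ m₀ hs₀ ⟨ht₀, hin⟩ => ?_
  rw [wp_seq]
  refine WP.mono (wp_markParents hin (by rw [hs₀.na 4 rfl]; simp [natInput]) (by omega) (by omega))
    fun t₁ m₁ hs₁ ⟨ht₁, h₁⟩ => ?_
  have hin₁ := hin.of_same hs₁ rfl
  rw [wp_seq]
  refine WP.mono (wp_dominators hin₁ (by rw [hs₁.na 6 rfl, hs₀.na 6 rfl]; simp [natInput])
    (by omega) (by omega)) fun t₂ m₂ hs₂ ⟨ht₂, h₂⟩ => ?_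
  have hin₂ := hin₁.of_same hs₂ rfl
  have h4₂ : ParentsMarked T.toReal m₂ := by rw [ParentsMarked, hs₂.na 4 rfl]; exact h₁
  rw [wp_seq]
  refine WP.mono (wp_radixSort hin₂ h4₂ h₂ hB hg fun v => (inWeight_toReal T v).symm)
    fun t₃ m₃ hs₃ ⟨ht₃, l, hl, hsort⟩ => ?_
  have hin₃ := hin₂.of_same hs₃ rfl
  refine WP.mono (wp_agents hin₃ (by omega) (by omega) hf (fun v => ?_) hl hsort ?_)
    fun t₄ m₄ hs₄ ⟨ht₄, h1, h2, h3⟩ => ⟨by omega, h1, ?_⟩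
  · rw [DomAt, hs₃.na 5 rfl]; exact h₂ v
  · rw [hs₃.na 9 rfl, hs₂.na 9 rfl, hs₁.na 9 rfl, hs₀.na 9 rfl]; simp [natInput]
  · rw [h3 (fun _ => rfl) fun v => (inWeight_toReal T v).symm]
    exact h2

theorem nat_upperBound : ∃ (P : Prog) (C : ℕ), ∀ (k n : ℕ) (T : WTree (Fin n) ℕ),
    T.BoundedBy ((n + 1) ^ k) → ∃ (t : ℕ) (m : Mem),
      Runs ((n + 1) ^ (k + C)) P (natInput T) t m ∧ t ≤ C * (k + 1) * n ∧
      HasOrder T.toReal m ∧ T.toReal.IsOptimalNumber (m.nv 2) := by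
  suffices h : ∀ C : ℕ, 1000 ≤ C → ∀ (k n : ℕ) (T : WTree (Fin n) ℕ),
      T.BoundedBy ((n + 1) ^ k) → ∃ (t : ℕ) (m : Mem),
        Runs ((n + 1) ^ (k + C)) natProgram (natInput T) t m ∧ t ≤ C * (k + 1) * n ∧
        HasOrder T.toReal m ∧ T.toReal.IsOptimalNumber (m.nv 2) from
    ⟨natProgram, 1000, h 1000 le_rfl⟩
  intro C hC k n T hT
  have hn : 1 ≤ n := by have := T.root.2; omega
  obtain ⟨t, m, hr, ht, h1, h2⟩ := wp_natProgram T (K := k) (B := (n + 1) ^ (k + C))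
    (Nat.pow_le_pow_right (by omega) (by omega)) hT
  refine ⟨t, m, hr, ht.trans ?_, h1, h2⟩
  have e1 : (k + 1) * (87 * n + 90) ≤ (k + 1) * (177 * n) := Nat.mul_le_mul_left _ (by omega)
  have e2 : n ≤ (k + 1) * n := Nat.le_mul_of_pos_left n (by omega)
  have e3 : (k + 1) * (177 * n) = 177 * ((k + 1) * n) := by ring
  have e4 : 1000 * ((k + 1) * n) ≤ C * ((k + 1) * n) := Nat.mul_le_mul_right _ hC
  rw [Nat.mul_assoc]
  omega

end

end RAM

theorem mainTheorem2 :
    -- The collected subtrees are disjoint, can be sorted by their dominating edges, and each of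
    -- them can be explored (for example by a depth first walk, which has the stated length).
    -- Visiting them in decreasing order of the dominating edges and fully exploring each one, in
    -- any way, before leaving it, is an optimal strategy.
    (∀ (V : Type*) [Fintype V] [DecidableEq V] (T : WTree V ℝ),
      (∀ u v, T.IsCollectedRoot u → T.IsCollectedRoot v → u ≠ v →
        Disjoint (T.collected u) (T.collected v)) ∧
      (∃ L, T.IsDecreasingList L) ∧
      (∀ v, T.IsCollectedRoot v → ∃ c : T.graph.Walk v v,
        T.Explores c ∧ c.length = 2 * ((T.collected v).ncard - 1)) ∧
      ∀ (L : List V) (c : ∀ v, T.graph.Walk v v), T.IsDecreasingList L →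
        (∀ v ∈ L, T.Explores (c v)) → ∃ K, T.IsOptimalStrategy K (T.tour c L)) ∧
    -- Real weights, upper bound `O(n log n)`, with words of `O(log n)` bits for natural numbers.
    (∃ (P : RAM.Prog) (C : ℕ), ∀ (n : ℕ) (T : WTree (Fin n) ℝ), ∃ (t : ℕ) (m : RAM.Mem),
      RAM.Runs ((n + 1) ^ C) P (RAM.realInput T) t m ∧
      (t : ℝ) ≤ C * (n * Real.log n + 1) ∧
      RAM.HasOrder T m ∧ T.IsOptimalNumber (m.rv 0)) ∧
    -- Real weights, lower bound `Ω(n log n)` for the same machine with words of any length.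
    (∃ c : ℝ, 0 < c ∧ ∀ (P : RAM.Prog) (B f : ℕ → ℕ),
      (∀ (n : ℕ) (T : WTree (Fin n) ℝ), T.Positive → ∃ t ≤ f n, ∃ m : RAM.Mem,
        RAM.Runs (B n) P (RAM.realInput T) t m ∧ RAM.HasOrder T m) →
      ∀ n : ℕ, 1 ≤ n → c * (n * Real.log n) ≤ f n) ∧
    -- Real weights, lower bound `Ω(n log n)` for algebraic decision trees.
    (∃ c : ℝ, 0 < c ∧ ∀ n : ℕ, 3 ≤ n →
      ∃ (G : SimpleGraph (Fin n)) (r : Fin n), G.IsTree ∧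
        ∀ D : DecTree (Fin n ⊕ Sym2 (Fin n)) (List (Fin n)),
          (∀ T : WTree (Fin n) ℝ, T.graph = G → T.root = r → T.Positive →
            T.IsOptimalLeafOrder (D.eval (Sum.elim T.vw T.ew))) →
          c * (n * Real.log n) ≤ D.depth) ∧
    -- Integer weights, upper bound: `O(n)` for weights that are polynomial in `n`.
    (∃ (P : RAM.Prog) (C : ℕ), ∀ (k n : ℕ) (T : WTree (Fin n) ℕ), T.BoundedBy ((n + 1) ^ k) →
      ∃ (t : ℕ) (m : RAM.Mem),
        RAM.Runs ((n + 1) ^ (k + C)) P (RAM.natInput T) t m ∧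
        t ≤ C * (k + 1) * n ∧
        RAM.HasOrder T.toReal m ∧ T.toReal.IsOptimalNumber (m.nv 2)) ∧
    -- Integer weights, lower bound `Ω(n)`.
    (∃ c : ℝ, 0 < c ∧ ∀ (k : ℕ) (P : RAM.Prog) (B f : ℕ → ℕ),
      (∀ (n : ℕ) (T : WTree (Fin n) ℕ), T.BoundedBy ((n + 1) ^ k) → ∃ t ≤ f n, ∃ m : RAM.Mem,
        RAM.Runs (B n) P (RAM.natInput T) t m ∧ RAM.HasOrder T.toReal m) →
      ∀ n : ℕ, 1 ≤ n → c * n ≤ f n) := by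
  refine ⟨fun V _ _ T => ⟨fun u v _ _ huv => T.collected_disjoint huv, T.exists_isDecreasingList,
    fun v hv => T.exists_explores hv, fun L c hL hc => T.exists_isOptimalStrategy_tour hL hc⟩,
    RAM.real_upperBound, RAM.real_lowerBound, decTree_lowerBound, RAM.nat_upperBound,
    RAM.nat_lowerBound⟩
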